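/- **Setting.** Let $\mathbb H_{\mathbb C}=\mathbb C\otimes\mathbb H$ be the algebra of complex $2\times 2$ matrices, with units $e_0=1$, $e_1=\begin{pmatrix}0&-i\\-i&0\end{pmatrix}$, $e_2=\begin{pmatrix}0&-1\\1&0\end{pmatrix}$, $e_3=\begin{pmatrix}-i&0\\0&i\end{pmatrix}$ and quadratic form $N(Z)=\det Z$. Write $Z=z^0e_0+z^1e_1+z^2e_2+z^3e_3$ with $z^j\in\mathbb C$. Minkowski space is $\mathbb M=\{Z\in\mathbb H_{\mathbb C}: Z^*=-Z\}$, with real basis $\tilde e_0=-ie_0,e_1,e_2,e_3$ and real coordinates $y^0,\dots,y^3$. Put $$Dz=e_0\,dz^1\wedge dz^2\wedge dz^3-e_1\,dz^0\wedge dz^2\wedge dz^3+e_2\,dz^0\wedge dz^1\wedge dz^3-e_3\,dz^0\wedge dz^1\wedge dz^2 .$$ Fix $m\ge 0$. Functions take values in the complex $2\times m$ matrices, on which $\mathbb H_{\mathbb C}$ acts by left multiplication ($m=2$: $\mathbb H_{\mathbb C}$-valued functions; $m=1$: spinor-valued functions). A real-differentiable function $f$ on $\mathbb M$ is left-regular if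 $$-\tilde e_0\,\partial f/\partial y^0+e_1\,\partial f/\partial y^1+e_2\,\partial f/\partial y^2+e_3\,\partial f/\partial y^3=0 .$$ For a function $h$ put $$(Th)(X)=\frac{(iX-1)^{-1}}{N(iX-1)}\,h\bigl((X-i)(X+i)^{-1}\bigr),\qquad N(X+i)\neq0 ;$$ the map $X\mapsto (X-i)(X+i)^{-1}$ sends $\{X\in U(2): N(X+i)\ne0\}$ into $\mathbb M$. Let $\mathcal V(\mathbb M)$ be the space of left-regular functions $f$ on $\mathbb M$ such that $Tf$, defined on $\{X\in U(2): N(X+i)\neq 0\}$, extends to a holomorphic function on an open neighbourhood of $U(2)$ in $\mathbb H_{\mathbb C}$. A *continuation* of $f\in\mathcal V(\mathbb M)$ is a function $f^{\mathbb C}$ on $\mathbb H_{\mathbb C}$ which equals $f$ on $\mathbb M$ and for which there are an open $W\supseteq U(2)$ and a holomorphic function $F$ on $W$ with $F=Tf^{\mathbb C}$ on $\{X\in W: N(X+i)\ne0\}$. (The values of $f^{\mathbb C}$ at points that are not of the form $(X-i)(X+i)^{-1}$ with $X\in W$ and that lie off $\mathbb M$ are irrelevant.) For $R>0$ let $H_R=\{Y\in\mathbb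 M: N(Y)=-R^2\}$, a two-sheeted hyperboloid, oriented so that $\{e_1,e_2,e_3\}$ is a positively oriented basis of its tangent spaces at $\pm iR$. For $Y\in\mathbb M$ with $N(Y)<0$ and $\epsilon\in\mathbb R$ let $Y^\epsilon=(1+i\epsilon)Y$ if $i\operatorname{Tr}Y>0$ and $Y^\epsilon=(1-i\epsilon)Y$ if $i\operatorname{Tr}Y<0$, and let $H_R^\epsilon=\{Y^\epsilon: Y\in H_R\}$, with the orientation induced from $H_R$. **Theorem.** Let $f\in\mathcal V(\mathbb M)$. Then $f$ has a continuation. For every continuation $f^{\mathbb C}$ of $f$ there is $\epsilon_0>0$ such that for all $0<\epsilon<\epsilon_0$ and all $R,R'>0$ the function $f^{\mathbb C}$ is holomorphic (complex differentiable) at every point of $H_R^{\epsilon}\cup H_{R'}^{-\epsilon}$, and for every $Y_0\in\mathbb M$ with $N(Y_0)<0$ one has $N(Z-Y_0)\ne0$ on $H_R^{\epsilon}\cup H_{R'}^{-\epsilon}$, the integrals below converge absolutely, and $$f(Y_0)=\frac1{2\pi^2}\int_{H_R^{\epsilon}-H_{R'}^{-\epsilon}}\frac{(Z-Y_0)^{-1}}{N(Z-Y_0)}\cdot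 Dz\cdot f^{\mathbb C}(Z),$$ where $\int_{H_R^{\epsilon}-H_{R'}^{-\epsilon}}$ means the integral over $H_R^{\epsilon}$ minus the integral over $H_{R'}^{-\epsilon}$. -/

import Mathlib

namespace MinkowskiFueter

open Complex MeasureTheory

/-- The complexified quaternions, realized as complex `2 × 2` matrices. The quadratic form `N` is
the determinant. -/
abbrev HC : Type := Matrix (Fin 2) (Fin 2) ℂ

/-- The values of the functions considered: complex `2 × m` matrices, on which `HC` acts by left
multiplication. For `m = 2` this is `HC` itself, for `m = 1` it is the space of spinors. -/
abbrev Val (m : ℕ) : Type := Matrix (Fin 2) (Fin m) ℂ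

/-- The quaternionic units `e₀, e₁, e₂, e₃`. -/
noncomputable def e : Fin 4 → HC :=
  ![1, !![0, -I; -I, 0], !![0, -1; 1, 0], !![-I, 0; 0, I]]

/-- The coordinates `z⁰, z¹, z², z³` of `Z = z⁰ e₀ + z¹ e₁ + z² e₂ + z³ e₃`. -/
noncomputable def coord (Z : HC) : Fin 4 → ℂ :=
  ![(Z 0 0 + Z 1 1) / 2, I * (Z 0 1 + Z 1 0) / 2, (Z 1 0 - Z 0 1) / 2, I * (Z 0 0 - Z 1 1) / 2]

lemma sum_coord (Z : HC) : ∑ j, coord Z j • e j = Z := by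
  ext a b
  fin_cases a <;> fin_cases b <;> simp [coord, e, Fin.sum_univ_four] <;> ring_nf <;>
    simp [I_sq] <;> ring

/-- Minkowski space `𝕄 = {Z : Z* = -Z}`, a real form of `HC`. -/
noncomputable abbrev Minkowski : Submodule ℝ HC := skewAdjoint.submodule ℝ HC

/-- The basis `ẽ₀ = -i e₀, e₁, e₂, e₃` of Minkowski space. -/
noncomputable def et : Fin 4 → HC := ![-I • e 0, e 1, e 2, e 3]

lemma et_mem (j : Fin 4) : et j ∈ Minkowski := by
  change star (et j) = -et j
  ext a b
  fin_cases j <;> fin_cases a <;> fin_cases b <;> simp [et, e, Matrix.star_apply]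

/-- The partial derivative `∂f/∂yʲ` at `Y` of a function on Minkowski space. -/
noncomputable def pderiv {m : ℕ} (j : Fin 4) (f : Minkowski → Val m) (Y : Minkowski) : Val m :=
  fderiv ℝ f Y ⟨et j, et_mem j⟩

/-- Left-regular functions on Minkowski space. -/
def LeftRegular {m : ℕ} (f : Minkowski → Val m) : Prop :=
  Differentiable ℝ f ∧ ∀ Y : Minkowski,
    -(et 0 * pderiv 0 f Y) + et 1 * pderiv 1 f Y + et 2 * pderiv 2 f Y + et 3 * pderiv 3 f Y = 0

/-- For `g = (a b; c d)`, the fractional linear map `X ↦ (a X + b) (c X + d)⁻¹`. -/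
noncomputable def fracLin (g : Matrix (Fin 2) (Fin 2) HC) (X : HC) : HC :=
  (g 0 0 * X + g 0 1) * (g 1 0 * X + g 1 1)⁻¹

/-- For `g = (a b; c d)`, the factor `(c X + d)⁻¹ / N(c X + d)`. The action `π_l` on functions is
`(π_l(h) f)(X) = factor h⁻¹ X * f (fracLin h⁻¹ X)`. -/
noncomputable def factor (g : Matrix (Fin 2) (Fin 2) HC) (X : HC) : HC :=
  ((g 1 0 * X + g 1 1).det)⁻¹ • (g 1 0 * X + g 1 1)⁻¹

/-- The points at which the fractional linear map and the factor are defined. -/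
def Nonsing (g : Matrix (Fin 2) (Fin 2) HC) (X : HC) : Prop := (g 1 0 * X + g 1 1).det ≠ 0

/-- `γ = (i 1; i -1)`; thus `fracLin γ X = (X - i) (X + i)⁻¹` is the map `π_l(γ⁻¹)`. -/
noncomputable def γ : Matrix (Fin 2) (Fin 2) HC := !![I • 1, 1; I • 1, -1]

/-- The group `U(2) ⊆ HC`, a compactification of Minkowski space. -/
def U2 : Set HC := {X | X ∈ Matrix.unitaryGroup (Fin 2) ℂ}

lemma fracLin_γ_mem {X : HC} (hX : X ∈ U2) (h : Nonsing γ X) : fracLin γ X ∈ Minkowski := by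
  set A : HC := I • X + 1 with hA
  set B : HC := I • X - 1 with hB
  have hf : fracLin γ X = A * B⁻¹ := by
    simp [fracLin, γ, hA, hB, sub_eq_add_neg]
  have hdet : B.det ≠ 0 := by
    simpa [Nonsing, γ, hB, sub_eq_add_neg] using h
  have hdet' : (star B).det ≠ 0 := by
    rw [Matrix.star_eq_conjTranspose, Matrix.det_conjTranspose]
    exact star_ne_zero.2 hdet
  have hXX : star X * X = 1 := Matrix.mem_unitaryGroup_iff'.1 hX
  have key : star A * B = -(star B * A) := by
    simp only [hA, hB, star_add, star_sub, star_smul, star_one, mul_add, mul_sub, add_mul, sub_mul,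
      smul_mul_smul_comm, hXX, mul_one, one_mul]
    simp
    abel
  have hB' : B * B⁻¹ = 1 := Matrix.mul_nonsing_inv B (Ne.isUnit hdet)
  have hB'' : (star B)⁻¹ * star B = 1 := Matrix.nonsing_inv_mul _ (Ne.isUnit hdet')
  change star (fracLin γ X) = -fracLin γ X
  rw [hf, star_mul]
  have hs : star (B⁻¹) = (star B)⁻¹ := by
    rw [Matrix.star_eq_conjTranspose, Matrix.star_eq_conjTranspose,
      Matrix.conjTranspose_nonsing_inv]
  rw [hs]
  calc (star B)⁻¹ * star A = (star B)⁻¹ * (star A * B) * B⁻¹ := by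
        rw [mul_assoc, mul_assoc, hB', mul_one]
    _ = -(((star B)⁻¹ * star B) * (A * B⁻¹)) := by
        rw [key]; simp only [mul_neg, neg_mul, mul_assoc]
    _ = -(A * B⁻¹) := by rw [hB'', one_mul]

/-- The space `𝒱(𝕄)`: left-regular functions `f` on Minkowski space such that `π_l(γ⁻¹) f`
extends holomorphically to an open neighbourhood of `U(2)` in `HC`. -/
def V (m : ℕ) : Set (Minkowski → Val m) :=
  {f | LeftRegular f ∧ ∃ W : Set HC, IsOpen W ∧ U2 ⊆ W ∧ ∃ F : HC → Val m,
    DifferentiableOn ℂ F W ∧ ∀ (X : HC) (hX : X ∈ U2) (h : Nonsing γ X),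
      F X = factor γ X * f ⟨fracLin γ X, fracLin_γ_mem hX h⟩}

/-- `fC` is the holomorphic continuation of `f ∈ 𝒱(𝕄)` off Minkowski space given by a holomorphic
extension of `π_l(γ⁻¹) f`: it equals `f` on `𝕄`, and `π_l(γ⁻¹) fC` extends to a holomorphic
function on some open neighbourhood `W` of `U(2)`. -/
def IsContinuation {m : ℕ} (f : Minkowski → Val m) (fC : HC → Val m) : Prop :=
  (∀ Y : Minkowski, fC Y = f Y) ∧ ∃ W : Set HC, IsOpen W ∧ U2 ⊆ W ∧ ∃ F : HC → Val m,
    DifferentiableOn ℂ F W ∧ ∀ X ∈ W, Nonsing γ X → F X = factor γ X * fC (fracLin γ X)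

/-- The two-sheeted hyperboloid `H_R = {Y ∈ 𝕄 : N(Y) = -R²}`. -/
def hyperboloid (R : ℝ) : Set HC := {Y | Y ∈ Minkowski ∧ Y.det = -(R : ℂ) ^ 2}

open Classical in
/-- `Y^ε`, which is `(1 + iε) Y` if `i Tr Y > 0` and `(1 - iε) Y` if `i Tr Y < 0`. (The number
`i Tr Y` is real for `Y ∈ 𝕄`, and it is nonzero if moreover `N(Y) < 0`.) -/
noncomputable def deform (ε : ℝ) (Y : HC) : HC :=
  if 0 < (I * Y.trace).re then (1 + I * ε) • Y else (1 - I * ε) • Y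

/-- The deformed hyperboloid `H_R^ε`. -/
def deformedHyperboloid (R ε : ℝ) : Set HC := deform ε '' hyperboloid R

/-- For `σ = 1` and `σ = -1` these are global charts of the two sheets of `H_R`. The derivative in
the direction of the `j`-th coordinate at `y = 0` is `e_j` on both sheets, so both charts are
positively oriented for the orientation of `H_R` in which `e₁, e₂, e₃` is a positive basis of the
tangent spaces at `±iR`. -/
noncomputable def sheet (R σ : ℝ) (y : Fin 3 → ℝ) : HC :=
  (σ * √(R ^ 2 + ∑ j, y j ^ 2)) • et 0 + ∑ j : Fin 3, y j • et j.succ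

/-- The charts of the two sheets of `H_R^ε` (with the orientation induced from `H_R`). -/
noncomputable def deformedSheet (R ε σ : ℝ) (y : Fin 3 → ℝ) : HC := deform ε (sheet R σ y)

lemma range_sheet (R : ℝ) :
    Set.range (sheet R 1) ∪ Set.range (sheet R (-1)) = hyperboloid R := by
  ext Y
  simp only [Set.mem_union, Set.mem_range]
  constructor
  · have main : ∀ σ : ℝ, σ ^ 2 = 1 → ∀ y, sheet R σ y ∈ hyperboloid R := by
      intro σ hσ y
      refine ⟨?_, ?_⟩
      · exact Submodule.add_mem _ (Submodule.smul_mem _ _ (et_mem 0))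
          (Submodule.sum_mem _ fun j _ => Submodule.smul_mem _ _ (et_mem j.succ))
      · have hs : √(R ^ 2 + ∑ j, y j ^ 2) ^ 2 = R ^ 2 + ∑ j, y j ^ 2 :=
          Real.sq_sqrt (by positivity)
        have h2 : ((σ * √(R ^ 2 + ∑ j, y j ^ 2) : ℝ) : ℂ) ^ 2 =
            (R : ℂ) ^ 2 + (y 0 : ℂ) ^ 2 + (y 1 : ℂ) ^ 2 + (y 2 : ℂ) ^ 2 := by
          rw [← ofReal_pow, mul_pow, hσ, hs, Fin.sum_univ_three]
          push_cast
          ring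
        rw [sheet]
        generalize σ * √(R ^ 2 + ∑ j, y j ^ 2) = t at h2
        simp [Matrix.det_fin_two, Fin.sum_univ_three, et, e]
        linear_combination (-1 : ℂ) * h2 +
          ((t : ℂ) ^ 2 - (y 2 : ℂ) ^ 2 - (y 0 : ℂ) ^ 2) * I_sq
    rintro (⟨y, rfl⟩ | ⟨y, rfl⟩)
    · exact main 1 (by norm_num) y
    · exact main (-1) (by norm_num) y
  · rintro ⟨hM, hd⟩
    have hst : star Y = -Y := hM
    have h00 := congrFun (congrFun hst 0) 0
    have h11 := congrFun (congrFun hst 1) 1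
    have h01 := congrFun (congrFun hst 0) 1
    simp only [Matrix.star_apply, Matrix.neg_apply, Complex.ext_iff, RCLike.star_def, conj_re,
      conj_im, neg_re, neg_im] at h00 h11 h01
    rw [Matrix.det_fin_two] at hd
    have hd' := congrArg Complex.re hd
    simp [pow_two] at hd'
    have hr : (Y 0 0).re = 0 := by linarith [h00.1]
    have hi : (Y 1 0).im = (Y 0 1).im := by linarith [h01.2]
    rw [hr, h01.1, hi] at hd'
    set t : ℝ := -((Y 0 0).im + (Y 1 1).im) / 2 with ht
    set y : Fin 3 → ℝ := ![-(Y 0 1).im, -(Y 0 1).re, ((Y 1 1).im - (Y 0 0).im) / 2] with hy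
    have hsq : t ^ 2 = R ^ 2 + ∑ j, y j ^ 2 := by
      simp [Fin.sum_univ_three, hy, ht]
      linear_combination -hd'
    have hY : Y = t • et 0 + ∑ j : Fin 3, y j • et j.succ := by
      ext a b
      fin_cases a <;> fin_cases b <;>
        simp [Fin.sum_univ_three, et, e, hy, ht, Complex.ext_iff] <;>
        constructor <;> linarith
    rcases le_total 0 t with h | h
    · left
      refine ⟨y, ?_⟩
      rw [sheet, ← hsq, Real.sqrt_sq h, one_mul, ← hY]
    · right
      refine ⟨y, ?_⟩
      rw [sheet, ← hsq, Real.sqrt_sq_eq_abs, abs_of_nonpos h, neg_one_mul, neg_neg, ← hY]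

lemma range_deformedSheet (R ε : ℝ) :
    Set.range (deformedSheet R ε 1) ∪ Set.range (deformedSheet R ε (-1)) =
      deformedHyperboloid R ε := by
  rw [deformedHyperboloid, ← range_sheet R, Set.image_union, ← Set.range_comp,
    ← Set.range_comp]
  rfl

/-- The 3-form `dzⁱ ∧ dzʲ ∧ dzᵏ`. -/
noncomputable def wedge (i j k : Fin 4) (h : Fin 3 → HC) : ℂ :=
  Matrix.det (Matrix.of fun a b : Fin 3 => coord (h a) (![i, j, k] b))

/-- The holomorphic `HC`-valued 3-form `Dz = e₀ dz¹∧dz²∧dz³ - e₁ dz⁰∧dz²∧dz³ + e₂ dz⁰∧dz¹∧dz³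
- e₃ dz⁰∧dz¹∧dz²`, evaluated on a triple of tangent vectors. -/
noncomputable def Dz (h : Fin 3 → HC) : HC :=
  wedge 1 2 3 h • e 0 - wedge 0 2 3 h • e 1 + wedge 0 1 3 h • e 2 - wedge 0 1 2 h • e 3

/-- The 3-form `(Z - Y₀)⁻¹ / N(Z - Y₀) · Dz · f(Z)`, at the point `Z` and evaluated on a triple of
tangent vectors. -/
noncomputable def fueterForm {m : ℕ} (fC : HC → Val m) (Y₀ : HC) (Z : HC) (h : Fin 3 → HC) :
    Val m :=
  (((Z - Y₀).det)⁻¹ • (Z - Y₀)⁻¹) * Dz h * fC Z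

/-- The coefficient of the pull-back of a 3-form along a chart `φ : ℝ³ → HC`. -/
noncomputable def pullback {m : ℕ} (ω : HC → (Fin 3 → HC) → Val m) (φ : (Fin 3 → ℝ) → HC)
    (y : Fin 3 → ℝ) : Val m :=
  ω (φ y) fun j => fderiv ℝ φ y (Pi.single j 1)

/-- Absolute convergence of the integral of a 3-form over `H_R^ε` (all matrix entries are
absolutely integrable on both sheets). -/
def FormIntegrable {m : ℕ} (ω : HC → (Fin 3 → HC) → Val m) (R ε : ℝ) : Prop :=
  ∀ a b, Integrable (fun y => pullback ω (deformedSheet R ε 1) y a b) ∧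
    Integrable (fun y => pullback ω (deformedSheet R ε (-1)) y a b)

/-- The integral of a 3-form over the oriented two-sheeted deformed hyperboloid `H_R^ε`. -/
noncomputable def formIntegral {m : ℕ} (ω : HC → (Fin 3 → HC) → Val m) (R ε : ℝ) : Val m :=
  Matrix.of fun a b => (∫ y, pullback ω (deformedSheet R ε 1) y a b) +
    ∫ y, pullback ω (deformedSheet R ε (-1)) y a b

end MinkowskiFueter

/-!
Both deformed sheets consist of points `t Y`, where `Y` runs over a sheet of the unit hyperboloid
and `t` is a complex number in a sector about the positive real axis. Since the kernel
`K(Z - Y₀) = (Z - Y₀)⁻¹ / N(Z - Y₀)` and the continuation `φ` are regular, the `t`-derivative of the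
integrand in the chart `y ↦ t Y(y)` is a divergence, so the integral over a sheet is locally
constant in `t` as long as `N(t Y - Y₀)` stays away from zero. Decay at infinity comes from the
Cayley transform, which turns `φ` into a function bounded near the compact group `U(2)`.

On the sheet opposite to `Y₀` the kernel has no singularity in the whole sector, and the two
contributions cancel. On the sheet of `Y₀` the singularities lie at real `t`, and what remains is
the jump of the integral across the real axis. It is computed at `t = ρ (1 ± iη) / (1 ∓ iη)`, where
`ρ² = -N(Y₀)`, as `η → 0`: after the substitution `y = y' + η x` around the point `y'` below `Y₀`,
dominated convergence applies, and the limit integral equals `2π² φ(Y₀)`.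
-/

namespace MinkowskiFueter

open Complex MeasureTheory Filter Topology Set Asymptotics
open scoped Matrix.Norms.Operator

section MatrixNorm

variable {𝕜 : Type*} [NontriviallyNormedField 𝕜] [NormedAlgebra 𝕜 ℂ]
  {k l n : Type*} [Fintype k] [Fintype l] [Fintype n]

lemma isBoundedBilinearMap_matrix_mul :
    IsBoundedBilinearMap 𝕜 fun p : Matrix k l ℂ × Matrix l n ℂ => p.1 * p.2 where
  add_left _ _ _ := Matrix.add_mul _ _ _
  smul_left _ _ _ := Matrix.smul_mul _ _ _
  add_right _ _ _ := Matrix.mul_add _ _ _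
  smul_right _ _ _ := Matrix.mul_smul _ _ _
  bound := ⟨1, one_pos, fun A B => by simpa using Matrix.linfty_opNorm_mul A B⟩

end MatrixNorm

section MatrixCalculus

variable {𝕜 : Type*} [NontriviallyNormedField 𝕜] [NormedAlgebra 𝕜 ℂ]
  {k l n : Type*} [Finite k] [Fintype l] [Finite n]

lemma hasDerivAt_matrix_mul {A : 𝕜 → Matrix k l ℂ} {B : 𝕜 → Matrix l n ℂ} {A' : Matrix k l ℂ}
    {B' : Matrix l n ℂ} {t : 𝕜} (hA : HasDerivAt A A' t) (hB : HasDerivAt B B' t) :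
    HasDerivAt (fun t => A t * B t) (A' * B t + A t * B') t := by
  have := Fintype.ofFinite k
  have := Fintype.ofFinite n
  refine ((isBoundedBilinearMap_matrix_mul.hasFDerivAt (A t, B t)).comp_hasDerivAt t
    (hA.prodMk hB)).congr_deriv ?_
  rw [add_comm]
  rfl

lemma differentiableAt_matrix_mul {E : Type*} [NormedAddCommGroup E] [NormedSpace 𝕜 E]
    {A : E → Matrix k l ℂ} {B : E → Matrix l n ℂ} {x : E}
    (hA : DifferentiableAt 𝕜 A x) (hB : DifferentiableAt 𝕜 B x) :
    DifferentiableAt 𝕜 (fun x => A x * B x) x := by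
  have := Fintype.ofFinite k
  have := Fintype.ofFinite n
  exact DifferentiableAt.comp (g := fun p : Matrix k l ℂ × Matrix l n ℂ => p.1 * p.2) x
    (isBoundedBilinearMap_matrix_mul.differentiableAt (A x, B x)) (hA.prodMk hB)

end MatrixCalculus

section Coordinates

lemma coord_sum (z : Fin 4 → ℂ) : coord (∑ j, z j • e j) = z := by
  ext j
  fin_cases j <;> simp [coord, e, Fin.sum_univ_four] <;> ring_nf <;> simp [I_sq]

lemma coord_sub (Z W : HC) : coord (Z - W) = coord Z - coord W := by
  ext j
  fin_cases j <;> simp [coord] <;> ring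

lemma coord_smul (c : ℂ) (Z : HC) : coord (c • Z) = c • coord Z := by
  ext j
  fin_cases j <;> simp [coord] <;> ring

lemma coord_one : coord (1 : HC) = Pi.single 0 1 := by
  ext j
  fin_cases j <;> simp [coord]

lemma det_eq_sum_coord_sq (Z : HC) : Z.det = ∑ j, coord Z j ^ 2 := by
  simp [coord, Matrix.det_fin_two, Fin.sum_univ_four]
  linear_combination ((Z 0 1 + Z 1 0) ^ 2 / 4 + (Z 0 0 - Z 1 1) ^ 2 / 4) * (-I_sq)

end Coordinates

section Height

variable {ι : Type*} [Fintype ι]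

/-- The height `√(1 + |y|²)` of the point of a unit hyperboloid lying over `y`. -/
noncomputable def height (y : ι → ℝ) : ℝ := √(1 + y ⬝ᵥ y)

lemma dotProduct_self_nonneg (y : ι → ℝ) : 0 ≤ y ⬝ᵥ y :=
  Finset.sum_nonneg fun j _ => mul_self_nonneg (y j)

lemma height_sq (y : ι → ℝ) : height y ^ 2 = 1 + y ⬝ᵥ y :=
  Real.sq_sqrt (add_nonneg zero_le_one (dotProduct_self_nonneg y))

lemma height_pos (y : ι → ℝ) : 0 < height y :=
  Real.sqrt_pos.2 (add_pos_of_pos_of_nonneg one_pos (dotProduct_self_nonneg y))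

lemma height_ne_zero (y : ι → ℝ) : (height y : ℂ) ≠ 0 := ofReal_ne_zero.2 (height_pos y).ne'

lemma one_le_height (y : ι → ℝ) : 1 ≤ height y :=
  Real.one_le_sqrt.2 (le_add_of_nonneg_right (dotProduct_self_nonneg y))

lemma abs_le_height (y : ι → ℝ) (j : ι) : |y j| ≤ height y := by
  refine abs_le_of_sq_le_sq ?_ (height_pos y).le
  have hj : y j ^ 2 ≤ y ⬝ᵥ y := by
    simpa only [sq, dotProduct] using Finset.single_le_sum (f := fun i => y i * y i)
      (fun i _ => mul_self_nonneg (y i)) (Finset.mem_univ j)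
  rw [height_sq]
  linarith

@[fun_prop]
lemma continuous_height : Continuous (height : (ι → ℝ) → ℝ) := by
  unfold height dotProduct
  fun_prop

lemma ofReal_height_sq (y : ι → ℝ) : (height y : ℂ) ^ 2 = 1 + ∑ j, (y j : ℂ) ^ 2 := by
  rw [← ofReal_pow, height_sq, dotProduct]
  push_cast
  simp only [sq]

lemma hasFDerivAt_height (y : ι → ℝ) :
    HasFDerivAt height ((height y)⁻¹ •
      ∑ j, y j • ContinuousLinearMap.proj (R := ℝ) (φ := fun _ : ι => ℝ) j) y := by
  have hsq : HasFDerivAt (fun y : ι → ℝ => 1 + y ⬝ᵥ y)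
      (∑ j, (2 * y j) • ContinuousLinearMap.proj (R := ℝ) (φ := fun _ : ι => ℝ) j) y := by
    refine (HasFDerivAt.fun_sum fun j _ => ?_).const_add 1
    refine ((hasFDerivAt_apply j y).mul (hasFDerivAt_apply j y)).congr_fderiv ?_
    rw [two_mul, add_smul]
  refine (hsq.sqrt (by rw [← height_sq]; exact (pow_pos (height_pos y) 2).ne')).congr_fderiv ?_
  rw [← height, Finset.smul_sum, Finset.smul_sum]
  refine Finset.sum_congr rfl fun j _ => ?_
  rw [smul_smul, smul_smul]
  congr 1
  ring

variable [DecidableEq ι]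

lemma fderiv_height_single (y : ι → ℝ) (j : ι) :
    fderiv ℝ height y (Pi.single j 1) = y j / height y := by
  simp [(hasFDerivAt_height y).fderiv, Pi.single_apply, div_eq_inv_mul]

end Height

section UnitSheet

lemma et_zero : et 0 = -I • e 0 := rfl

lemma et_succ (j : Fin 3) : et j.succ = e j.succ := by
  fin_cases j <;> rfl

lemma coord_smul_add_sum (a : ℂ) (v : Fin 3 → ℂ) :
    coord (a • e 0 + ∑ j : Fin 3, v j • e j.succ) = Fin.cons a v := by
  simpa only [Fin.sum_univ_succ (n := 3), Fin.cons_zero, Fin.cons_succ] using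
    coord_sum (Fin.cons a v)

/-- The global chart `y ↦ -iσ√(1 + |y|²) e₀ + y¹ e₁ + y² e₂ + y³ e₃` of the sheet of the unit
hyperboloid with sign `σ = ±1`. -/
noncomputable def unitSheet (σ : ℝ) (y : Fin 3 → ℝ) : HC :=
  (-(I * σ * height y)) • e 0 + ∑ j : Fin 3, (y j : ℂ) • e j.succ

lemma coord_unitSheet (σ : ℝ) (y : Fin 3 → ℝ) :
    coord (unitSheet σ y) = Fin.cons (-(I * σ * height y)) fun j => (y j : ℂ) :=
  coord_smul_add_sum _ _

lemma sqrt_sq_add_sum_sq {R : ℝ} (hR : 0 < R) (y : Fin 3 → ℝ) :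
    √(R ^ 2 + ∑ j, y j ^ 2) = R * height (R⁻¹ • y) := by
  have hsum : R ^ 2 + ∑ j, y j ^ 2 = R ^ 2 * (1 + (R⁻¹ • y) ⬝ᵥ (R⁻¹ • y)) := by
    simp only [dotProduct, Fin.sum_univ_three, Pi.smul_apply, smul_eq_mul]
    field_simp
  rw [hsum, Real.sqrt_mul (sq_nonneg R), Real.sqrt_sq hR.le, height]

lemma sheet_eq_smul_unitSheet {R : ℝ} (hR : 0 < R) (σ : ℝ) (y : Fin 3 → ℝ) :
    sheet R σ y = (R : ℂ) • unitSheet σ (R⁻¹ • y) := by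
  have hR' : (R : ℂ) ≠ 0 := ofReal_ne_zero.2 hR.ne'
  rw [sheet, sqrt_sq_add_sum_sq hR, unitSheet, et_zero, smul_add, Finset.smul_sum]
  congr 1
  · rw [smul_smul, ← Complex.coe_smul, smul_smul]
    push_cast
    ring_nf
  · refine Finset.sum_congr rfl fun j _ => ?_
    rw [et_succ, smul_smul, ← Complex.coe_smul, Pi.smul_apply, smul_eq_mul, ofReal_mul,
      ofReal_inv, mul_inv_cancel_left₀ hR']

lemma unitSheet_eq_sheet (σ : ℝ) (y : Fin 3 → ℝ) : unitSheet σ y = sheet 1 σ y := by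
  simp [sheet_eq_smul_unitSheet one_pos]

lemma unitSheet_mem_minkowski (σ : ℝ) (y : Fin 3 → ℝ) : unitSheet σ y ∈ Minkowski := by
  rw [unitSheet_eq_sheet]
  exact Submodule.add_mem _ (Submodule.smul_mem _ _ (et_mem 0))
    (Submodule.sum_mem _ fun j _ => Submodule.smul_mem _ _ (et_mem j.succ))

lemma deformedSheet_eq_smul_unitSheet {R : ℝ} (hR : 0 < R) (ε : ℝ) {σ : ℝ} (hσ : σ ^ 2 = 1)
    (y : Fin 3 → ℝ) :
    deformedSheet R ε σ y = (R * (1 + I * (σ * ε))) • unitSheet σ (R⁻¹ • y) := by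
  have htrace : (I * (sheet R σ y).trace).re = 2 * (σ * (R * height (R⁻¹ • y))) := by
    rw [sheet_eq_smul_unitSheet hR, unitSheet, Fin.sum_univ_three]
    simp [Matrix.trace_fin_two, e]
    ring
  have hpos := mul_pos hR (height_pos (R⁻¹ • y))
  rw [deformedSheet, deform, htrace, sheet_eq_smul_unitSheet hR, smul_smul, smul_smul]
  rcases sq_eq_one_iff.1 hσ with rfl | rfl
  · rw [if_pos (by linarith)]
    push_cast
    ring_nf
  · rw [if_neg (by linarith)]
    push_cast
    ring_nf

end UnitSheet

section Determinants

/-- The Lorentz product, with overall sign `τ = σσ'`, of the points of the unit sheets `σ` and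
`σ'` over `y` and `y'`. -/
noncomputable def pairing {ι : Type*} [Fintype ι] (τ : ℝ) (y y' : ι → ℝ) : ℝ :=
  τ * (height y * height y') - y ⬝ᵥ y'

lemma ofReal_sq_eq_one {σ : ℝ} (hσ : σ ^ 2 = 1) : (σ : ℂ) ^ 2 = 1 := by
  rw [← ofReal_pow, hσ, ofReal_one]

lemma det_smul_unitSheet_sub {σ σ' : ℝ} (hσ : σ ^ 2 = 1) (hσ' : σ' ^ 2 = 1) (y y' : Fin 3 → ℝ)
    (t ρ : ℂ) : (t • unitSheet σ y - ρ • unitSheet σ' y').det =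
      -(t ^ 2 - 2 * ρ * pairing (σ * σ') y y' * t + ρ ^ 2) := by
  have hh := ofReal_height_sq y
  have hh' := ofReal_height_sq y'
  have hs := ofReal_sq_eq_one hσ
  have hs' := ofReal_sq_eq_one hσ'
  rw [det_eq_sum_coord_sq, coord_sub, coord_smul, coord_smul, coord_unitSheet, coord_unitSheet,
    pairing, dotProduct]
  simp [Fin.sum_univ_succ] at hh hh' ⊢
  linear_combination (t * σ * height y - ρ * σ' * height y') ^ 2 * I_sq
    - t ^ 2 * height y ^ 2 * hs - ρ ^ 2 * height y' ^ 2 * hs' - t ^ 2 * hh - ρ ^ 2 * hh'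

lemma det_unitSheet {σ : ℝ} (hσ : σ ^ 2 = 1) (y : Fin 3 → ℝ) : (unitSheet σ y).det = -1 := by
  simpa using det_smul_unitSheet_sub hσ hσ y y 1 0

lemma det_one_sub_smul_unitSheet {σ : ℝ} (hσ : σ ^ 2 = 1) (y : Fin 3 → ℝ) (t : ℂ) :
    (1 - t • unitSheet σ y).det = 1 - t ^ 2 + 2 * I * σ * height y * t := by
  have hh := ofReal_height_sq y
  have hs := ofReal_sq_eq_one hσ
  rw [det_eq_sum_coord_sq, coord_sub, coord_smul, coord_unitSheet, coord_one]
  simp [Fin.sum_univ_succ] at hh ⊢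
  linear_combination t ^ 2 * σ ^ 2 * height y ^ 2 * I_sq - t ^ 2 * height y ^ 2 * hs - t ^ 2 * hh

end Determinants

section Tangents

/-- The `j`-th coordinate tangent vector of the chart `unitSheet σ` at `y`. -/
noncomputable def tangent (σ : ℝ) (y : Fin 3 → ℝ) (j : Fin 3) : HC :=
  (-(I * σ * (y j / height y))) • e 0 + e j.succ

/-- The basis `eᵢ + yⁱ Y` dual to the coordinate tangent vectors at the point `Y` of the unit
sheet, for the quadratic form `N`; it is orthogonal to `Y`. -/
noncomputable def dualTangent (σ : ℝ) (y : Fin 3 → ℝ) (i : Fin 3) : HC :=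
  e i.succ + (y i : ℂ) • unitSheet σ y

lemma hasFDerivAt_unitSheet (σ : ℝ) (y : Fin 3 → ℝ) :
    HasFDerivAt (unitSheet σ) ((fderiv ℝ height y).smulRight ((-(I * σ)) • e 0) +
      ∑ j : Fin 3, (ContinuousLinearMap.proj (R := ℝ) (φ := fun _ : Fin 3 => ℝ) j).smulRight
        (e j.succ)) y := by
  have hsheet : unitSheet σ = fun y => height y • ((-(I * σ)) • e 0) +
      ∑ j : Fin 3, y j • e j.succ := by
    funext y
    simp only [unitSheet, ← Complex.coe_smul, smul_smul]
    ring_nf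
  rw [hsheet]
  exact ((hasFDerivAt_height y).differentiableAt.hasFDerivAt.smul_const _).add
    (HasFDerivAt.fun_sum fun j _ => (hasFDerivAt_apply j y).smul_const _)

lemma fderiv_unitSheet_single (σ : ℝ) (y : Fin 3 → ℝ) (j : Fin 3) :
    fderiv ℝ (unitSheet σ) y (Pi.single j 1) = tangent σ y j := by
  simp only [(hasFDerivAt_unitSheet σ y).fderiv, add_apply, sum_apply,
    ContinuousLinearMap.smulRight_apply, fderiv_height_single, ContinuousLinearMap.proj_apply,
    Pi.single_apply, ite_smul, one_smul, zero_smul, Finset.sum_ite_eq', Finset.mem_univ, if_true,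
    tangent, ← Complex.coe_smul, smul_smul]
  push_cast
  ring_nf

lemma differentiable_unitSheet (σ : ℝ) : Differentiable ℝ (unitSheet σ) := fun y =>
  (hasFDerivAt_unitSheet σ y).differentiableAt

@[fun_prop]
lemma continuous_unitSheet (σ : ℝ) : Continuous (unitSheet σ) :=
  (differentiable_unitSheet σ).continuous

lemma coord_tangent (σ : ℝ) (y : Fin 3 → ℝ) (j : Fin 3) :
    coord (tangent σ y j) = Fin.cons (-(I * σ * (y j / height y))) (Pi.single j 1) := by
  rw [← coord_smul_add_sum]
  simp [tangent, Pi.single_apply]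

lemma wedge_smul_tangent (σ : ℝ) (y : Fin 3 → ℝ) (c : ℂ) :
    wedge 1 2 3 (fun j => c • tangent σ y j) = c ^ 3 ∧
    wedge 0 2 3 (fun j => c • tangent σ y j) = -(c ^ 3 * (I * σ * (y 0 / height y))) ∧
    wedge 0 1 3 (fun j => c • tangent σ y j) = c ^ 3 * (I * σ * (y 1 / height y)) ∧
    wedge 0 1 2 (fun j => c • tangent σ y j) = -(c ^ 3 * (I * σ * (y 2 / height y))) := by
  have h0 : ∀ j, coord (tangent σ y j) 0 = -(I * σ * (y j / height y)) := fun j => by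
    rw [coord_tangent, Fin.cons_zero]
  have h1 : ∀ j, coord (tangent σ y j) 1 = Pi.single (M := fun _ => ℂ) j 1 0 := fun j => by
    rw [coord_tangent, ← Fin.succ_zero_eq_one, Fin.cons_succ]
  have h2 : ∀ j, coord (tangent σ y j) 2 = Pi.single (M := fun _ => ℂ) j 1 1 := fun j => by
    rw [coord_tangent, ← Fin.succ_one_eq_two, Fin.cons_succ]
  have h3 : ∀ j, coord (tangent σ y j) 3 = Pi.single (M := fun _ => ℂ) j 1 2 := fun j => by
    rw [coord_tangent, show (3 : Fin 4) = Fin.succ 2 from rfl, Fin.cons_succ]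
  simp only [wedge, Matrix.det_fin_three, coord_smul, Matrix.of_apply, Matrix.cons_val,
    Pi.smul_apply, smul_eq_mul, h0, h1, h2, h3, Pi.single_apply, Fin.reduceEq, if_true, if_false]
  refine ⟨?_, ?_, ?_, ?_⟩ <;> ring

lemma Dz_smul_tangent {σ : ℝ} (hσ : σ ^ 2 = 1) (y : Fin 3 → ℝ) (c : ℂ) :
    Dz (fun j => c • tangent σ y j) = (c ^ 3 * (I * σ / height y)) • unitSheet σ y := by
  have hs := ofReal_sq_eq_one hσ
  have hh := height_ne_zero y
  obtain ⟨h0, h1, h2, h3⟩ := wedge_smul_tangent σ y c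
  rw [Dz, h0, h1, h2, h3, unitSheet, Fin.sum_univ_three]
  simp only [Fin.succ_zero_eq_one, Fin.succ_one_eq_two, show (2 : Fin 3).succ = 3 from rfl]
  match_scalars <;> field_simp
  linear_combination c ^ 3 * σ ^ 2 * I_sq - c ^ 3 * hs

lemma sum_tangent_dualTangent {E : Type*} [AddCommGroup E] [Module ℂ E] {σ : ℝ}
    (hσ : σ ^ 2 = 1) (y : Fin 3 → ℝ) (b : HC →ₗ[ℂ] HC →ₗ[ℂ] E) :
    ∑ i, b (tangent σ y i) (dualTangent σ y i) =
      ∑ j, b (e j) (e j) + b (unitSheet σ y) (unitSheet σ y) := by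
  have hs := ofReal_sq_eq_one hσ
  have hh := ofReal_height_sq y
  have hh0 := height_ne_zero y
  rw [Fin.sum_univ_three] at hh
  simp only [Fin.sum_univ_three, Fin.sum_univ_four, tangent, dualTangent, unitSheet,
    Fin.succ_zero_eq_one, Fin.succ_one_eq_two, show (2 : Fin 3).succ = 3 from rfl, map_add,
    map_smul, LinearMap.add_apply, LinearMap.smul_apply, smul_add, smul_smul]
  match_scalars <;> field_simp <;> simp only [hh, I_sq, hs] <;> ring

lemma sum_deriv_dualTangent (σ : ℝ) (y : Fin 3 → ℝ) :
    ∑ i : Fin 3, ((-(y i / (height y : ℂ) ^ 2)) • dualTangent σ y i +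
      (unitSheet σ y + (y i : ℂ) • tangent σ y i)) = (3 : ℂ) • unitSheet σ y := by
  have hh := ofReal_height_sq y
  have hh0 := height_ne_zero y
  rw [Fin.sum_univ_three] at hh
  simp only [Fin.sum_univ_three, tangent, dualTangent, unitSheet, Fin.succ_zero_eq_one,
    Fin.succ_one_eq_two, show (2 : Fin 3).succ = 3 from rfl, smul_add, smul_smul]
  match_scalars <;> field_simp <;> simp only [hh] <;> ring

end Tangents

section FueterKernel

/-- The adjugate of `2 × 2` matrices, which is a linear map. -/
noncomputable def adj : HC →L[ℂ] HC :=
  LinearMap.toContinuousLinearMap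
    { toFun := fun Z => Z.adjugate
      map_add' := fun A B => by
        ext a b
        fin_cases a <;> fin_cases b <;> simp [Matrix.adjugate_fin_two, add_comm]
      map_smul' := fun c A => by
        ext a b
        fin_cases a <;> fin_cases b <;> simp [Matrix.adjugate_fin_two] }

lemma adj_apply (Z : HC) : adj Z = Z.adjugate := rfl

lemma adj_mul_self (Z : HC) : adj Z * Z = Z.det • 1 := Matrix.adjugate_mul Z

lemma mul_adj_self (Z : HC) : Z * adj Z = Z.det • 1 := Matrix.mul_adjugate Z

lemma adj_one : adj (1 : HC) = 1 := by
  rw [adj_apply, Matrix.adjugate_one]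

lemma det_e (j : Fin 4) : (e j).det = 1 := by
  fin_cases j <;> simp [e, Matrix.det_fin_two]

lemma sum_trace_mul_e_smul (Z : HC) : ∑ j, (Z * e j).trace • e j = (2 : ℂ) • adj Z := by
  rw [adj_apply, Matrix.adjugate_fin_two, Fin.sum_univ_four]
  simp only [Matrix.trace_fin_two, Matrix.mul_apply, Fin.sum_univ_two]
  ext a b
  fin_cases a <;> fin_cases b <;> simp [e]
  · linear_combination (Z 0 0 - Z 1 1) * I_sq
  · linear_combination (Z 0 1 + Z 1 0) * I_sq
  · linear_combination (Z 0 1 + Z 1 0) * I_sq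
  · linear_combination (Z 1 1 - Z 0 0) * I_sq

/-- The differential `h ↦ Tr (adj Z · h)` of the determinant at `Z`. -/
noncomputable def detDeriv (Z : HC) : HC →L[ℂ] ℂ :=
  LinearMap.toContinuousLinearMap (Matrix.traceLinearMap (Fin 2) ℂ ℂ ∘ₗ LinearMap.mulLeft ℂ (adj Z))

lemma detDeriv_apply (Z h : HC) : detDeriv Z h = (adj Z * h).trace := rfl

lemma hasFDerivAt_det (Z : HC) : HasFDerivAt (fun Z : HC => Z.det) (detDeriv Z) Z := by
  have hentry : ∀ a b, HasFDerivAt (fun Z : HC => Z a b)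
      (LinearMap.toContinuousLinearMap (Matrix.entryLinearMap ℂ ℂ a b)) Z := fun a b =>
    (LinearMap.toContinuousLinearMap (Matrix.entryLinearMap ℂ ℂ a b)).hasFDerivAt
  have hdet : (fun Z : HC => Z.det) = fun Z => Z 0 0 * Z 1 1 - Z 0 1 * Z 1 0 :=
    funext Matrix.det_fin_two
  rw [hdet]
  refine (((hentry 0 0).mul (hentry 1 1)).sub ((hentry 0 1).mul (hentry 1 0))).congr_fderiv ?_
  ext h : 1
  have htrace : (adj Z * h).trace =
      Z 0 0 * h 1 1 + Z 1 1 * h 0 0 - (Z 0 1 * h 1 0 + Z 1 0 * h 0 1) := by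
    rw [adj_apply, Matrix.adjugate_fin_two]
    simp only [Matrix.trace_fin_two, Matrix.mul_apply, Fin.sum_univ_two, Matrix.of_apply,
      Matrix.cons_val_zero, Matrix.cons_val_one, Matrix.cons_val']
    ring
  exact htrace.symm

/-- The Fueter kernel `Z⁻¹ / N(Z)`. -/
noncomputable def fueterKernel (Z : HC) : HC := Z.det⁻¹ • Z⁻¹

lemma fueterKernel_eq (Z : HC) : fueterKernel Z = (Z.det⁻¹ ^ 2) • adj Z := by
  rw [fueterKernel, Matrix.inv_def, Ring.inverse_eq_inv', adj_apply, smul_smul, sq]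

lemma hasFDerivAt_fueterKernel {Z : HC} (hZ : Z.det ≠ 0) :
    HasFDerivAt fueterKernel ((Z.det⁻¹ ^ 2) • adj -
      (2 * Z.det⁻¹ ^ 3) • (detDeriv Z).smulRight (adj Z)) Z := by
  rw [funext fueterKernel_eq]
  have hinv := ((hasDerivAt_inv hZ).comp_hasFDerivAt Z (hasFDerivAt_det Z)).pow 2
  refine (hinv.smul adj.hasFDerivAt).congr_fderiv ?_
  ext h : 1
  change (Z.det⁻¹ ^ 2) • adj h +
    ((2 • Z.det⁻¹ ^ (2 - 1)) • (-(Z.det ^ 2)⁻¹ • detDeriv Z h)) • adj Z =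
    (Z.det⁻¹ ^ 2) • adj h - (2 * Z.det⁻¹ ^ 3) • (detDeriv Z h • adj Z)
  rw [smul_smul _ (detDeriv Z h), sub_eq_add_neg, ← neg_smul]
  congr 2
  simp only [nsmul_eq_mul, smul_eq_mul]
  push_cast
  ring

lemma sum_fderiv_fueterKernel_mul_e {Z : HC} (hZ : Z.det ≠ 0) :
    ∑ j, fderiv ℂ fueterKernel Z (e j) * e j = 0 := by
  have hterm : ∀ j, fderiv ℂ fueterKernel Z (e j) * e j =
      (Z.det⁻¹ ^ 2) • (1 : HC) - (2 * Z.det⁻¹ ^ 3) • (adj Z * ((adj Z * e j).trace • e j)) := by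
    intro j
    rw [(hasFDerivAt_fueterKernel hZ).fderiv, sub_apply, smul_apply, smul_apply,
      ContinuousLinearMap.smulRight_apply, detDeriv_apply, sub_mul, smul_mul_assoc, smul_mul_assoc,
      smul_mul_assoc, mul_smul_comm, adj_mul_self, det_e, one_smul]
  have hadj : adj Z * adj (adj Z) = Z.det • 1 := by
    rw [mul_adj_self, adj_apply, Matrix.det_adjugate, Fintype.card_fin, pow_one]
  simp only [hterm]
  rw [Finset.sum_sub_distrib, ← Finset.smul_sum, ← Finset.smul_sum, ← Finset.mul_sum,
    sum_trace_mul_e_smul, mul_smul_comm, hadj, Finset.sum_const, Finset.card_univ,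
    Fintype.card_fin, ← Nat.cast_smul_eq_nsmul ℂ, smul_smul, smul_smul, smul_smul, ← sub_smul]
  convert zero_smul ℂ (1 : HC) using 2
  push_cast
  field_simp
  ring

end FueterKernel

section SheetCoeff

variable {m : ℕ}

/-- The coefficient of the pull-back of the form `K(Z - Y₀) · Dz · φ(Z)` along the chart
`y ↦ t Y(y)`, where `Y = unitSheet σ` and `t` is a complex parameter. -/
noncomputable def sheetCoeff (Y₀ : HC) (φ : HC → Val m) (σ : ℝ) (t : ℂ) (y : Fin 3 → ℝ) : Val m :=
  (I * σ * t ^ 3 / height y) •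
    (fueterKernel (t • unitSheet σ y - Y₀) * unitSheet σ y * φ (t • unitSheet σ y))

lemma pullback_deformedSheet {R : ℝ} (hR : 0 < R) (ε : ℝ) {σ : ℝ} (hσ : σ ^ 2 = 1)
    (Y₀ : HC) (φ : HC → Val m) (y : Fin 3 → ℝ) :
    pullback (fueterForm φ Y₀) (deformedSheet R ε σ) y =
      (R⁻¹ ^ 3) • sheetCoeff Y₀ φ σ (R * (1 + I * (σ * ε))) (R⁻¹ • y) := by
  have hR' : (R : ℂ) ≠ 0 := ofReal_ne_zero.2 hR.ne'
  rw [funext (deformedSheet_eq_smul_unitSheet hR ε hσ)]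
  generalize (R : ℂ) * (1 + I * (σ * ε)) = t
  have hchart : HasFDerivAt (fun y : Fin 3 → ℝ => t • unitSheet σ (R⁻¹ • y))
      (t • (fderiv ℝ (unitSheet σ) (R⁻¹ • y)).comp
        (R⁻¹ • ContinuousLinearMap.id ℝ (Fin 3 → ℝ))) y :=
    ((differentiable_unitSheet σ (R⁻¹ • y)).hasFDerivAt.comp y
      ((hasFDerivAt_id y).const_smul R⁻¹)).const_smul t
  have htangent : ∀ j, fderiv ℝ (fun y : Fin 3 → ℝ => t • unitSheet σ (R⁻¹ • y)) y
      (Pi.single j 1) = (t * (R : ℂ)⁻¹) • tangent σ (R⁻¹ • y) j := by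
    intro j
    rw [hchart.fderiv, smul_apply, ContinuousLinearMap.comp_apply, smul_apply,
      ContinuousLinearMap.id_apply, map_smul, fderiv_unitSheet_single, mul_smul,
      ← Complex.coe_smul, ofReal_inv]
  simp only [pullback, fueterForm, htangent, Dz_smul_tangent hσ, sheetCoeff, fueterKernel]
  rw [mul_smul_comm, Matrix.smul_mul, ← Complex.coe_smul, smul_smul]
  congr 1
  push_cast
  field_simp

/-- The vector field on `ℝ³` whose divergence is the derivative of `sheetCoeff` in `t`: the
contraction of the closed form `K(Z - Y₀) · Dz · φ(Z)` with the velocity of the family of charts. -/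
noncomputable def sheetFlux (Y₀ : HC) (φ : HC → Val m) (σ : ℝ) (t : ℂ) (i : Fin 3)
    (y : Fin 3 → ℝ) : Val m :=
  (I * σ * t ^ 2 / height y) •
    (fueterKernel (t • unitSheet σ y - Y₀) * dualTangent σ y i * φ (t • unitSheet σ y))

/-- The left Fueter operator `B ↦ ∑ⱼ eⱼ B(eⱼ)`, applied to a differential `B`. -/
noncomputable def fueterOp (B : HC →L[ℂ] Val m) : Val m := ∑ j, e j * B (e j)

variable {Y₀ : HC} {φ : HC → Val m} {σ : ℝ} {t : ℂ} {y : Fin 3 → ℝ}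

lemma hasFDerivAt_fueterKernel_sub {Z : HC} (hN : (Z - Y₀).det ≠ 0) :
    HasFDerivAt (fun Z => fueterKernel (Z - Y₀)) (fderiv ℂ fueterKernel (Z - Y₀)) Z :=
  HasFDerivAt.comp (f := fun Z => Z - Y₀) Z
    (hasFDerivAt_fueterKernel hN).differentiableAt.hasFDerivAt ((hasFDerivAt_id Z).sub_const Y₀)

lemma differentiableAt_sheetFlux (hN : (t • unitSheet σ y - Y₀).det ≠ 0)
    (hφ : DifferentiableAt ℂ φ (t • unitSheet σ y)) (i : Fin 3) :
    DifferentiableAt ℝ (sheetFlux Y₀ φ σ t i) y := by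
  have hY := differentiable_unitSheet σ y
  have hK : DifferentiableAt ℝ (fun y => fueterKernel (t • unitSheet σ y - Y₀)) y :=
    DifferentiableAt.comp (g := fun Z => fueterKernel (Z - Y₀)) y
      ((hasFDerivAt_fueterKernel_sub hN).restrictScalars ℝ).differentiableAt (hY.const_smul t)
  have hφY : DifferentiableAt ℝ (fun y => φ (t • unitSheet σ y)) y :=
    DifferentiableAt.comp (g := φ) y (hφ.restrictScalars ℝ) (hY.const_smul t)
  have hh : DifferentiableAt ℝ (fun y : Fin 3 → ℝ => (height y : ℂ)) y :=
    DifferentiableAt.comp (g := ofReal) y ofRealCLM.differentiableAt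
      (hasFDerivAt_height y).differentiableAt
  have hyi : DifferentiableAt ℝ (fun y : Fin 3 → ℝ => (y i : ℂ)) y :=
    DifferentiableAt.comp (g := ofReal) y ofRealCLM.differentiableAt (differentiableAt_apply i y)
  have hc : DifferentiableAt ℝ (fun y : Fin 3 → ℝ => I * σ * t ^ 2 / (height y : ℂ)) y := by
    simpa only [div_eq_mul_inv] using (hh.fun_inv (height_ne_zero y)).const_mul _
  exact hc.smul (differentiableAt_matrix_mul
    (differentiableAt_matrix_mul hK ((hyi.smul hY).const_add (e i.succ))) hφY)

lemma hasDerivAt_dualTangent_div_height_line (σ : ℝ) (y : Fin 3 → ℝ) (i : Fin 3) :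
    HasDerivAt (fun r : ℝ => (height (y + r • Pi.single i 1) : ℂ)⁻¹ •
        dualTangent σ (y + r • Pi.single i 1) i)
      ((height y : ℂ)⁻¹ • ((-(y i / (height y : ℂ) ^ 2)) • dualTangent σ y i +
        (unitSheet σ y + (y i : ℂ) • tangent σ y i))) 0 := by
  have hline : y + (0 : ℝ) • Pi.single i (1 : ℝ) = y := by rw [zero_smul, add_zero]
  have hY : HasDerivAt (fun r : ℝ => unitSheet σ (y + r • Pi.single i 1)) (tangent σ y i) 0 := by
    rw [← fderiv_unitSheet_single]
    exact (differentiable_unitSheet σ y).hasFDerivAt.hasLineDerivAt (Pi.single i 1)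
  have hh : HasDerivAt (fun r : ℝ => (height (y + r • Pi.single i 1) : ℂ))
      ((y i / height y : ℝ) : ℂ) 0 := by
    rw [← fderiv_height_single]
    exact HasDerivAt.ofReal_comp ((hasFDerivAt_height
      y).differentiableAt.hasFDerivAt.hasLineDerivAt (Pi.single i 1))
  have hyi : HasDerivAt (fun r : ℝ => (((y + r • Pi.single i 1 : Fin 3 → ℝ) i : ℝ) : ℂ)) 1 0 := by
    simpa using HasDerivAt.ofReal_comp ((hasDerivAt_id (0 : ℝ)).const_add (y i))
  have hprod := (hh.fun_inv (by rw [hline]; exact height_ne_zero y)).fun_smul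
    ((hyi.fun_smul hY).const_add (e i.succ))
  simp only [hline] at hprod
  refine hprod.congr_deriv ?_
  rw [dualTangent]
  push_cast
  module

lemma hasDerivAt_sheetFlux_line (hN : (t • unitSheet σ y - Y₀).det ≠ 0)
    (hφ : DifferentiableAt ℂ φ (t • unitSheet σ y)) (i : Fin 3) :
    HasDerivAt (fun r : ℝ => sheetFlux Y₀ φ σ t i (y + r • Pi.single i 1))
      ((I * σ * t ^ 2 / height y) •
        (fueterKernel (t • unitSheet σ y - Y₀) *
            ((-(y i / (height y : ℂ) ^ 2)) • dualTangent σ y i +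
              (unitSheet σ y + (y i : ℂ) • tangent σ y i)) * φ (t • unitSheet σ y) +
          t • (fderiv ℂ fueterKernel (t • unitSheet σ y - Y₀) (tangent σ y i) *
            dualTangent σ y i * φ (t • unitSheet σ y) +
          fueterKernel (t • unitSheet σ y - Y₀) *
            (dualTangent σ y i * fderiv ℂ φ (t • unitSheet σ y) (tangent σ y i))))) 0 := by
  have hline : y + (0 : ℝ) • Pi.single i (1 : ℝ) = y := by rw [zero_smul, add_zero]
  have hY : HasDerivAt (fun r : ℝ => t • unitSheet σ (y + r • Pi.single i 1))
      (t • tangent σ y i) 0 := by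
    rw [← fderiv_unitSheet_single]
    exact ((differentiable_unitSheet σ y).hasFDerivAt.hasLineDerivAt (Pi.single i 1)).const_smul t
  have hcomp : ∀ {E : Type} [NormedAddCommGroup E] [NormedSpace ℂ E] {ψ : HC → E}
      {ψ' : HC →L[ℂ] E}, HasFDerivAt ψ ψ' (t • unitSheet σ y) →
      HasDerivAt (fun r : ℝ => ψ (t • unitSheet σ (y + r • Pi.single i 1)))
        (t • ψ' (tangent σ y i)) 0 := fun {E _ _ ψ ψ'} hψ =>
    (HasFDerivAt.comp_hasDerivAt (l' := ψ'.restrictScalars ℝ) (l := ψ) (0 : ℝ)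
      (by rw [hline]; exact hψ.restrictScalars ℝ) hY).congr_deriv (map_smul ψ' t _)
  have hprod := (hasDerivAt_matrix_mul (hasDerivAt_matrix_mul
    (hcomp (hasFDerivAt_fueterKernel_sub hN)) (hasDerivAt_dualTangent_div_height_line σ y i))
    (hcomp hφ.hasFDerivAt)).fun_const_smul (I * σ * t ^ 2)
  simp only [hline] at hprod
  refine (hprod.congr_deriv ?_).congr_of_eventuallyEq (Eventually.of_forall fun r => ?_)
  · simp only [Matrix.smul_mul, Matrix.mul_smul, Matrix.add_mul, Matrix.mul_add, Matrix.mul_assoc,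
      div_eq_mul_inv]
    module
  · simp only [sheetFlux, Matrix.smul_mul, Matrix.mul_smul, smul_smul, div_eq_mul_inv]

lemma hasDerivAt_sheetCoeff (hN : (t • unitSheet σ y - Y₀).det ≠ 0)
    (hφ : DifferentiableAt ℂ φ (t • unitSheet σ y)) :
    HasDerivAt (fun t => sheetCoeff Y₀ φ σ t y)
      ((I * σ * t ^ 2 / height y) •
        (fueterKernel (t • unitSheet σ y - Y₀) * ((3 : ℂ) • unitSheet σ y) *
            φ (t • unitSheet σ y) +
          t • (fderiv ℂ fueterKernel (t • unitSheet σ y - Y₀) (unitSheet σ y) *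
            unitSheet σ y * φ (t • unitSheet σ y) +
          fueterKernel (t • unitSheet σ y - Y₀) *
            (unitSheet σ y * fderiv ℂ φ (t • unitSheet σ y) (unitSheet σ y))))) t := by
  have hY : HasDerivAt (fun t : ℂ => t • unitSheet σ y) (unitSheet σ y) t := by
    have hid := (hasDerivAt_id t).smul_const (unitSheet σ y)
    rwa [one_smul] at hid
  have hK := HasFDerivAt.comp_hasDerivAt (f := fun t : ℂ => t • unitSheet σ y) t
    (hasFDerivAt_fueterKernel_sub hN) hY
  have hφY := HasFDerivAt.comp_hasDerivAt (f := fun t : ℂ => t • unitSheet σ y) t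
    hφ.hasFDerivAt hY
  have hc : HasDerivAt (fun t : ℂ => I * σ * t ^ 3 / height y)
      (I * σ * t ^ 2 / height y * 3) t := by
    refine (((hasDerivAt_pow 3 t).const_mul (I * σ)).div_const _).congr_deriv ?_
    push_cast
    ring
  refine (hc.fun_smul (hasDerivAt_matrix_mul (hK.mul_const (unitSheet σ y)) hφY)).congr_deriv ?_
  simp only [Function.comp_apply, Matrix.smul_mul, Matrix.mul_smul, Matrix.mul_assoc]
  rw [show I * σ * t ^ 3 / height y = I * σ * t ^ 2 / height y * t by ring]
  module

lemma sum_mul_e_mul_add_mul_e_mul (A : HC →L[ℂ] HC) (B : HC →L[ℂ] Val m) (K : HC) (v : Val m)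
    (hA : ∑ j, A (e j) * e j = 0) (hB : fueterOp B = 0) :
    ∑ j, (A (e j) * e j * v + K * (e j * B (e j))) = 0 := by
  rw [Finset.sum_add_distrib, ← Matrix.sum_mul, hA, ← Matrix.mul_sum, ← fueterOp, hB,
    Matrix.zero_mul, Matrix.mul_zero, add_zero]

/-- For regular `K` and `φ`, only the derivatives along `Y` survive in the divergence of the flux;
at `t Y` these are the derivatives in `t`. -/
lemma sum_tangent_mul_dualTangent (hσ : σ ^ 2 = 1) (A : HC →L[ℂ] HC) (B : HC →L[ℂ] Val m)
    (K : HC) (v : Val m) (hA : ∑ j, A (e j) * e j = 0) (hB : fueterOp B = 0) :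
    ∑ i, (A (tangent σ y i) * dualTangent σ y i * v +
        K * (dualTangent σ y i * B (tangent σ y i))) =
      A (unitSheet σ y) * unitSheet σ y * v + K * (unitSheet σ y * B (unitSheet σ y)) := by
  let b : HC →ₗ[ℂ] HC →ₗ[ℂ] Val m := LinearMap.mk₂ ℂ
    (fun X Z => A X * Z * v + K * (Z * B X))
    (fun X X' Z => by simp only [map_add, add_mul, Matrix.add_mul, Matrix.mul_add]; abel)
    (fun c X Z => by
      simp only [map_smul, smul_mul_assoc, Matrix.smul_mul, Matrix.mul_smul, smul_add])
    (fun X Z Z' => by simp only [mul_add, Matrix.add_mul, Matrix.mul_add]; abel)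
    (fun c X Z => by simp only [mul_smul_comm, Matrix.smul_mul, Matrix.mul_smul, smul_add])
  refine (sum_tangent_dualTangent hσ y b).trans ?_
  have he : ∑ j, b (e j) (e j) = 0 := sum_mul_e_mul_add_mul_e_mul A B K v hA hB
  rw [he, zero_add]
  rfl

lemma hasDerivAt_sheetCoeff_eq_div (hσ : σ ^ 2 = 1) (hN : (t • unitSheet σ y - Y₀).det ≠ 0)
    (hφ : DifferentiableAt ℂ φ (t • unitSheet σ y))
    (hreg : fueterOp (fderiv ℂ φ (t • unitSheet σ y)) = 0) :
    HasDerivAt (fun t => sheetCoeff Y₀ φ σ t y)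
      (∑ i, fderiv ℝ (sheetFlux Y₀ φ σ t i) y (Pi.single i 1)) t := by
  have hflux := fun i : Fin 3 => ((differentiableAt_sheetFlux hN hφ i).hasFDerivAt.hasLineDerivAt
    (Pi.single i 1)).unique (hasDerivAt_sheetFlux_line hN hφ i)
  refine (hasDerivAt_sheetCoeff hN hφ).congr_deriv ?_
  refine Eq.trans ?_ (Finset.sum_congr rfl fun i _ => (hflux i).symm)
  rw [← Finset.smul_sum, Finset.sum_add_distrib, ← Matrix.sum_mul, ← Matrix.mul_sum,
    sum_deriv_dualTangent, ← Finset.smul_sum, sum_tangent_mul_dualTangent hσ _ _ _ _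
      (sum_fderiv_fueterKernel_mul_e hN) hreg]

end SheetCoeff

section HolomorphicParameter

variable {E : Type*} [NormedAddCommGroup E] [NormedSpace ℂ E] {f : ℂ → E} {c : ℂ} {r C : ℝ}

lemma norm_deriv_le_of_mem_ball_half (hd : DifferentiableOn ℂ f (Metric.ball c r))
    (hC : ∀ z ∈ Metric.ball c r, ‖f z‖ ≤ C) {z : ℂ} (hz : z ∈ Metric.ball c (r / 2)) :
    ‖deriv f z‖ ≤ C / (r / 4) := by
  have hr : 0 < r / 4 := by linarith [Metric.pos_of_mem_ball hz]
  have hsub : Metric.closedBall z (r / 4) ⊆ Metric.ball c r := fun w hw => by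
    rw [Metric.mem_ball] at hz ⊢
    linarith [dist_triangle w z c, Metric.mem_closedBall.1 hw]
  refine norm_deriv_le_of_forall_mem_sphere_norm_le hr ?_ fun w hw =>
    hC w (hsub (Metric.sphere_subset_closedBall hw))
  exact (hd.mono (by rwa [closure_ball z hr.ne'])).diffContOnCl

variable {α : Type*} [MeasurableSpace α] {μ : Measure α} {T : Set ℂ} {F : ℂ → α → E} {t₀ : ℂ}

lemma aestronglyMeasurable_deriv_parameter (hT : IsOpen T)
    (hmeas : ∀ t ∈ T, AEStronglyMeasurable (F t) μ) (hd : ∀ a, DifferentiableOn ℂ (F · a) T)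
    (ht₀ : t₀ ∈ T) : AEStronglyMeasurable (fun a => deriv (F · a) t₀) μ := by
  classical
  have hnear : ∀ᶠ h in 𝓝[≠] (0 : ℂ), t₀ + h ∈ T :=
    nhdsWithin_le_nhds ((continuous_const_add t₀).tendsto' 0 t₀ (add_zero t₀) (hT.mem_nhds ht₀))
  refine aestronglyMeasurable_of_tendsto_ae (𝓝[≠] (0 : ℂ))
    (f := fun h a => if t₀ + h ∈ T then h⁻¹ • (F (t₀ + h) a - F t₀ a) else 0) (fun h => ?_)
    (Eventually.of_forall fun a => ?_)
  · split_ifs with hh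
    · exact ((hmeas _ hh).sub (hmeas _ ht₀)).const_smul h⁻¹
    · exact aestronglyMeasurable_const
  · refine (((hd a).differentiableAt (hT.mem_nhds ht₀)).hasDerivAt.tendsto_slope_zero).congr' ?_
    filter_upwards [hnear] with h hh
    rw [if_pos hh]

lemma hasDerivAt_integral_of_differentiableOn (hT : IsOpen T)
    (hmeas : ∀ t ∈ T, AEStronglyMeasurable (F t) μ) (hd : ∀ a, DifferentiableOn ℂ (F · a) T)
    (ht₀ : t₀ ∈ T) {b : α → ℝ} (hb : Integrable b μ) (hbd : ∀ᶠ t in 𝓝 t₀, ∀ a, ‖F t a‖ ≤ b a) :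
    Integrable (fun a => deriv (F · a) t₀) μ ∧
      HasDerivAt (fun t => ∫ a, F t a ∂μ) (∫ a, deriv (F · a) t₀ ∂μ) t₀ := by
  obtain ⟨r, hr, hball⟩ := Metric.eventually_nhds_iff_ball.1 (hbd.and (hT.mem_nhds ht₀))
  have hderiv (a : α) (t : ℂ) (ht : t ∈ Metric.ball t₀ (r / 2)) :
      HasDerivAt (F · a) (deriv (F · a) t) t :=
    ((hd a).differentiableAt (hT.mem_nhds
      (hball t (Metric.ball_subset_ball (by linarith) ht)).2)).hasDerivAt
  have hbound (a : α) (t : ℂ) (ht : t ∈ Metric.ball t₀ (r / 2)) :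
      ‖deriv (F · a) t‖ ≤ b a / (r / 4) :=
    norm_deriv_le_of_mem_ball_half ((hd a).mono fun z hz => (hball z hz).2)
      (fun z hz => (hball z hz).1 a) ht
  refine hasDerivAt_integral_of_dominated_loc_of_deriv_le (bound := fun a => b a / (r / 4))
    (Metric.ball_mem_nhds t₀ (by positivity)) ?_ ?_
    (aestronglyMeasurable_deriv_parameter hT hmeas hd ht₀) (Eventually.of_forall hbound)
    (hb.div_const _) (Eventually.of_forall hderiv)
  · filter_upwards [hT.mem_nhds ht₀] with t ht using hmeas t ht
  · exact hb.mono' (hmeas t₀ ht₀) (Eventually.of_forall hbd.self_of_nhds)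

lemma norm_sub_sub_smul_deriv_le (hd : DifferentiableOn ℂ f (Metric.ball c r))
    (hC : ∀ z ∈ Metric.ball c r, ‖f z‖ ≤ C) {z : ℂ} (hz : z ∈ Metric.ball c r) :
    ‖f z - f c - (z - c) • deriv f c‖ ≤ 4 * C * (‖z - c‖ / r) ^ 2 := by
  have hr : 0 < r := Metric.pos_of_mem_ball hz
  have hc : c ∈ Metric.ball c r := Metric.mem_ball_self hr
  have hmaps : MapsTo f (Metric.ball c r) (Metric.closedBall (f c) (2 * C)) := fun w hw => by
    rw [mem_closedBall_iff_norm]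
    linarith [norm_sub_le (f w) (f c), hC w hw, hC c hc]
  set g : ℂ → E := fun w => f w - (w - c) • deriv f c with hg
  have hgc : g c = f c := by simp [hg]
  have hgd : DifferentiableOn ℂ g (Metric.ball c r) := hd.sub (by fun_prop)
  have hg_maps : MapsTo g (Metric.ball c r) (Metric.closedBall (g c) (4 * C)) := fun w hw => by
    have hw' : ‖w - c‖ * ‖deriv f c‖ ≤ r * (2 * C / r) := by
      gcongr
      · exact (mem_ball_iff_norm.1 hw).le
      · exact norm_deriv_le_div_of_mapsTo_ball hd hmaps hr
    rw [mul_div_cancel₀ _ hr.ne'] at hw'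
    rw [hgc, mem_closedBall_iff_norm, hg, sub_right_comm]
    have := norm_sub_le (f w - f c) ((w - c) • deriv f c)
    rw [norm_smul] at this
    linarith [mem_closedBall_iff_norm.1 (hmaps hw)]
  have hgo : (fun w => g w - g c) =o[𝓝 c] fun w => ‖w - c‖ ^ 1 := by
    have := (hd.differentiableAt (Metric.ball_mem_nhds c hr)).hasDerivAt.isLittleO
    simpa [hg, hgc, sub_right_comm] using this.norm_right
  have := dist_le_mul_div_pow_of_mapsTo_ball_of_isLittleO (n := 1) hgd hg_maps hgo hz
  rwa [hgc, dist_eq_norm, dist_eq_norm, hg, sub_right_comm] at this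

lemma tendstoUniformlyOn_slope_line {G : Type*} [NormedAddCommGroup G] [NormedSpace ℂ G]
    {φ : G → E} {K : Set ℂ} {a v : G} (hr : 0 < r)
    (hφ : ∀ t ∈ K, ∀ h ∈ Metric.ball (0 : ℂ) r, DifferentiableAt ℂ φ (t • a + h • v))
    (hC : ∀ t ∈ K, ∀ h ∈ Metric.ball (0 : ℂ) r, ‖φ (t • a + h • v)‖ ≤ C) :
    TendstoUniformlyOn (fun (h t : ℂ) => h⁻¹ • (φ (t • a + h • v) - φ (t • a)))
      (fun t => fderiv ℂ φ (t • a) v) (𝓝[≠] 0) K := by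
  refine Metric.tendstoUniformlyOn_iff.2 fun δ hδ => ?_
  have hsmall : ∀ᶠ h : ℂ in 𝓝 0, 4 * C * (‖h‖ / r ^ 2) < δ :=
    ContinuousAt.eventually_lt (by fun_prop) continuousAt_const (by simpa)
  filter_upwards [hsmall.filter_mono nhdsWithin_le_nhds, self_mem_nhdsWithin,
    mem_nhdsWithin_of_mem_nhds (Metric.ball_mem_nhds 0 hr)] with h hhδ hh0 hh t ht
  have hline (w : ℂ) (hw : w ∈ Metric.ball (0 : ℂ) r) :
      HasDerivAt (fun h : ℂ => φ (t • a + h • v)) (fderiv ℂ φ (t • a + w • v) v) w :=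
    (hφ t ht w hw).hasFDerivAt.comp_hasDerivAt (l := φ) w
      ((((hasDerivAt_id w).smul_const v).const_add (t • a)).congr_deriv (one_smul ℂ v))
  have htaylor := norm_sub_sub_smul_deriv_le
    (fun w hw => (hline w hw).differentiableAt.differentiableWithinAt) (hC t ht) hh
  rw [(hline 0 (Metric.mem_ball_self hr)).deriv, zero_smul, add_zero, sub_zero] at htaylor
  have hh0' : 0 < ‖h‖ := norm_pos_iff.2 hh0
  calc dist (fderiv ℂ φ (t • a) v) (h⁻¹ • (φ (t • a + h • v) - φ (t • a)))
      = ‖h‖⁻¹ * ‖φ (t • a + h • v) - φ (t • a) - h • fderiv ℂ φ (t • a) v‖ := by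
        rw [dist_comm, dist_eq_norm, ← norm_inv, ← norm_smul, smul_sub h⁻¹ (_ - _), smul_smul,
          inv_mul_cancel₀ hh0, one_smul]
    _ ≤ ‖h‖⁻¹ * (4 * C * (‖h‖ / r) ^ 2) := by gcongr
    _ = 4 * C * (‖h‖ / r ^ 2) := by field_simp
    _ < δ := hhδ

lemma differentiableAt_fderiv_line [CompleteSpace E] {G : Type*} [NormedAddCommGroup G]
    [NormedSpace ℂ G] {φ : G → E} {Ω : Set G} (hΩ : IsOpen Ω) (hφ : DifferentiableOn ℂ φ Ω)
    (a v : G) {t₀ : ℂ} (ht₀ : t₀ • a ∈ Ω) :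
    DifferentiableAt ℂ (fun t : ℂ => fderiv ℂ φ (t • a) v) t₀ := by
  have hdiff (Z : G) (hZ : Z ∈ Ω) : DifferentiableAt ℂ φ Z := hφ.differentiableAt (hΩ.mem_nhds hZ)
  have hline : Tendsto (fun p : ℂ × ℂ => p.1 • a + p.2 • v) (𝓝 (t₀, 0)) (𝓝 (t₀ • a)) :=
    Continuous.tendsto' (by fun_prop) _ _ (by simp)
  have hnear : ∀ᶠ Z in 𝓝 (t₀ • a), Z ∈ Ω ∧ ‖φ Z‖ ≤ ‖φ (t₀ • a)‖ + 1 :=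
    (hΩ.eventually_mem ht₀).and
      ((hdiff _ ht₀).continuousAt.norm.eventually_le_const (lt_add_one _))
  obtain ⟨r, hr, hball⟩ := Metric.eventually_nhds_iff_ball.1 (hline.eventually hnear)
  simp only [← ball_prod_same, Prod.forall, mem_prod, and_imp] at hball
  have hunif := tendstoUniformlyOn_slope_line (K := Metric.ball t₀ r) hr
    (fun t ht h hh => hdiff _ (hball t h ht hh).1) (fun t ht h hh => (hball t h ht hh).2)
  refine (hunif.tendstoLocallyUniformlyOn.differentiableOn ?_ Metric.isOpen_ball).differentiableAt
    (Metric.ball_mem_nhds t₀ hr)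
  filter_upwards [mem_nhdsWithin_of_mem_nhds (Metric.ball_mem_nhds 0 hr)] with h hh t ht
  have hφh := hdiff _ (hball t h ht hh).1
  have hφ0 : DifferentiableAt ℂ φ (t • a) := by
    simpa using hdiff _ (hball t 0 ht (Metric.mem_ball_self hr)).1
  exact (((hφh.comp (g := φ) t (by fun_prop)).sub
    (hφ0.comp (g := φ) t (by fun_prop))).const_smul h⁻¹).differentiableWithinAt

end HolomorphicParameter

section Divergence

lemma one_add_norm_sq_le_height_sq {ι : Type*} [Fintype ι] (y : ι → ℝ) :
    1 + ‖y‖ ^ 2 ≤ height y ^ 2 := by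
  have hle : ‖y‖ ≤ √(y ⬝ᵥ y) := (pi_norm_le_iff_of_nonneg (Real.sqrt_nonneg _)).2 fun j =>
    Real.abs_le_sqrt (by
      rw [sq]
      exact Finset.single_le_sum (f := fun j => y j * y j) (fun i _ => mul_self_nonneg _)
        (Finset.mem_univ j))
  rw [height_sq, ← Real.sq_sqrt (dotProduct_self_nonneg y)]
  gcongr

lemma integrable_inv_height_pow {ι : Type*} [Fintype ι] {k : ℕ} (hk : Fintype.card ι < k) :
    Integrable fun y : ι → ℝ => (height y)⁻¹ ^ k := by
  refine (integrable_rpow_neg_one_add_norm_sq (E := ι → ℝ) (μ := volume) (r := k)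
    (by simpa using hk)).mono' ?_ (Eventually.of_forall fun y => ?_)
  · exact ((continuous_height.inv₀ fun y => (height_pos y).ne').pow k).aestronglyMeasurable
  · have hy := height_pos y
    calc ‖(height y)⁻¹ ^ k‖ = (height y ^ 2) ^ (-k / 2 : ℝ) := by
          rw [Real.norm_of_nonneg (by positivity), ← Real.rpow_natCast (height y) 2,
            ← Real.rpow_mul hy.le, inv_pow, ← Real.rpow_natCast, ← Real.rpow_neg hy.le]
          congr 1
          push_cast
          ring
      _ ≤ (1 + ‖y‖ ^ 2) ^ (-k / 2 : ℝ) :=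
          Real.rpow_le_rpow_of_nonpos (by positivity) (one_add_norm_sq_le_height_sq y)
            (div_nonpos_of_nonpos_of_nonneg (by simp) zero_le_two)

variable {n : ℕ} {E : Type*} [NormedAddCommGroup E] [NormedSpace ℝ E]

lemma norm_integral_face_le {v : (Fin (n + 1) → ℝ) → E} {C : ℝ} (hC : 0 ≤ C)
    (hv : ∀ y, ‖v y‖ ≤ C * (height y)⁻¹ ^ (n + 1)) {a s : ℝ} (ha : 0 < a) (hs : |s| = a)
    (i : Fin (n + 1)) :
    ‖∫ x in Icc ((fun _ => -a) ∘ i.succAbove) ((fun _ => a) ∘ i.succAbove),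
      v (i.insertNth s x)‖ ≤ C / a ^ (n + 1) * (2 * a) ^ n := by
  have hvol : volume.real (Icc ((fun _ : Fin (n + 1) => -a) ∘ i.succAbove)
      ((fun _ : Fin (n + 1) => a) ∘ i.succAbove)) = (2 * a) ^ n := by
    rw [Measure.real, Real.volume_Icc_pi_toReal fun j => by
      simpa using (neg_lt_self ha).le]
    simp [two_mul]
  rw [← hvol]
  refine norm_setIntegral_le_of_norm_le_const ?_ fun x _ => (hv _).trans ?_
  · exact isCompact_Icc.measure_lt_top
  · have hle : a ≤ height (i.insertNth (α := fun _ => ℝ) s x) := by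
      simpa [hs] using abs_le_height (i.insertNth (α := fun _ => ℝ) s x) i
    rw [inv_pow, ← div_eq_mul_inv]
    gcongr

lemma norm_integral_cube_divergence_le {V : Fin (n + 1) → (Fin (n + 1) → ℝ) → E}
    (hV : ∀ i, Differentiable ℝ (V i)) {C : ℝ} (hC : 0 ≤ C)
    (hbound : ∀ i y, ‖V i y‖ ≤ C * (height y)⁻¹ ^ (n + 1)) {a : ℝ} (ha : 0 < a)
    (hi : IntegrableOn (fun y => ∑ i, fderiv ℝ (V i) y (Pi.single i 1))
      (Icc (fun _ => -a) (fun _ => a))) :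
    ‖∫ y in Icc (fun _ => -a) (fun _ => a), ∑ i, fderiv ℝ (V i) y (Pi.single i 1)‖ ≤
      (n + 1) * 2 ^ (n + 1) * C / a := by
  rw [integral_divergence_of_hasFDerivAt_off_countable' (fun _ => -a) (fun _ => a)
    (fun _ => (neg_lt_self ha).le) V (fun i => fderiv ℝ (V i)) ∅ countable_empty
    (fun i => (hV i).continuous.continuousOn) (fun y _ i => (hV i y).hasFDerivAt) hi]
  calc _ ≤ ∑ i : Fin (n + 1), 2 * (C / a ^ (n + 1) * (2 * a) ^ n) := by
        refine norm_sum_le_of_le _ fun i _ => (norm_sub_le _ _).trans ?_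
        rw [two_mul]
        exact add_le_add (norm_integral_face_le hC (hbound i) ha (abs_of_pos ha) i)
          (norm_integral_face_le hC (hbound i) ha (by rw [abs_neg, abs_of_pos ha]) i)
    _ = (n + 1) * 2 ^ (n + 1) * C / a := by
        rw [Finset.sum_const, Finset.card_univ, Fintype.card_fin, nsmul_eq_mul]
        push_cast
        field_simp
        ring

lemma aecover_cube {ι : Type*} [Finite ι] {μ : Measure (ι → ℝ)} :
    AECover μ atTop fun a : ℝ => Icc (fun _ => -a) (fun _ => a) := by
  refine aecover_Icc (tendsto_atBot.2 fun b => ?_) (tendsto_atTop.2 fun b => ?_)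
  · have : ∀ᶠ a : ℝ in atTop, ∀ i, -a ≤ b i :=
      eventually_all.2 fun i => tendsto_neg_atTop_atBot.eventually_le_atBot (b i)
    exact this
  · exact (eventually_all.2 fun i => eventually_ge_atTop (b i) : ∀ᶠ a : ℝ in atTop, ∀ i, b i ≤ a)

lemma integral_divergence_eq_zero {V : Fin (n + 1) → (Fin (n + 1) → ℝ) → E}
    (hV : ∀ i, Differentiable ℝ (V i)) {C : ℝ} (hC : 0 ≤ C)
    (hbound : ∀ i y, ‖V i y‖ ≤ C * (height y)⁻¹ ^ (n + 1))
    (hi : Integrable fun y => ∑ i, fderiv ℝ (V i) y (Pi.single i 1)) :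
    ∫ y, ∑ i, fderiv ℝ (V i) y (Pi.single i 1) = 0 := by
  refine tendsto_nhds_unique (aecover_cube.integral_tendsto_of_countably_generated hi)
    (squeeze_zero_norm' (a := fun a => (n + 1) * 2 ^ (n + 1) * C / a) ?_
      (tendsto_const_nhds.div_atTop tendsto_id))
  filter_upwards [eventually_gt_atTop 0] with a ha
  exact norm_integral_cube_divergence_le hV hC hbound ha hi.integrableOn

end Divergence

section Sector

/-- The sector of complex numbers `t` with `|arg t| < arctan κ`. -/
def sector (κ : ℝ) : Set ℂ := {t | 0 < t.re ∧ |t.im| < κ * t.re}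

lemma isOpen_sector (κ : ℝ) : IsOpen (sector κ) :=
  (isOpen_lt continuous_const continuous_re).inter
    (isOpen_lt continuous_im.abs (continuous_const.mul continuous_re))

lemma convex_sector (κ : ℝ) : Convex ℝ (sector κ) := by
  refine (convex_halfSpace_re_gt 0).inter fun s hs t ht a b ha hb _ => ?_
  change |s.im| < κ * s.re at hs
  change |t.im| < κ * t.re at ht
  change |(a • s + b • t).im| < κ * (a • s + b • t).re
  simp only [abs_lt, add_re, add_im, real_smul, re_ofReal_mul, im_ofReal_mul] at *
  rcases ha.eq_or_lt with rfl | ha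
  · have : 0 < b := by linarith
    constructor <;> nlinarith
  · constructor <;> nlinarith

end Sector

section DetBounds

lemma one_add_norm_le_mul_norm_sub {t x : ℂ} {d B : ℝ} (hd : 0 < d) (hB : ‖t‖ ≤ B)
    (h : d ≤ ‖t - x‖) : 1 + ‖x‖ ≤ ((1 + B) / d + 1) * ‖t - x‖ := by
  have hx : ‖x‖ ≤ ‖t‖ + ‖t - x‖ := by
    simpa using norm_sub_le t (t - x)
  have hB' : 0 ≤ 1 + B := by linarith [norm_nonneg t]
  calc 1 + ‖x‖ ≤ (1 + B) / d * d + ‖t - x‖ := by rw [div_mul_cancel₀ _ hd.ne']; linarith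
    _ ≤ (1 + B) / d * ‖t - x‖ + ‖t - x‖ := by gcongr
    _ = ((1 + B) / d + 1) * ‖t - x‖ := by ring

lemma one_add_norm_add_le_mul_norm_mul {t x x' : ℂ} {d B : ℝ} (hd : 0 < d) (hB : ‖t‖ ≤ B)
    (h : d ≤ ‖t - x‖) (h' : d ≤ ‖t - x'‖) :
    1 + ‖x + x'‖ ≤ ((1 + B) / d + 1) ^ 2 * ‖(t - x) * (t - x')‖ := by
  calc 1 + ‖x + x'‖ ≤ (1 + ‖x‖) * (1 + ‖x'‖) := by
        nlinarith [norm_add_le x x', mul_nonneg (norm_nonneg x) (norm_nonneg x')]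
    _ ≤ (((1 + B) / d + 1) * ‖t - x‖) * (((1 + B) / d + 1) * ‖t - x'‖) :=
        mul_le_mul (one_add_norm_le_mul_norm_sub hd hB h) (one_add_norm_le_mul_norm_sub hd hB h')
          (by positivity) ((by positivity : (0 : ℝ) ≤ 1 + ‖x‖).trans
            (one_add_norm_le_mul_norm_sub hd hB h))
    _ = ((1 + B) / d + 1) ^ 2 * ‖(t - x) * (t - x')‖ := by rw [norm_mul]; ring

lemma two_mul_abs_le_mul_norm_quadratic {t : ℂ} {d B ρ g : ℝ} (hd : 0 < d) (hB : ‖t‖ ≤ B)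
    (hρ : 0 ≤ ρ) (hg : 1 ≤ |g|) (h : d ≤ |t.im| ∨ d ≤ t.re ∧ g ≤ 0) :
    2 * ρ * |g| ≤ ((1 + B) / d + 1) ^ 2 * ‖t ^ 2 - 2 * ρ * g * t + ρ ^ 2‖ := by
  have hr : √(g ^ 2 - 1) ^ 2 = g ^ 2 - 1 :=
    Real.sq_sqrt (sub_nonneg.2 (one_le_sq_iff_one_le_abs g |>.2 hg))
  have hrg : √(g ^ 2 - 1) ≤ |g| := Real.sqrt_le_iff.2 ⟨abs_nonneg g, by rw [sq_abs]; linarith⟩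
  have hr0 := Real.sqrt_nonneg (g ^ 2 - 1)
  set r := √(g ^ 2 - 1)
  have hfactor : t ^ 2 - 2 * ρ * g * t + ρ ^ 2 =
      (t - (ρ * (g + r) : ℝ)) * (t - (ρ * (g - r) : ℝ)) := by
    have hr' : (r : ℂ) ^ 2 = g ^ 2 - 1 := by exact_mod_cast hr
    push_cast
    linear_combination ρ ^ 2 * hr'
  have hroot (x : ℝ) (hx : g ≤ 0 → x ≤ 0) : d ≤ ‖t - x‖ := by
    rcases h with h | ⟨h, hg0⟩
    · exact h.trans (by simpa using abs_im_le_norm (t - x))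
    · refine (h.trans ?_).trans (re_le_norm _)
      simpa using hx hg0
  have hsum := one_add_norm_add_le_mul_norm_mul hd hB
    (hroot (ρ * (g + r)) fun hg0 => mul_nonpos_of_nonneg_of_nonpos hρ (by
      rw [abs_of_nonpos hg0] at hrg; linarith))
    (hroot (ρ * (g - r)) fun hg0 => mul_nonpos_of_nonneg_of_nonpos hρ (by linarith))
  rw [hfactor]
  refine le_trans (le_of_eq ?_) ((le_add_of_nonneg_left zero_le_one).trans hsum)
  rw [← ofReal_add, norm_real, Real.norm_eq_abs, ← mul_add, add_add_sub_cancel, abs_mul,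
    abs_of_nonneg hρ, ← two_mul, abs_mul, abs_two]
  ring

variable {ι : Type*} [Fintype ι]

/-- The constant in the lower bound `gap y' * height y ≤ |pairing τ y y'|`. -/
noncomputable def gap (y' : ι → ℝ) : ℝ := height y' - √(y' ⬝ᵥ y')

lemma gap_pos (y' : ι → ℝ) : 0 < gap y' :=
  sub_pos.2 (Real.sqrt_lt_sqrt (dotProduct_self_nonneg y') (lt_one_add _))

lemma abs_dotProduct_le (y y' : ι → ℝ) : |y ⬝ᵥ y'| ≤ √(y ⬝ᵥ y) * √(y' ⬝ᵥ y') := by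
  rw [← Real.sqrt_mul (dotProduct_self_nonneg y)]
  refine Real.abs_le_sqrt ?_
  simpa only [dotProduct, ← sq] using Finset.sum_mul_sq_le_sq_mul_sq Finset.univ y y'

lemma one_add_abs_dotProduct_le (y y' : ι → ℝ) : 1 + |y ⬝ᵥ y'| ≤ height y * height y' := by
  refine (add_le_add_right (abs_dotProduct_le y y') 1).trans (abs_le_of_sq_le_sq' ?_
    (mul_pos (height_pos y) (height_pos y')).le).2
  have ha := Real.sq_sqrt (dotProduct_self_nonneg y)
  have hb := Real.sq_sqrt (dotProduct_self_nonneg y')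
  rw [mul_pow, height_sq, height_sq]
  nlinarith [sq_nonneg (√(y ⬝ᵥ y) - √(y' ⬝ᵥ y'))]

lemma gap_mul_height_add_abs_dotProduct_le (y y' : ι → ℝ) :
    gap y' * height y + |y ⬝ᵥ y'| ≤ height y * height y' := by
  have hle : √(y ⬝ᵥ y) ≤ height y := Real.sqrt_le_sqrt (le_add_of_nonneg_left zero_le_one)
  have := mul_le_mul_of_nonneg_right hle (Real.sqrt_nonneg (y' ⬝ᵥ y'))
  rw [gap, sub_mul]
  linarith [abs_dotProduct_le y y']

lemma height_mul_sub_abs_dotProduct_le_abs_pairing {τ : ℝ} (hτ : τ ^ 2 = 1) (y y' : ι → ℝ) :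
    height y * height y' - |y ⬝ᵥ y'| ≤ |pairing τ y y'| := by
  have hh := abs_of_pos (mul_pos (height_pos y) (height_pos y'))
  have := abs_sub_abs_le_abs_sub (τ * (height y * height y')) (y ⬝ᵥ y')
  rwa [abs_mul, abs_eq_abs.2 (sq_eq_one_iff.1 hτ), abs_one, one_mul, hh] at this

lemma one_le_abs_pairing {τ : ℝ} (hτ : τ ^ 2 = 1) (y y' : ι → ℝ) : 1 ≤ |pairing τ y y'| := by
  linarith [height_mul_sub_abs_dotProduct_le_abs_pairing hτ y y', one_add_abs_dotProduct_le y y']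

lemma gap_mul_height_le_abs_pairing {τ : ℝ} (hτ : τ ^ 2 = 1) (y y' : ι → ℝ) :
    gap y' * height y ≤ |pairing τ y y'| := by
  linarith [height_mul_sub_abs_dotProduct_le_abs_pairing hτ y y',
    gap_mul_height_add_abs_dotProduct_le y y']

lemma pairing_neg_one_nonpos (y y' : ι → ℝ) : pairing (-1) y y' ≤ 0 := by
  rw [pairing]
  linarith [one_add_abs_dotProduct_le y y', neg_abs_le (y ⬝ᵥ y')]

lemma height_le_mul_norm_det_one_sub {t : ℂ} {d B : ℝ} (hd : 0 < d) (hB : ‖t‖ ≤ B)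
    (ht : d ≤ t.re) {σ : ℝ} (hσ : σ ^ 2 = 1) (y : Fin 3 → ℝ) :
    height y ≤ ((1 + B) / d + 1) ^ 2 * ‖(1 - t • unitSheet σ y).det‖ := by
  have habs : |-(σ * height y)| = height y := by
    rw [abs_neg, abs_mul, abs_eq_abs.2 (sq_eq_one_iff.1 hσ), abs_one, one_mul,
      abs_of_pos (height_pos y)]
  have hdet : (1 - t • unitSheet σ y).det =
      (I * t) ^ 2 - 2 * (1 : ℝ) * (-(σ * height y) : ℝ) * (I * t) + (1 : ℝ) ^ 2 := by
    rw [det_one_sub_smul_unitSheet hσ]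
    push_cast
    linear_combination -t ^ 2 * I_sq
  have hquad := two_mul_abs_le_mul_norm_quadratic (t := I * t) (B := B) (ρ := 1)
    (g := -(σ * height y)) hd (by rwa [norm_mul, norm_I, one_mul]) zero_le_one
    ((one_le_height y).trans_eq habs.symm) (Or.inl (by simpa using ht.trans (le_abs_self _)))
  rw [← hdet, habs] at hquad
  linarith [height_pos y]

lemma height_le_mul_norm_det_sub {t : ℂ} {d B ρ : ℝ} (hd : 0 < d) (hB : ‖t‖ ≤ B) (hρ : 0 ≤ ρ)
    {σ σ' : ℝ} (hσ : σ ^ 2 = 1) (hσ' : σ' ^ 2 = 1) (y y' : Fin 3 → ℝ)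
    (h : d ≤ |t.im| ∨ d ≤ t.re ∧ σ * σ' = -1) :
    2 * ρ * gap y' * height y ≤
      ((1 + B) / d + 1) ^ 2 * ‖(t • unitSheet σ y - (ρ : ℂ) • unitSheet σ' y').det‖ := by
  have hτ : (σ * σ') ^ 2 = 1 := by rw [mul_pow, hσ, hσ', one_mul]
  have hquad := two_mul_abs_le_mul_norm_quadratic hd hB hρ (one_le_abs_pairing hτ y y')
    (h.imp_right fun ⟨ht, hσσ'⟩ => ⟨ht, by rw [hσσ']; exact pairing_neg_one_nonpos y y'⟩)
  rw [det_smul_unitSheet_sub hσ hσ', norm_neg]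
  refine le_trans ?_ hquad
  rw [mul_assoc]
  gcongr
  exact gap_mul_height_le_abs_pairing hτ y y'

end DetBounds

section Decay

/-- The filter on `ℂ × (Fin 3 → ℝ)` along which estimates hold locally uniformly in the parameter
near `t` and uniformly on the sheet. -/
noncomputable abbrev sheetFilter (t : ℂ) : Filter (ℂ × (Fin 3 → ℝ)) := 𝓝 t ×ˢ ⊤

lemma exists_bound_of_isBigO {E F : Type*} [Norm E] [Norm F] {t : ℂ} {f : ℂ × (Fin 3 → ℝ) → E}
    {g : ℂ × (Fin 3 → ℝ) → F} (h : f =O[sheetFilter t] g) :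
    ∃ C, ∀ᶠ s in 𝓝 t, ∀ y, ‖f (s, y)‖ ≤ C * ‖g (s, y)‖ := by
  obtain ⟨C, hC⟩ := h.bound
  exact ⟨C, mem_prod_top.1 hC⟩

lemma isBigO_matrix_mul {α : Type*} {l : Filter α} {m : ℕ} {f : α → HC} {g : α → Val m}
    {a b : α → ℝ} (hf : f =O[l] a) (hg : g =O[l] b) :
    (fun x => f x * g x) =O[l] fun x => a x * b x :=
  (IsBigO.of_norm_le fun x => by simpa using Matrix.linfty_opNorm_mul (f x) (g x)).trans
    (hf.norm_left.mul hg.norm_left)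

lemma isBigO_adj {α : Type*} {l : Filter α} {f : α → HC} {a : α → ℝ} (hf : f =O[l] a) :
    (fun x => adj (f x)) =O[l] a :=
  (adj.isBigO_comp f l).trans hf

lemma isBigO_const_height (l : Filter (ℂ × (Fin 3 → ℝ))) {E : Type*} [SeminormedAddCommGroup E]
    (c : E) : (fun _ => c) =O[l] fun p => height p.2 :=
  (isBigO_const_const c (one_ne_zero' ℝ) l).trans <| IsBigO.of_norm_le fun p => by
    simpa using one_le_height p.2

lemma isBigO_fst (t : ℂ) : (fun p => p.1) =O[sheetFilter t] fun _ => (1 : ℝ) :=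
  tendsto_fst.isBigO_one ℝ

lemma isBigO_coord_height (l : Filter (ℂ × (Fin 3 → ℝ))) (i : Fin 3) :
    (fun p => (p.2 i : ℂ)) =O[l] fun p => height p.2 :=
  IsBigO.of_norm_le fun p => by simpa using abs_le_height p.2 i

lemma isBigO_unitSheet (l : Filter (ℂ × (Fin 3 → ℝ))) (σ : ℝ) :
    (fun p => unitSheet σ p.2) =O[l] fun p => height p.2 := by
  have hsmul {c : ℂ × (Fin 3 → ℝ) → ℂ} (hc : c =O[l] fun p => height p.2) (Z : HC) :
      (fun p => c p • Z) =O[l] fun p => height p.2 := by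
    simpa using hc.smul (isBigO_const_const Z (one_ne_zero' ℝ) l)
  have hheight : (fun p : ℂ × (Fin 3 → ℝ) => (height p.2 : ℂ)) =O[l] fun p => height p.2 :=
    IsBigO.of_norm_le fun p => by simp [abs_of_pos (height_pos p.2)]
  exact (hsmul (hheight.const_mul_left _).neg_left _).add
    (IsBigO.fun_sum fun j _ => hsmul (isBigO_coord_height l j) _)

lemma isBigO_adj_sub (σ : ℝ) (t : ℂ) (W : HC) :
    (fun p => adj (p.1 • unitSheet σ p.2 - W)) =O[sheetFilter t] fun p => height p.2 := by
  refine isBigO_adj (IsBigO.sub ?_ (isBigO_const_height _ W))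
  simpa using (isBigO_fst t).smul (isBigO_unitSheet _ σ)

lemma adj_sub_mul_unitSheet_mul_adj {σ : ℝ} (hσ : σ ^ 2 = 1) (W : HC) (t : ℂ) (y : Fin 3 → ℝ) :
    adj (t • unitSheet σ y - W) * unitSheet σ y * adj (1 - t • unitSheet σ y) =
      t ^ 2 • adj (unitSheet σ y) - t • 1 - adj W * unitSheet σ y - t • adj W := by
  have hadj_mul := adj_mul_self (unitSheet σ y)
  have hmul_adj := mul_adj_self (unitSheet σ y)
  rw [det_unitSheet hσ] at hadj_mul hmul_adj
  rw [map_sub, map_sub, map_smul, adj_one]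
  generalize adj (unitSheet σ y) = P at *
  generalize adj W = Q
  generalize unitSheet σ y = Y at *
  have hPYP : P * Y * P = -P := by rw [hadj_mul]; simp
  have hQYP : Q * Y * P = -Q := by rw [mul_assoc, hmul_adj]; simp
  calc (t • P - Q) * Y * (1 - t • P)
      = t • (P * Y) - t ^ 2 • (P * Y * P) - Q * Y + t • (Q * Y * P) := by
        simp only [sub_mul, mul_sub, smul_mul_assoc, mul_smul_comm, mul_one]
        module
    _ = t ^ 2 • P - t • 1 - Q * Y - t • Q := by
        rw [hPYP, hQYP, hadj_mul]
        module

lemma isBigO_adj_sub_mul_unitSheet_mul_adj {σ : ℝ} (hσ : σ ^ 2 = 1) (t : ℂ) (W : HC) :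
    (fun p => adj (p.1 • unitSheet σ p.2 - W) * unitSheet σ p.2 *
      adj (1 - p.1 • unitSheet σ p.2)) =O[sheetFilter t] fun p => height p.2 := by
  simp only [adj_sub_mul_unitSheet_mul_adj hσ]
  have hY := isBigO_unitSheet (sheetFilter t) σ
  have ht := isBigO_fst t
  refine ((IsBigO.sub ?_ ?_).sub ?_).sub ?_
  · simpa using (ht.pow 2).smul (isBigO_adj hY)
  · simpa using ht.smul (isBigO_const_height _ (1 : HC))
  · simpa using isBigO_matrix_mul (isBigO_const_const (adj W) (one_ne_zero' ℝ) _) hY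
  · simpa using ht.smul (isBigO_const_height _ (adj W))

lemma isBigO_height_det_one_sub {σ : ℝ} (hσ : σ ^ 2 = 1) {t : ℂ} (ht : 0 < t.re) :
    (fun p => height p.2) =O[sheetFilter t] fun p => (1 - p.1 • unitSheet σ p.2).det := by
  have hre : ∀ᶠ s in 𝓝 t, t.re / 2 ≤ s.re :=
    continuous_re.continuousAt.eventually_const_le (half_lt_self ht)
  have hnorm : ∀ᶠ s in 𝓝 t, ‖s‖ ≤ ‖t‖ + 1 :=
    continuous_norm.continuousAt.eventually_le_const (lt_add_one _)
  refine IsBigO.of_bound (((1 + (‖t‖ + 1)) / (t.re / 2) + 1) ^ 2) (mem_prod_top.2 ?_)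
  filter_upwards [hre, hnorm] with s hs hs' y
  rw [Real.norm_of_nonneg (height_pos y).le]
  exact height_le_mul_norm_det_one_sub (half_pos ht) hs' hs hσ y

end Decay

section ConeRegular

variable {m : ℕ}

/-- The union of the two sheets of the hyperboloid `H₁`, rotated and rescaled by the parameters of
a sector. -/
def cone (κ : ℝ) : Set HC :=
  {Z | ∃ t ∈ sector κ, ∃ σ : ℝ, σ ^ 2 = 1 ∧ ∃ y, t • unitSheet σ y = Z}

lemma smul_unitSheet_mem_cone {κ : ℝ} {t : ℂ} (ht : t ∈ sector κ) {σ : ℝ} (hσ : σ ^ 2 = 1)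
    (y : Fin 3 → ℝ) : t • unitSheet σ y ∈ cone κ :=
  ⟨t, ht, σ, hσ, y, rfl⟩

/-- Holomorphic left-regular functions on a cone with the growth forced by regularity at the points
of `U(2)` at infinity: up to conformal inversion, `N(1 - Z) (1 - Z) φ(Z)` is the function on
`U(2)`. -/
structure ConeRegular (φ : HC → Val m) (κ : ℝ) : Prop where
  differentiableAt : ∀ Z ∈ cone κ, DifferentiableAt ℂ φ Z
  fueterOp_fderiv : ∀ Z ∈ cone κ, fueterOp (fderiv ℂ φ Z) = 0
  bounded : ∃ C, ∀ Z ∈ cone κ, ‖(1 - Z).det • ((1 - Z) * φ Z)‖ ≤ C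

/-- A uniform form of the condition that `N(t Y - Y₀) ≠ 0` for `t ∈ T` and `Y` on the sheet `σ`. -/
def Avoids (Y₀ : HC) (σ : ℝ) (T : Set ℂ) : Prop :=
  ∀ t ∈ T, (fun p => height p.2) =O[sheetFilter t] fun p => (p.1 • unitSheet σ p.2 - Y₀).det

variable {φ : HC → Val m} {κ : ℝ} {Y₀ : HC} {σ : ℝ} {T : Set ℂ} {t : ℂ}

lemma Avoids.mono {T' : Set ℂ} (h : Avoids Y₀ σ T') (hT : T ⊆ T') : Avoids Y₀ σ T :=
  fun t ht => h t (hT ht)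

lemma eventually_ne_zero_of_isBigO_height {f : ℂ × (Fin 3 → ℝ) → ℂ}
    (h : (fun p => height p.2) =O[sheetFilter t] f) : ∀ᶠ p in sheetFilter t, f p ≠ 0 := by
  filter_upwards [h.eq_zero_imp] with p hp h0
  exact (height_pos p.2).ne' (hp h0)

lemma Avoids.det_ne_zero (h : Avoids Y₀ σ T) (ht : t ∈ T) (y : Fin 3 → ℝ) :
    (t • unitSheet σ y - Y₀).det ≠ 0 :=
  mem_of_mem_nhds (mem_prod_top.1 (eventually_ne_zero_of_isBigO_height (h t ht))) y

lemma isBigO_inv_of_isBigO_height {f : ℂ × (Fin 3 → ℝ) → ℂ}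
    (h : (fun p => height p.2) =O[sheetFilter t] f) :
    (fun p => (f p)⁻¹) =O[sheetFilter t] fun p => (height p.2)⁻¹ :=
  h.inv_rev (.of_forall fun p h0 => absurd h0 (height_pos p.2).ne')

lemma isBigO_prefactor (t : ℂ) (σ : ℝ) (n : ℕ) :
    (fun p => I * σ * p.1 ^ n / height p.2) =O[sheetFilter t] fun p => (height p.2)⁻¹ := by
  have hinv : (fun p : ℂ × (Fin 3 → ℝ) => (height p.2 : ℂ)⁻¹) =O[sheetFilter t]
      fun p => (height p.2)⁻¹ :=
    IsBigO.of_norm_le fun p => by simp [abs_of_pos (height_pos p.2)]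
  simpa [div_eq_mul_inv] using (((isBigO_fst t).pow n).const_mul_left (I * σ)).mul hinv

namespace ConeRegular

lemma isBigO_mul (hφ : ConeRegular φ κ) (hσ : σ ^ 2 = 1) (ht : t ∈ sector κ)
    {X : ℂ × (Fin 3 → ℝ) → HC}
    (hX : (fun p => X p * adj (1 - p.1 • unitSheet σ p.2)) =O[sheetFilter t]
      fun p => height p.2) :
    (fun p => X p * φ (p.1 • unitSheet σ p.2)) =O[sheetFilter t] fun p => (height p.2)⁻¹ := by
  obtain ⟨C, hC⟩ := hφ.bounded
  have hdet := isBigO_height_det_one_sub hσ ht.1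
  have hΦ : (fun p : ℂ × (Fin 3 → ℝ) => (1 - p.1 • unitSheet σ p.2).det •
      ((1 - p.1 • unitSheet σ p.2) * φ (p.1 • unitSheet σ p.2))) =O[sheetFilter t]
      fun _ => (1 : ℝ) := by
    refine IsBigO.of_bound C (mem_prod_top.2 ?_)
    filter_upwards [(isOpen_sector κ).mem_nhds ht] with s hs y
    simpa using hC _ (smul_unitSheet_mem_cone hs hσ y)
  refine (((isBigO_inv_of_isBigO_height hdet).pow 2).smul (isBigO_matrix_mul hX hΦ)).congr' ?_ ?_
  · filter_upwards [eventually_ne_zero_of_isBigO_height hdet] with p hp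
    rw [Matrix.mul_smul, Matrix.mul_assoc, ← Matrix.mul_assoc (adj _), adj_mul_self,
      Matrix.smul_mul, Matrix.one_mul, Matrix.mul_smul, smul_smul, smul_smul, mul_assoc, ← sq,
      ← mul_pow, inv_mul_cancel₀ hp, one_pow, one_smul]
  · refine .of_forall fun p => ?_
    have := height_pos p.2
    simp only [smul_eq_mul]
    field_simp

lemma isBigO_comp_unitSheet (hφ : ConeRegular φ κ) (hσ : σ ^ 2 = 1) (ht : t ∈ sector κ) :
    (fun p => φ (p.1 • unitSheet σ p.2)) =O[sheetFilter t] fun p => (height p.2)⁻¹ := by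
  have hadj : (fun p => (-1 : HC) * adj (1 - p.1 • unitSheet σ p.2)) =O[sheetFilter t]
      fun p => height p.2 := by
    simpa using isBigO_adj_sub σ t 1
  simpa using hφ.isBigO_mul hσ ht hadj

lemma isBigO_fueterKernel_mul_unitSheet_mul (hφ : ConeRegular φ κ) (hσ : σ ^ 2 = 1)
    (ht : t ∈ sector κ)
    (hA : (fun p => height p.2) =O[sheetFilter t] fun p => (p.1 • unitSheet σ p.2 - Y₀).det) :
    (fun p => fueterKernel (p.1 • unitSheet σ p.2 - Y₀) * unitSheet σ p.2 *
      φ (p.1 • unitSheet σ p.2)) =O[sheetFilter t] fun p => (height p.2)⁻¹ ^ 3 := by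
  have hadj := hφ.isBigO_mul hσ ht (isBigO_adj_sub_mul_unitSheet_mul_adj hσ t Y₀)
  simpa only [fueterKernel_eq, smul_mul_assoc, Matrix.smul_mul, smul_eq_mul, ← pow_succ] using
    ((isBigO_inv_of_isBigO_height hA).pow 2).smul hadj

lemma isBigO_sheetCoeff (hφ : ConeRegular φ κ) (hσ : σ ^ 2 = 1) (hT : T ⊆ sector κ)
    (hA : Avoids Y₀ σ T) (ht : t ∈ T) :
    (fun p => sheetCoeff Y₀ φ σ p.1 p.2) =O[sheetFilter t] fun p => (height p.2)⁻¹ ^ 4 := by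
  simpa only [smul_eq_mul, ← pow_succ', sheetCoeff] using (isBigO_prefactor t σ 3).smul
    (hφ.isBigO_fueterKernel_mul_unitSheet_mul hσ (hT ht) (hA t ht))

lemma isBigO_sheetFlux (hφ : ConeRegular φ κ) (hσ : σ ^ 2 = 1) (hT : T ⊆ sector κ)
    (hA : Avoids Y₀ σ T) (ht : t ∈ T) (i : Fin 3) :
    (fun p => sheetFlux Y₀ φ σ p.1 i p.2) =O[sheetFilter t] fun p => (height p.2)⁻¹ ^ 3 := by
  have hKe : (fun p => fueterKernel (p.1 • unitSheet σ p.2 - Y₀) * e i.succ *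
      φ (p.1 • unitSheet σ p.2)) =O[sheetFilter t] fun p => (height p.2)⁻¹ ^ 2 := by
    have hK : (fun p => fueterKernel (p.1 • unitSheet σ p.2 - Y₀)) =O[sheetFilter t]
        fun p => (height p.2)⁻¹ := by
      simp only [fueterKernel_eq]
      refine (((isBigO_inv_of_isBigO_height (hA t ht)).pow 2).smul
        (isBigO_adj_sub σ t Y₀)).congr_right fun p => ?_
      have := height_pos p.2
      simp only [smul_eq_mul]
      field_simp
    simpa [sq] using isBigO_matrix_mul
      (isBigO_matrix_mul hK (isBigO_const_const (e i.succ) (one_ne_zero' ℝ) _))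
      (hφ.isBigO_comp_unitSheet hσ (hT ht))
  have hKY : (fun p => (p.2 i : ℂ) • (fueterKernel (p.1 • unitSheet σ p.2 - Y₀) *
      unitSheet σ p.2 * φ (p.1 • unitSheet σ p.2))) =O[sheetFilter t]
      fun p => (height p.2)⁻¹ ^ 2 := by
    refine ((isBigO_coord_height _ i).smul (hφ.isBigO_fueterKernel_mul_unitSheet_mul hσ (hT ht)
      (hA t ht))).congr_right fun p => ?_
    have := height_pos p.2
    simp only [smul_eq_mul]
    field_simp
  simpa only [smul_eq_mul, ← pow_succ', sheetFlux, dualTangent, mul_add, Matrix.add_mul,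
    mul_smul_comm, Matrix.smul_mul] using (isBigO_prefactor t σ 2).smul (hKe.add hKY)

end ConeRegular

end ConeRegular

-- The norm of a matrix induces its topology only after unfolding, so that instance search misses
-- the next two instances.
noncomputable instance (m : ℕ) : ContinuousENorm (Val m) :=
  @SeminormedAddGroup.toContinuousENorm (Val m) _

instance (m : ℕ) : TopologicalSpace.PseudoMetrizableSpace (Val m) :=
  @PseudoEMetricSpace.pseudoMetrizableSpace (Val m) _

namespace ConeRegular

variable {m : ℕ} {φ : HC → Val m} {κ : ℝ} {Y₀ : HC} {σ : ℝ} {T : Set ℂ} {t : ℂ}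

lemma continuous_sheetCoeff (hφ : ConeRegular φ κ) (hσ : σ ^ 2 = 1) (ht : t ∈ sector κ)
    (hN : ∀ y, (t • unitSheet σ y - Y₀).det ≠ 0) : Continuous (sheetCoeff Y₀ φ σ t) := by
  have hY := continuous_unitSheet σ
  have hφY : Continuous fun y => φ (t • unitSheet σ y) := continuous_iff_continuousAt.2 fun y =>
    ContinuousAt.comp (g := φ)
      (hφ.differentiableAt _ (smul_unitSheet_mem_cone ht hσ y)).continuousAt
      (hY.const_smul t).continuousAt
  have hK : Continuous fun y => fueterKernel (t • unitSheet σ y - Y₀) := by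
    have hsub : Continuous fun y => t • unitSheet σ y - Y₀ := (hY.const_smul t).sub continuous_const
    simp only [fueterKernel_eq]
    exact ((hsub.matrix_det.inv₀ hN).pow 2).smul (adj.continuous.comp hsub)
  exact (continuous_const.div (continuous_ofReal.comp continuous_height) height_ne_zero).smul
    ((hK.matrix_mul hY).matrix_mul hφY)

lemma hasDerivAt_sheetCoeff_eq_div (hφ : ConeRegular φ κ) (hσ : σ ^ 2 = 1) (hT : T ⊆ sector κ)
    (hA : Avoids Y₀ σ T) (ht : t ∈ T) (y : Fin 3 → ℝ) :
    HasDerivAt (fun t => sheetCoeff Y₀ φ σ t y)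
      (∑ i, fderiv ℝ (sheetFlux Y₀ φ σ t i) y (Pi.single i 1)) t :=
  have hmem := smul_unitSheet_mem_cone (hT ht) hσ y
  MinkowskiFueter.hasDerivAt_sheetCoeff_eq_div hσ (hA.det_ne_zero ht y)
    (hφ.differentiableAt _ hmem) (hφ.fueterOp_fderiv _ hmem)

lemma integrable_sheetCoeff (hφ : ConeRegular φ κ) (hσ : σ ^ 2 = 1) (hT : T ⊆ sector κ)
    (hA : Avoids Y₀ σ T) (ht : t ∈ T) : Integrable (sheetCoeff Y₀ φ σ t) := by
  obtain ⟨C, hC⟩ := exists_bound_of_isBigO (hφ.isBigO_sheetCoeff hσ hT hA ht)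
  exact (((integrable_inv_height_pow (by simp)).norm).const_mul C).mono'
    (hφ.continuous_sheetCoeff hσ (hT ht) (hA.det_ne_zero ht)).aestronglyMeasurable
    (.of_forall hC.self_of_nhds)

lemma hasDerivAt_integral_sheetCoeff (hφ : ConeRegular φ κ) (hσ : σ ^ 2 = 1) (hTo : IsOpen T)
    (hT : T ⊆ sector κ) (hA : Avoids Y₀ σ T) (ht : t ∈ T) :
    HasDerivAt (fun t => ∫ y, sheetCoeff Y₀ φ σ t y) 0 t := by
  have hdiv {t : ℂ} (ht : t ∈ T) := hφ.hasDerivAt_sheetCoeff_eq_div hσ hT hA ht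
  obtain ⟨C, hC⟩ := exists_bound_of_isBigO (hφ.isBigO_sheetCoeff hσ hT hA ht)
  obtain ⟨hint, hderiv⟩ := hasDerivAt_integral_of_differentiableOn hTo
    (fun t ht => (hφ.continuous_sheetCoeff hσ (hT ht) (hA.det_ne_zero ht)).aestronglyMeasurable)
    (fun y t ht => (hdiv ht y).differentiableAt.differentiableWithinAt) ht
    (((integrable_inv_height_pow (by simp)).norm).const_mul C) hC
  choose D hD using fun i => exists_bound_of_isBigO (hφ.isBigO_sheetFlux hσ hT hA ht i)
  have hflux (i : Fin 3) (y : Fin 3 → ℝ) :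
      ‖sheetFlux Y₀ φ σ t i y‖ ≤ (∑ j, |D j|) * (height y)⁻¹ ^ 3 := by
    have hpos : 0 ≤ (height y)⁻¹ ^ 3 := pow_nonneg (inv_nonneg.2 (height_pos y).le) 3
    refine ((hD i).self_of_nhds y).trans ?_
    rw [Real.norm_of_nonneg hpos]
    exact mul_le_mul_of_nonneg_right ((le_abs_self _).trans
      (Finset.single_le_sum (fun j _ => abs_nonneg (D j)) (Finset.mem_univ i))) hpos
  simp only [fun y => (hdiv ht y).deriv] at hint hderiv
  refine hderiv.congr_deriv (integral_divergence_eq_zero (fun i y => ?_)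
    (Finset.sum_nonneg fun j _ => abs_nonneg (D j)) hflux hint)
  exact differentiableAt_sheetFlux (hA.det_ne_zero ht y)
    (hφ.differentiableAt _ (smul_unitSheet_mem_cone (hT ht) hσ y)) i

lemma integral_sheetCoeff_eq (hφ : ConeRegular φ κ) (hσ : σ ^ 2 = 1) (hTo : IsOpen T)
    (hTc : IsPreconnected T) (hT : T ⊆ sector κ) (hA : Avoids Y₀ σ T) {t' : ℂ} (ht : t ∈ T)
    (ht' : t' ∈ T) : ∫ y, sheetCoeff Y₀ φ σ t y = ∫ y, sheetCoeff Y₀ φ σ t' y :=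
  hTo.is_const_of_deriv_eq_zero hTc
    (fun _ hs => (hφ.hasDerivAt_integral_sheetCoeff hσ hTo hT hA
      hs).differentiableAt.differentiableWithinAt)
    (fun _ hs => (hφ.hasDerivAt_integral_sheetCoeff hσ hTo hT hA hs).deriv) ht ht'

end ConeRegular

lemma integral_Ioi_sq_mul_inv_one_add_sq_sq :
    ∫ r in Ioi (0 : ℝ), r ^ 2 * (1 + r ^ 2)⁻¹ ^ 2 = Real.pi / 4 := by
  have hderiv (r : ℝ) : HasDerivAt (fun r : ℝ => (Real.arctan r - r * (1 + r ^ 2)⁻¹) / 2)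
      (r ^ 2 * (1 + r ^ 2)⁻¹ ^ 2) r := by
    have hne : 1 + r ^ 2 ≠ 0 := by positivity
    have hinv := ((hasDerivAt_pow 2 r).const_add 1).inv hne
    refine (((Real.hasDerivAt_arctan r).sub ((hasDerivAt_id r).mul hinv)).div_const 2).congr_deriv
      ?_
    simp only [id_eq, Nat.cast_ofNat, Nat.add_one_sub_one, pow_one, Pi.inv_apply]
    field_simp
    ring
  have hzero : Tendsto (fun r : ℝ => r * (1 + r ^ 2)⁻¹) atTop (𝓝 0) := by
    refine squeeze_zero' (g := fun r => r⁻¹) ?_ ?_ tendsto_inv_atTop_zero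
    · filter_upwards [eventually_gt_atTop 0] with r hr using by positivity
    · filter_upwards [eventually_gt_atTop 0] with r hr
      rw [← div_eq_mul_inv, div_le_iff₀ (by positivity)]
      field_simp
      linarith
  have hlim : Tendsto (fun r : ℝ => (Real.arctan r - r * (1 + r ^ 2)⁻¹) / 2) atTop
      (𝓝 ((Real.pi / 2 - 0) / 2)) :=
    ((tendsto_nhds_of_tendsto_nhdsWithin Real.tendsto_arctan_atTop).sub hzero).div_const 2
  rw [integral_Ioi_of_hasDerivAt_of_nonneg' (fun r _ => hderiv r) (fun r _ => by positivity) hlim,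
    Real.arctan_zero]
  ring

lemma integral_inv_height_pow_four : ∫ y : Fin 3 → ℝ, (height y)⁻¹ ^ 4 = Real.pi ^ 2 := by
  have hheight (x : EuclideanSpace ℝ (Fin 3)) :
      (height ((MeasurableEquiv.toLp 2 (Fin 3 → ℝ)).symm x))⁻¹ ^ 4 = (1 + ‖x‖ ^ 2)⁻¹ ^ 2 := by
    have hsq : height ((MeasurableEquiv.toLp 2 (Fin 3 → ℝ)).symm x) ^ 2 = 1 + ‖x‖ ^ 2 := by
      rw [height_sq, EuclideanSpace.real_norm_sq_eq, dotProduct]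
      simp only [sq]
      rfl
    rw [← hsq, ← inv_pow, ← pow_mul]
  rw [← (EuclideanSpace.volume_preserving_symm_measurableEquiv_toLp (Fin 3)).integral_comp'
    (fun y : Fin 3 → ℝ => (height y)⁻¹ ^ 4)]
  simp only [hheight]
  rw [integral_fun_norm_addHaar volume fun r : ℝ => (1 + r ^ 2)⁻¹ ^ 2, finrank_euclideanSpace_fin,
    Measure.real, EuclideanSpace.volume_ball_fin_three]
  simp only [smul_eq_mul, nsmul_eq_mul, Nat.add_one_sub_one,
    integral_Ioi_sq_mul_inv_one_add_sq_sq]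
  rw [ENNReal.ofReal_one, one_pow, one_mul, ENNReal.toReal_ofReal (by positivity)]
  push_cast
  ring

section Hessian

variable {ι : Type*} [Fintype ι]

/-- The Hessian at `y'` of `y ↦ pairing 1 y y'`, as a quadratic form. -/
noncomputable def hessian (y' x : ι → ℝ) : ℝ := x ⬝ᵥ x - ((y' ⬝ᵥ x) / height y') ^ 2

lemma hessian_nonneg (y' x : ι → ℝ) : 0 ≤ hessian y' x := by
  have hx := dotProduct_self_nonneg x
  have hcs : (y' ⬝ᵥ x) ^ 2 ≤ (y' ⬝ᵥ y') * (x ⬝ᵥ x) := by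
    simpa only [dotProduct, ← sq] using Finset.sum_mul_sq_le_sq_mul_sq Finset.univ y' x
  have hle : ((y' ⬝ᵥ x) / height y') ^ 2 ≤ x ⬝ᵥ x := by
    rw [div_pow, div_le_iff₀ (pow_pos (height_pos y') 2), height_sq]
    linarith
  exact sub_nonneg.2 hle

/-- The square root of the matrix of the quadratic form `hessian y'`. -/
noncomputable def hessianSqrt [DecidableEq ι] (y' : ι → ℝ) : Matrix ι ι ℝ :=
  1 - (height y' * (height y' + 1))⁻¹ • Matrix.vecMulVec y' y'

lemma det_hessianSqrt [DecidableEq ι] (y' : ι → ℝ) : (hessianSqrt y').det = (height y')⁻¹ := by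
  have hpos := height_pos y'
  have hmul : (height y' * (height y' + 1))⁻¹ • Matrix.vecMulVec y' y' =
      Matrix.replicateCol Unit ((height y' * (height y' + 1))⁻¹ • y') *
        Matrix.replicateRow Unit y' := by
    rw [← Matrix.smul_vecMulVec, Matrix.vecMulVec_eq Unit]
  rw [hessianSqrt, hmul, Matrix.det_one_sub_mul_comm, Matrix.det_unique]
  simp only [Matrix.sub_apply, Matrix.one_apply_eq, Matrix.replicateRow_mul_replicateCol_apply,
    dotProduct_smul, smul_eq_mul]
  rw [show y' ⬝ᵥ y' = height y' ^ 2 - 1 by rw [height_sq]; ring]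
  field_simp
  ring

lemma dotProduct_self_hessianSqrt_mulVec [DecidableEq ι] (y' x : ι → ℝ) :
    (hessianSqrt y').mulVec x ⬝ᵥ (hessianSqrt y').mulVec x = hessian y' x := by
  have hpos := height_pos y'
  have hmulVec : (hessianSqrt y').mulVec x =
      x - ((height y' * (height y' + 1))⁻¹ * (y' ⬝ᵥ x)) • y' := by
    rw [hessianSqrt, Matrix.sub_mulVec, Matrix.one_mulVec, Matrix.smul_mulVec,
      Matrix.vecMulVec_mulVec, op_smul_eq_smul, smul_smul]
  rw [hmulVec, hessian]
  simp only [sub_dotProduct, dotProduct_sub, smul_dotProduct, dotProduct_smul, smul_eq_mul,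
    dotProduct_comm x y']
  rw [show y' ⬝ᵥ y' = height y' ^ 2 - 1 by rw [height_sq]; ring]
  field_simp
  ring

lemma integral_comp_hessian {E : Type*} [NormedAddCommGroup E] [NormedSpace ℝ E] (y' : ι → ℝ)
    (g : ℝ → E) : ∫ x, g (hessian y' x) = height y' • ∫ x : ι → ℝ, g (x ⬝ᵥ x) := by
  classical
  have hdet : LinearMap.det (hessianSqrt y').toLin' = (height y')⁻¹ := by
    rw [LinearMap.det_toLin', det_hessianSqrt]
  have hne : LinearMap.det (hessianSqrt y').toLin' ≠ 0 :=
    hdet ▸ inv_ne_zero (height_pos y').ne'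
  let A := ((hessianSqrt y').toLin'.equivOfDetNeZero hne).toContinuousLinearEquiv
    |>.toHomeomorph.toMeasurableEquiv
  have hA (x : ι → ℝ) : A x = (hessianSqrt y').mulVec x := rfl
  have hmap : Measure.map A volume = ENNReal.ofReal (height y') • (volume : Measure (ι → ℝ)) := by
    have := Measure.map_linearMap_addHaar_eq_smul_addHaar volume hne
    rwa [hdet, inv_inv, abs_of_pos (height_pos y')] at this
  simp only [← dotProduct_self_hessianSqrt_mulVec y', ← hA]
  rw [← integral_map_equiv A fun z => g (z ⬝ᵥ z), hmap, integral_smul_measure,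
    ENNReal.toReal_ofReal (height_pos y').le]

end Hessian

lemma integral_four_div_hessian_add_four_sq (y' : Fin 3 → ℝ) :
    ∫ x, 4 / (hessian y' x + 4) ^ 2 = 2 * Real.pi ^ 2 * height y' := by
  have hscale (z : Fin 3 → ℝ) :
      4 / (((2 : ℝ) • z) ⬝ᵥ ((2 : ℝ) • z) + 4) ^ 2 = 4⁻¹ * (height z)⁻¹ ^ 4 := by
    have hpos := height_pos z
    rw [show ((2 : ℝ) • z) ⬝ᵥ ((2 : ℝ) • z) + 4 = 4 * height z ^ 2 by
      rw [height_sq, smul_dotProduct, dotProduct_smul, smul_eq_mul, smul_eq_mul]; ring]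
    field_simp
  have hint := Measure.integral_comp_smul volume (fun z : Fin 3 → ℝ => 4 / (z ⬝ᵥ z + 4) ^ 2) 2
  simp only [hscale] at hint
  rw [integral_const_mul, integral_inv_height_pow_four, Module.finrank_pi, Fintype.card_fin,
    abs_of_pos (by positivity), smul_eq_mul] at hint
  rw [integral_comp_hessian y' fun q => 4 / (q + 4) ^ 2, smul_eq_mul]
  linear_combination -8 * height y' * hint

section PairingOne

variable {ι : Type*} [Fintype ι]

lemma one_le_pairing_one (y y' : ι → ℝ) : 1 ≤ pairing 1 y y' := by
  rw [pairing]
  linarith [one_add_abs_dotProduct_le y y', le_abs_self (y ⬝ᵥ y')]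

lemma two_mul_pairing_one_sub_one (y y' : ι → ℝ) :
    2 * (pairing 1 y y' - 1) = (y - y') ⬝ᵥ (y - y') - (height y - height y') ^ 2 := by
  rw [pairing]
  simp only [sub_dotProduct, dotProduct_sub, dotProduct_comm y' y]
  linear_combination height_sq y + height_sq y'

lemma dotProduct_sub_mul_one_add_pairing_le (y y' : ι → ℝ) :
    ((y - y') ⬝ᵥ (y - y')) * (1 + pairing 1 y y') ≤
      (pairing 1 y y' - 1) * (height y + height y') ^ 2 := by
  have hcs : ((y - y') ⬝ᵥ (y + y')) ^ 2 ≤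
      ((y - y') ⬝ᵥ (y - y')) * ((y + y') ⬝ᵥ (y + y')) := by
    simpa only [dotProduct, ← sq] using Finset.sum_mul_sq_le_sq_mul_sq Finset.univ (y - y') (y + y')
  have hdiff : (y - y') ⬝ᵥ (y + y') = height y ^ 2 - height y' ^ 2 := by
    simp only [sub_dotProduct, dotProduct_add, dotProduct_comm y' y, height_sq]
    ring
  have hsum : (y + y') ⬝ᵥ (y + y') = (height y + height y') ^ 2 - 2 - 2 * pairing 1 y y' := by
    simp only [pairing, add_dotProduct, dotProduct_add, dotProduct_comm y' y]
    linear_combination -height_sq y - height_sq y'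
  have hdouble : 2 * ((pairing 1 y y' - 1) * (height y + height y') ^ 2) =
      ((y - y') ⬝ᵥ (y - y')) * (height y + height y') ^ 2 - (height y ^ 2 - height y' ^ 2) ^ 2 := by
    linear_combination (height y + height y') ^ 2 * two_mul_pairing_one_sub_one y y'
  rw [hdiff, hsum] at hcs
  linarith

lemma mul_dotProduct_sub_div_height_le (y y' : ι → ℝ) :
    gap y' / (1 + height y') ^ 2 * ((y - y') ⬝ᵥ (y - y')) / height y ≤ pairing 1 y y' - 1 := by
  have hheight := one_le_height y
  have hheight' := one_le_height y'
  have hpairing := one_le_pairing_one y y'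
  have hgap := gap_mul_height_le_abs_pairing (one_pow 2) y y'
  rw [abs_of_pos (by linarith)] at hgap
  have hdot := dotProduct_self_nonneg (y - y')
  rw [div_mul_eq_mul_div, div_div, div_le_iff₀ (by positivity)]
  refine le_of_mul_le_mul_right ?_ (by linarith : 0 < height y)
  calc gap y' * ((y - y') ⬝ᵥ (y - y')) * height y
      = ((y - y') ⬝ᵥ (y - y')) * (gap y' * height y) := by ring
    _ ≤ ((y - y') ⬝ᵥ (y - y')) * (1 + pairing 1 y y') := by gcongr; linarith
    _ ≤ (pairing 1 y y' - 1) * (height y + height y') ^ 2 :=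
        dotProduct_sub_mul_one_add_pairing_le y y'
    _ ≤ (pairing 1 y y' - 1) * (height y * (1 + height y')) ^ 2 := by
        gcongr
        nlinarith
    _ = (pairing 1 y y' - 1) * ((1 + height y') ^ 2 * height y) * height y := by ring

end PairingOne

/-- The Cayley parametrization of the circle of radius `ρ`, which crosses the positive real axis
at `η = 0`. -/
noncomputable def arc (ρ η : ℝ) : ℂ := ρ * ((1 + I * η) / (1 - I * η))

lemma one_add_I_mul_ne_zero (η : ℝ) : (1 + I * η : ℂ) ≠ 0 := fun h => by
  simpa using congrArg re h

lemma one_sub_I_mul_ne_zero (η : ℝ) : (1 - I * η : ℂ) ≠ 0 := fun h => by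
  simpa using congrArg re h

lemma one_add_sq_eq_mul (η : ℝ) : (1 + η ^ 2 : ℂ) = (1 + I * η) * (1 - I * η) := by
  linear_combination (η : ℂ) ^ 2 * I_sq

lemma arc_zero (ρ : ℝ) : arc ρ 0 = ρ := by simp [arc]

lemma arc_im (ρ η : ℝ) : (arc ρ η).im = 2 * ρ * η / (1 + η ^ 2) := by
  have harc : arc ρ η =
      (ρ * (1 - η ^ 2) / (1 + η ^ 2) : ℝ) + (2 * ρ * η / (1 + η ^ 2) : ℝ) * I := by
    have hadd := one_add_I_mul_ne_zero η
    have hsub := one_sub_I_mul_ne_zero η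
    push_cast
    rw [arc, one_add_sq_eq_mul]
    field_simp
    linear_combination (ρ * η ^ 2 : ℂ) * I_sq
  rw [harc, add_im, ofReal_im, zero_add, im_ofReal_mul, I_im, mul_one]

lemma arc_ne_zero {ρ : ℝ} (hρ : ρ ≠ 0) (η : ℝ) : arc ρ η ≠ 0 :=
  mul_ne_zero (ofReal_ne_zero.2 hρ)
    (div_ne_zero (one_add_I_mul_ne_zero η) (one_sub_I_mul_ne_zero η))

lemma hasDerivAt_arc (ρ η : ℝ) : HasDerivAt (arc ρ) (2 * I * ρ / (1 - I * η) ^ 2) η := by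
  have hI : HasDerivAt (fun η : ℝ => I * (η : ℂ)) I η := by
    simpa using (ofRealCLM.hasDerivAt (x := η)).const_mul I
  refine (((hI.const_add 1).div (hI.const_sub 1) (one_sub_I_mul_ne_zero η)).const_mul
    (ρ : ℂ)).congr_deriv ?_
  ring

lemma continuous_arc (ρ : ℝ) : Continuous (arc ρ) :=
  continuous_iff_continuousAt.2 fun η => (hasDerivAt_arc ρ η).continuousAt

lemma norm_arc_sub_arc_neg_le {ρ η : ℝ} (hρ : 0 ≤ ρ) (hη : 0 ≤ η) :
    ‖arc ρ η - arc ρ (-η)‖ ≤ 4 * ρ * η := by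
  have hsub : arc ρ η - arc ρ (-η) = (4 * ρ * η / (1 + η ^ 2) : ℝ) * I := by
    have hadd := one_add_I_mul_ne_zero η
    have hsub := one_sub_I_mul_ne_zero η
    simp only [arc, ofReal_neg, mul_neg, sub_neg_eq_add, ← sub_eq_add_neg]
    push_cast
    rw [one_add_sq_eq_mul]
    field_simp
    ring
  rw [hsub, norm_mul, norm_I, mul_one, norm_real, Real.norm_of_nonneg (by positivity)]
  exact div_le_self (by positivity) (by nlinarith)

/-- The real factor of `N(t Y - Y₀)` for `t = arc ρ η`, where `Y` and `Y₀ / ρ` are the points of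
one unit sheet over `y` and `y'`. -/
noncomputable def arcFactor (y' : Fin 3 → ℝ) (η : ℝ) (y : Fin 3 → ℝ) : ℝ :=
  pairing 1 y y' - 1 + 2 * η ^ 2 / (1 + η ^ 2)

lemma arcFactor_neg (y' : Fin 3 → ℝ) (η : ℝ) (y : Fin 3 → ℝ) :
    arcFactor y' (-η) y = arcFactor y' η y := by
  rw [arcFactor, arcFactor, neg_sq]

lemma arcFactor_pos (y' : Fin 3 → ℝ) {η : ℝ} (hη : η ≠ 0) (y : Fin 3 → ℝ) :
    0 < arcFactor y' η y :=
  add_pos_of_nonneg_of_pos (sub_nonneg.2 (one_le_pairing_one y y')) (by positivity)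

lemma det_arc_smul_unitSheet_sub {σ : ℝ} (hσ : σ ^ 2 = 1) (ρ η : ℝ) (y y' : Fin 3 → ℝ) :
    (arc ρ η • unitSheet σ y - (ρ : ℂ) • unitSheet σ y').det =
      2 * ρ * arc ρ η * arcFactor y' η y := by
  have hadd := one_add_I_mul_ne_zero η
  have hsub := one_sub_I_mul_ne_zero η
  rw [det_smul_unitSheet_sub hσ hσ, ← sq, hσ, arcFactor, arc]
  push_cast
  rw [one_add_sq_eq_mul]
  field_simp
  linear_combination -(4 * ρ ^ 2 * η ^ 2 : ℂ) * I_sq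

lemma det_arc_smul_unitSheet_sub_ne_zero {σ : ℝ} (hσ : σ ^ 2 = 1) {ρ η : ℝ} (hρ : ρ ≠ 0)
    (hη : η ≠ 0) (y y' : Fin 3 → ℝ) :
    (arc ρ η • unitSheet σ y - (ρ : ℂ) • unitSheet σ y').det ≠ 0 := by
  rw [det_arc_smul_unitSheet_sub hσ]
  exact mul_ne_zero (mul_ne_zero (mul_ne_zero two_ne_zero (ofReal_ne_zero.2 hρ))
    (arc_ne_zero hρ η)) (ofReal_ne_zero.2 (arcFactor_pos y' hη y).ne')

lemma tendsto_arcFactor_div_sq (y' x : Fin 3 → ℝ) :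
    Tendsto (fun η : ℝ => arcFactor y' η (y' + η • x) / η ^ 2) (𝓝[≠] 0)
      (𝓝 ((hessian y' x + 4) / 2)) := by
  have hline : fderiv ℝ height y' x = (y' ⬝ᵥ x) / height y' := by
    rw [(hasFDerivAt_height y').fderiv, dotProduct]
    simp [div_eq_inv_mul]
  have hslope : Tendsto (fun η : ℝ => η⁻¹ * (height (y' + η • x) - height y')) (𝓝[≠] 0)
      (𝓝 ((y' ⬝ᵥ x) / height y')) := by
    simpa [hline] using hasDerivAt_iff_tendsto_slope_zero.1
      ((hasFDerivAt_height y').differentiableAt.hasFDerivAt.hasLineDerivAt x)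
  have htwo : Tendsto (fun η : ℝ => 2 / (1 + η ^ 2)) (𝓝[≠] 0) (𝓝 2) := by
    have hcont : Continuous fun η : ℝ => 2 / (1 + η ^ 2) :=
      continuous_const.div (by fun_prop) fun η => by positivity
    exact (hcont.tendsto' 0 2 (by simp)).mono_left nhdsWithin_le_nhds
  have hlim := (((hslope.pow 2).const_sub (x ⬝ᵥ x)).div_const 2).add htwo
  rw [← hessian, show hessian y' x / 2 + 2 = (hessian y' x + 4) / 2 by ring] at hlim
  refine hlim.congr' ?_
  filter_upwards [self_mem_nhdsWithin] with η (hη : η ≠ 0)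
  have hpairing := two_mul_pairing_one_sub_one (y' + η • x) y'
  rw [add_sub_cancel_left, smul_dotProduct, dotProduct_smul, smul_eq_mul, smul_eq_mul] at hpairing
  have hne : 1 + η ^ 2 ≠ 0 := by positivity
  rw [arcFactor, eq_div_of_mul_eq two_ne_zero ((mul_comm _ _).trans hpairing)]
  field_simp

lemma exists_norm_sub_le_of_eventually_norm_le {E α : Type*} [NormedAddCommGroup E]
    [NormedSpace ℂ E] {F : ℂ → α → E} {b : α → ℝ} {t₀ : ℂ}
    (hd : ∀ᶠ t in 𝓝 t₀, ∀ a, DifferentiableAt ℂ (fun t => F t a) t)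
    (hb : ∀ᶠ t in 𝓝 t₀, ∀ a, ‖F t a‖ ≤ b a) :
    ∃ C, 0 < C ∧ ∀ᶠ p in 𝓝 t₀ ×ˢ 𝓝 t₀, ∀ a, ‖F p.1 a - F p.2 a‖ ≤ C * ‖p.1 - p.2‖ * b a := by
  obtain ⟨r, hr, hball⟩ := Metric.eventually_nhds_iff_ball.1 (hd.and hb)
  refine ⟨4 / r, by positivity, ?_⟩
  have hnear := Metric.ball_mem_nhds t₀ (half_pos hr)
  filter_upwards [prod_mem_prod hnear hnear] with p ⟨hp, hp'⟩ a
  have hsub : Metric.ball t₀ (r / 2) ⊆ Metric.ball t₀ r := Metric.ball_subset_ball (by linarith)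
  refine ((convex_ball t₀ (r / 2)).norm_image_sub_le_of_norm_deriv_le (f := fun t => F t a)
    (fun t ht => (hball t (hsub ht)).1 a) (fun t ht => norm_deriv_le_of_mem_ball_half
      (fun z hz => ((hball z hz).1 a).differentiableWithinAt) (fun z hz => (hball z hz).2 a) ht)
    hp' hp).trans_eq ?_
  field_simp

/-- The numerator of `sheetCoeff`: what remains after the factor `N(t Y - Y₀)⁻²` of the Fueter
kernel is split off and one factor `t` is kept. -/
noncomputable def sheetNumerator {m : ℕ} (Y₀ : HC) (φ : HC → Val m) (σ : ℝ) (t : ℂ)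
    (y : Fin 3 → ℝ) : Val m :=
  t • (adj (t • unitSheet σ y - Y₀) * unitSheet σ y * φ (t • unitSheet σ y))

section Jump

variable {m : ℕ} {φ : HC → Val m} {κ σ ρ : ℝ}

lemma sheetCoeff_arc (φ : HC → Val m) (hσ : σ ^ 2 = 1) (hρ : ρ ≠ 0) (η : ℝ) (y y' : Fin 3 → ℝ) :
    sheetCoeff ((ρ : ℂ) • unitSheet σ y') φ σ (arc ρ η) y =
      (I * σ / (4 * ρ ^ 2 * height y * arcFactor y' η y ^ 2)) •
        sheetNumerator ((ρ : ℂ) • unitSheet σ y') φ σ (arc ρ η) y := by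
  have harc := arc_ne_zero hρ η
  rw [sheetCoeff, fueterKernel_eq, sheetNumerator, det_arc_smul_unitSheet_sub hσ, smul_mul_assoc,
    Matrix.smul_mul, smul_smul, smul_smul]
  congr 1
  rw [inv_pow, mul_pow, mul_pow, mul_pow]
  field_simp
  norm_num

namespace ConeRegular

lemma differentiableAt_sheetNumerator (hφ : ConeRegular φ κ) (Y₀ : HC) {t : ℂ}
    (ht : t ∈ sector κ) (hσ : σ ^ 2 = 1) (y : Fin 3 → ℝ) :
    DifferentiableAt ℂ (fun t => sheetNumerator Y₀ φ σ t y) t := by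
  have hY : DifferentiableAt ℂ (fun t : ℂ => t • unitSheet σ y) t :=
    differentiableAt_id.smul_const _
  have hφY : DifferentiableAt ℂ (fun t : ℂ => φ (t • unitSheet σ y)) t :=
    DifferentiableAt.comp (g := φ) t
      (hφ.differentiableAt _ (smul_unitSheet_mem_cone ht hσ y)) hY
  have hadj : DifferentiableAt ℂ (fun t : ℂ => adj (t • unitSheet σ y - Y₀)) t :=
    DifferentiableAt.comp (g := adj) t adj.differentiableAt (hY.sub_const Y₀)
  exact differentiableAt_id.fun_smul (differentiableAt_matrix_mul (hadj.mul_const _) hφY)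

lemma isBigO_sheetNumerator (hφ : ConeRegular φ κ) (Y₀ : HC) {t : ℂ} (ht : t ∈ sector κ)
    (hσ : σ ^ 2 = 1) :
    (fun p => sheetNumerator Y₀ φ σ p.1 p.2) =O[sheetFilter t] fun p => (height p.2)⁻¹ := by
  simpa [sheetNumerator] using
    (isBigO_fst t).smul (hφ.isBigO_mul hσ ht (isBigO_adj_sub_mul_unitSheet_mul_adj hσ t Y₀))

lemma exists_norm_sheetNumerator_arc_sub_le (hφ : ConeRegular φ κ) (Y₀ : HC) (hσ : σ ^ 2 = 1)
    (hρ : (ρ : ℂ) ∈ sector κ) :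
    ∃ C, 0 < C ∧ ∀ᶠ η in 𝓝[>] (0 : ℝ), ∀ y,
      ‖sheetNumerator Y₀ φ σ (arc ρ η) y - sheetNumerator Y₀ φ σ (arc ρ (-η)) y‖ ≤
        C * η * (height y)⁻¹ := by
  have hρ0 : 0 < ρ := by simpa using hρ.1
  obtain ⟨M, hM⟩ := exists_bound_of_isBigO (hφ.isBigO_sheetNumerator Y₀ hρ hσ)
  have hM' : ∀ᶠ t in 𝓝 (ρ : ℂ), ∀ y, ‖sheetNumerator Y₀ φ σ t y‖ ≤ max M 1 * (height y)⁻¹ := by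
    filter_upwards [hM] with t ht y
    have hpos := inv_pos.2 (height_pos y)
    exact (ht y).trans (by rw [Real.norm_of_nonneg hpos.le]; gcongr; exact le_max_left _ _)
  have hd : ∀ᶠ t in 𝓝 (ρ : ℂ), ∀ y, DifferentiableAt ℂ (fun t => sheetNumerator Y₀ φ σ t y) t := by
    filter_upwards [(isOpen_sector κ).mem_nhds hρ] with t ht y
    exact hφ.differentiableAt_sheetNumerator Y₀ ht hσ y
  obtain ⟨C, hC0, hC⟩ := exists_norm_sub_le_of_eventually_norm_le hd hM'
  have harc : Tendsto (fun η => (arc ρ η, arc ρ (-η))) (𝓝[>] 0) (𝓝 (ρ : ℂ) ×ˢ 𝓝 (ρ : ℂ)) := by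
    have hcont := continuous_arc ρ
    exact ((hcont.tendsto' 0 ρ (arc_zero ρ)).prodMk ((hcont.comp continuous_neg).tendsto' 0 ρ
      (by simp [arc_zero]))).mono_left nhdsWithin_le_nhds
  refine ⟨C * (4 * ρ) * max M 1, by positivity, ?_⟩
  filter_upwards [harc.eventually hC, self_mem_nhdsWithin] with η hη (hη0 : 0 < η) y
  have hpos := height_pos y
  calc _ ≤ C * ‖arc ρ η - arc ρ (-η)‖ * (max M 1 * (height y)⁻¹) := hη y
    _ ≤ C * (4 * ρ * η) * (max M 1 * (height y)⁻¹) := by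
        gcongr
        exact norm_arc_sub_arc_neg_le hρ0.le hη0.le
    _ = C * (4 * ρ) * max M 1 * η * (height y)⁻¹ := by ring

lemma hasDerivAt_sheetNumerator_line (hφ : ConeRegular φ κ) (hσ : σ ^ 2 = 1)
    (hρ : (ρ : ℂ) ∈ sector κ) (y' x : Fin 3 → ℝ) {p : ℝ → ℂ} {p' : ℂ} (hp₀ : p 0 = ρ)
    (hp : HasDerivAt p p' 0) :
    HasDerivAt (fun η => sheetNumerator ((ρ : ℂ) • unitSheet σ y') φ σ (p η) (y' + η • x))
      (-(ρ * p') • φ ((ρ : ℂ) • unitSheet σ y') + (ρ * ρ : ℂ) •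
        (adj (fderiv ℝ (unitSheet σ) y' x) * unitSheet σ y' * φ ((ρ : ℂ) • unitSheet σ y'))) 0 := by
  have hy₀ : y' + (0 : ℝ) • x = y' := by rw [zero_smul, add_zero]
  have hY : HasDerivAt (fun η : ℝ => unitSheet σ (y' + η • x)) (fderiv ℝ (unitSheet σ) y' x) 0 :=
    (differentiable_unitSheet σ y').hasFDerivAt.hasLineDerivAt x
  set Y' := fderiv ℝ (unitSheet σ) y' x
  have hZ : HasDerivAt (fun η => p η • unitSheet σ (y' + η • x))
      ((ρ : ℂ) • Y' + p' • unitSheet σ y') 0 := by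
    have := hp.fun_smul hY
    rwa [hy₀, hp₀] at this
  obtain ⟨B, hB⟩ := hφ.differentiableAt _ (smul_unitSheet_mem_cone hρ hσ y')
  have hφZ : HasDerivAt (fun η => φ (p η • unitSheet σ (y' + η • x)))
      (B ((ρ : ℂ) • Y' + p' • unitSheet σ y')) 0 :=
    HasFDerivAt.comp_hasDerivAt (l' := B.restrictScalars ℝ) (l := φ)
      (f := fun η => p η • unitSheet σ (y' + η • x)) (0 : ℝ)
      (by rw [hy₀, hp₀]; exact hB.restrictScalars ℝ) hZ
  have hadj : HasDerivAt
      (fun η => adj (p η • unitSheet σ (y' + η • x) - (ρ : ℂ) • unitSheet σ y'))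
      (adj ((ρ : ℂ) • Y' + p' • unitSheet σ y')) 0 :=
    HasFDerivAt.comp_hasDerivAt (l' := adj.restrictScalars ℝ) (l := adj)
      (f := fun η => p η • unitSheet σ (y' + η • x) - (ρ : ℂ) • unitSheet σ y') (0 : ℝ)
      (adj.hasFDerivAt.restrictScalars ℝ) (hZ.sub_const _)
  have hprod := hp.fun_smul (hasDerivAt_matrix_mul (hadj.fun_mul hY) hφZ)
  simp only [hy₀, hp₀, sub_self, map_zero, zero_mul, Matrix.zero_mul, add_zero, smul_zero] at hprod
  refine hprod.congr_deriv ?_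
  have hadj_mul := adj_mul_self (unitSheet σ y')
  rw [det_unitSheet hσ] at hadj_mul
  rw [map_add, map_smul, map_smul, add_mul, smul_mul_assoc, smul_mul_assoc, hadj_mul]
  simp only [Matrix.add_mul, Matrix.smul_mul, Matrix.one_mul]
  module

lemma tendsto_inv_smul_sheetNumerator_arc_sub (hφ : ConeRegular φ κ) (hσ : σ ^ 2 = 1)
    (hρ : (ρ : ℂ) ∈ sector κ) (y' x : Fin 3 → ℝ) :
    Tendsto (fun η : ℝ => η⁻¹ •
      (sheetNumerator ((ρ : ℂ) • unitSheet σ y') φ σ (arc ρ η) (y' + η • x) -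
        sheetNumerator ((ρ : ℂ) • unitSheet σ y') φ σ (arc ρ (-η)) (y' + η • x))) (𝓝[≠] 0)
      (𝓝 (-(4 * I * ρ ^ 2) • φ ((ρ : ℂ) • unitSheet σ y'))) := by
  have harc : HasDerivAt (arc ρ) (2 * I * ρ) 0 := by simpa using hasDerivAt_arc ρ 0
  have harc_neg : HasDerivAt (fun η => arc ρ (-η)) (-(2 * I * ρ)) 0 := by
    have hcomp := HasDerivAt.scomp (0 : ℝ) (by simpa using harc) (hasDerivAt_neg (0 : ℝ))
    rwa [neg_one_smul] at hcomp
  have hslope := hasDerivAt_iff_tendsto_slope_zero.1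
    ((hφ.hasDerivAt_sheetNumerator_line hσ hρ y' x (arc_zero ρ) harc).fun_sub
      (hφ.hasDerivAt_sheetNumerator_line hσ hρ y' x (p := fun η => arc ρ (-η))
        (by simp [arc_zero]) harc_neg))
  rw [add_sub_add_right_eq_sub, ← sub_smul] at hslope
  refine (hslope.congr fun η => ?_).trans_eq ?_
  · simp [arc_zero]
  · congr 2
    ring

end ConeRegular

end Jump

lemma mul_height_sq_div_le_arcFactor_div_sq (y' x : Fin 3 → ℝ) {η : ℝ} (hη : 0 < η)
    (hη₁ : η ≤ 1) :
    gap y' / (1 + height y') ^ 2 * height x ^ 2 / height (y' + η • x) ≤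
      arcFactor y' η (y' + η • x) / η ^ 2 := by
  set k := gap y' / (1 + height y') ^ 2
  have hk₁ : k ≤ 1 := by
    have hheight' := height_pos y'
    have hgap : gap y' ≤ height y' := sub_le_self _ (Real.sqrt_nonneg _)
    refine div_le_one_of_le₀ ?_ (by positivity)
    nlinarith
  have hpairing := mul_dotProduct_sub_div_height_le (y' + η • x) y'
  rw [add_sub_cancel_left, smul_dotProduct, dotProduct_smul, smul_eq_mul, smul_eq_mul] at hpairing
  have hheight := one_le_height (y' + η • x)
  set s := height (y' + η • x)
  have hη₂ : η ^ 2 ≤ 2 * η ^ 2 / (1 + η ^ 2) := by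
    rw [le_div_iff₀ (by positivity)]
    nlinarith [pow_le_one₀ (n := 2) hη.le hη₁, sq_nonneg η]
  rw [le_div_iff₀ (by positivity), arcFactor]
  calc k * height x ^ 2 / s * η ^ 2 = k * (η * (η * (x ⬝ᵥ x))) / s + k / s * η ^ 2 := by
        rw [height_sq]
        ring
    _ ≤ k * (η * (η * (x ⬝ᵥ x))) / s + 1 * η ^ 2 := by
        gcongr
        exact div_le_one_of_le₀ (hk₁.trans hheight) (by linarith)
    _ ≤ pairing 1 (y' + η • x) y' - 1 + 2 * η ^ 2 / (1 + η ^ 2) := by linarith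

/-- The difference of the integrands `sheetCoeff` at two points of the circle of radius `ρ` that
approach `ρ` from above and below, with `y` blown up around the singular point `y'`. -/
noncomputable def rescaledJump {m : ℕ} (φ : HC → Val m) (σ ρ : ℝ) (y' : Fin 3 → ℝ) (η : ℝ)
    (x : Fin 3 → ℝ) : Val m :=
  η ^ 3 • (sheetCoeff ((ρ : ℂ) • unitSheet σ y') φ σ (arc ρ η) (y' + η • x) -
    sheetCoeff ((ρ : ℂ) • unitSheet σ y') φ σ (arc ρ (-η)) (y' + η • x))

section RescaledJump

variable {m : ℕ} {φ : HC → Val m} {κ σ ρ : ℝ}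

lemma integral_rescaledJump (φ : HC → Val m) (σ ρ : ℝ) (y' : Fin 3 → ℝ) {η : ℝ} (hη : 0 < η) :
    ∫ x, rescaledJump φ σ ρ y' η x =
      ∫ y, (sheetCoeff ((ρ : ℂ) • unitSheet σ y') φ σ (arc ρ η) y -
        sheetCoeff ((ρ : ℂ) • unitSheet σ y') φ σ (arc ρ (-η)) y) := by
  set f : (Fin 3 → ℝ) → Val m := fun y =>
    sheetCoeff ((ρ : ℂ) • unitSheet σ y') φ σ (arc ρ η) y -
      sheetCoeff ((ρ : ℂ) • unitSheet σ y') φ σ (arc ρ (-η)) y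
  have hscale := Measure.integral_comp_smul volume (fun z => f (y' + z)) η
  rw [integral_add_left_eq_self f y', Module.finrank_pi, Fintype.card_fin,
    abs_of_pos (by positivity)] at hscale
  calc ∫ x, rescaledJump φ σ ρ y' η x = η ^ 3 • ∫ x, f (y' + η • x) := integral_smul _ _
    _ = ∫ y, f y := by rw [hscale, smul_inv_smul₀ (by positivity)]

lemma rescaledJump_eq (φ : HC → Val m) (hσ : σ ^ 2 = 1) (hρ : ρ ≠ 0) (y' : Fin 3 → ℝ) {η : ℝ}
    (hη : η ≠ 0) (x : Fin 3 → ℝ) :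
    rescaledJump φ σ ρ y' η x =
      (I * σ / (4 * ρ ^ 2 * height (y' + η • x) *
        ((arcFactor y' η (y' + η • x) / η ^ 2 : ℝ) : ℂ) ^ 2)) •
      (η⁻¹ • (sheetNumerator ((ρ : ℂ) • unitSheet σ y') φ σ (arc ρ η) (y' + η • x) -
        sheetNumerator ((ρ : ℂ) • unitSheet σ y') φ σ (arc ρ (-η)) (y' + η • x))) := by
  have hη' : (η : ℂ) ≠ 0 := ofReal_ne_zero.2 hη
  have hfactor : (arcFactor y' η (y' + η • x) : ℂ) ≠ 0 :=
    ofReal_ne_zero.2 (arcFactor_pos y' hη _).ne'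
  have hheight := height_ne_zero (y' + η • x)
  rw [rescaledJump, sheetCoeff_arc φ hσ hρ, sheetCoeff_arc φ hσ hρ, arcFactor_neg, ← smul_sub,
    ← Complex.coe_smul, ← Complex.coe_smul, smul_smul, smul_smul]
  congr 1
  push_cast
  field_simp

namespace ConeRegular

lemma exists_norm_rescaledJump_le (hφ : ConeRegular φ κ) (hσ : σ ^ 2 = 1)
    (hρ : (ρ : ℂ) ∈ sector κ) (y' : Fin 3 → ℝ) :
    ∃ C, ∀ᶠ η in 𝓝[>] (0 : ℝ), ∀ x, ‖rescaledJump φ σ ρ y' η x‖ ≤ C * (height x)⁻¹ ^ 4 := by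
  have hρ₀ : 0 < ρ := by simpa using hρ.1
  obtain ⟨C, hC₀, hC⟩ :=
    hφ.exists_norm_sheetNumerator_arc_sub_le ((ρ : ℂ) • unitSheet σ y') hσ hρ
  have hk₀ : 0 < gap y' / (1 + height y') ^ 2 := by
    have := gap_pos y'
    have := height_pos y'
    positivity
  refine ⟨C / (4 * ρ ^ 2) * (gap y' / (1 + height y') ^ 2)⁻¹ ^ 2, ?_⟩
  filter_upwards [hC, Ioc_mem_nhdsGT one_pos] with η hnum ⟨hη, hη₁⟩ x
  have hle := mul_height_sq_div_le_arcFactor_div_sq y' x hη hη₁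
  have hnum := hnum (y' + η • x)
  rw [rescaledJump_eq φ hσ hρ₀.ne' y' hη.ne']
  have hheight := height_pos (y' + η • x)
  have hheight_x := height_pos x
  set s := height (y' + η • x)
  set k := gap y' / (1 + height y') ^ 2
  set D := arcFactor y' η (y' + η • x) / η ^ 2
  have hD : 0 < D := lt_of_lt_of_le (by positivity) hle
  have hσ_abs : |σ| = 1 := by rw [abs_eq_abs.2 (sq_eq_one_iff.1 hσ), abs_one]
  have hnorm : ‖I * σ / (4 * ρ ^ 2 * s * (D : ℂ) ^ 2)‖ = (4 * ρ ^ 2 * s * D ^ 2)⁻¹ := by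
    rw [norm_div, norm_mul, norm_I, norm_real, Real.norm_eq_abs, hσ_abs]
    simp [abs_of_pos hheight, abs_of_pos hD, abs_of_pos hρ₀]
  rw [norm_smul, norm_smul, hnorm, norm_inv, Real.norm_of_nonneg hη.le]
  calc (4 * ρ ^ 2 * s * D ^ 2)⁻¹ * (η⁻¹ * _)
      ≤ (4 * ρ ^ 2 * s * (k * height x ^ 2 / s) ^ 2)⁻¹ * (η⁻¹ * (C * η * s⁻¹)) := by gcongr
    _ = C / (4 * ρ ^ 2) * k⁻¹ ^ 2 * (height x)⁻¹ ^ 4 := by field_simp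

lemma tendsto_rescaledJump (hφ : ConeRegular φ κ) (hσ : σ ^ 2 = 1)
    (hρ : (ρ : ℂ) ∈ sector κ) (y' x : Fin 3 → ℝ) :
    Tendsto (fun η => rescaledJump φ σ ρ y' η x) (𝓝[>] 0)
      (𝓝 ((σ / height y' * (4 / (hessian y' x + 4) ^ 2)) • φ ((ρ : ℂ) • unitSheet σ y'))) := by
  have hρ₀ : ρ ≠ 0 := ne_of_gt (by simpa using hρ.1)
  have hρ' : (ρ : ℂ) ≠ 0 := ofReal_ne_zero.2 hρ₀
  have hhessian := hessian_nonneg y' x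
  have hhessian' : (hessian y' x + 4 : ℂ) ≠ 0 := by
    exact_mod_cast (by positivity : hessian y' x + 4 ≠ 0)
  have hheight' := height_ne_zero y'
  have hheight : Tendsto (fun η : ℝ => (height (y' + η • x) : ℂ)) (𝓝[≠] 0) (𝓝 (height y')) := by
    have hcont : Continuous fun η : ℝ => (height (y' + η • x) : ℂ) := by fun_prop
    exact (hcont.tendsto' 0 _ (by simp)).mono_left nhdsWithin_le_nhds
  have hfactor := (continuous_ofReal.tendsto _).comp (tendsto_arcFactor_div_sq y' x)
  have hlim := ((tendsto_const_nhds (x := I * (σ : ℂ))).div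
    ((hheight.const_mul (4 * (ρ : ℂ) ^ 2)).mul (hfactor.pow 2)) (mul_ne_zero (mul_ne_zero
      (mul_ne_zero (by norm_num : (4 : ℂ) ≠ 0) (pow_ne_zero 2 hρ')) hheight')
      (pow_ne_zero 2 (ofReal_ne_zero.2 (by positivity))))).smul
    (hφ.tendsto_inv_smul_sheetNumerator_arc_sub hσ hρ y' x)
  refine ((hlim.mono_left (nhdsWithin_mono _ fun η => ne_of_gt)).congr' ?_).trans_eq ?_
  · filter_upwards [self_mem_nhdsWithin] with η (hη : 0 < η)
    exact (rescaledJump_eq φ hσ hρ₀ y' hη.ne' x).symm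
  · rw [← Complex.coe_smul, smul_smul]
    congr 2
    push_cast
    field_simp
    linear_combination (-4 * σ : ℂ) * I_sq

lemma eventually_aestronglyMeasurable_rescaledJump (hφ : ConeRegular φ κ) (hσ : σ ^ 2 = 1)
    (hρ : (ρ : ℂ) ∈ sector κ) (y' : Fin 3 → ℝ) :
    ∀ᶠ η in 𝓝[>] (0 : ℝ), AEStronglyMeasurable (rescaledJump φ σ ρ y' η) volume := by
  have hρ₀ : ρ ≠ 0 := ne_of_gt (by simpa using hρ.1)
  have hsector := (isOpen_sector κ).mem_nhds hρ
  have harc : ∀ᶠ η in 𝓝 0, arc ρ η ∈ sector κ :=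
    (continuous_arc ρ).tendsto' 0 ρ (arc_zero ρ) hsector
  have harc_neg : ∀ᶠ η in 𝓝 0, arc ρ (-η) ∈ sector κ :=
    ((continuous_arc ρ).comp continuous_neg).tendsto' 0 ρ (by simp [arc_zero]) hsector
  filter_upwards [nhdsWithin_le_nhds harc, nhdsWithin_le_nhds harc_neg, self_mem_nhdsWithin]
    with η hη hη_neg (hη₀ : 0 < η)
  have hline : Continuous fun x : Fin 3 → ℝ => y' + η • x := by fun_prop
  have hcont := (hφ.continuous_sheetCoeff hσ hη fun y =>
    det_arc_smul_unitSheet_sub_ne_zero hσ hρ₀ hη₀.ne' y y').comp hline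
  have hcont_neg := (hφ.continuous_sheetCoeff hσ hη_neg fun y =>
    det_arc_smul_unitSheet_sub_ne_zero hσ hρ₀ (neg_ne_zero.2 hη₀.ne') y y').comp hline
  exact ((hcont.sub hcont_neg).const_smul (η ^ 3)).aestronglyMeasurable

lemma tendsto_integral_jump (hφ : ConeRegular φ κ) (hσ : σ ^ 2 = 1)
    (hρ : (ρ : ℂ) ∈ sector κ) (y' : Fin 3 → ℝ) :
    Tendsto (fun η : ℝ => ∫ y, (sheetCoeff ((ρ : ℂ) • unitSheet σ y') φ σ (arc ρ η) y -
        sheetCoeff ((ρ : ℂ) • unitSheet σ y') φ σ (arc ρ (-η)) y)) (𝓝[>] 0)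
      (𝓝 ((σ * (2 * Real.pi ^ 2)) • φ ((ρ : ℂ) • unitSheet σ y'))) := by
  obtain ⟨C, hC⟩ := hφ.exists_norm_rescaledJump_le hσ hρ y'
  have hlim := tendsto_integral_filter_of_dominated_convergence
    (fun x => C * (height x)⁻¹ ^ 4) (hφ.eventually_aestronglyMeasurable_rescaledJump hσ hρ y')
    (hC.mono fun η => Eventually.of_forall)
    ((integrable_inv_height_pow (by simp)).const_mul C)
    (Eventually.of_forall (hφ.tendsto_rescaledJump hσ hρ y'))
  rw [integral_smul_const, integral_const_mul, integral_four_div_hessian_add_four_sq,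
    mul_comm (2 * Real.pi ^ 2), ← mul_assoc, div_mul_cancel₀ σ (height_pos y').ne'] at hlim
  refine hlim.congr' ?_
  filter_upwards [self_mem_nhdsWithin] with η hη
  exact integral_rescaledJump φ σ ρ y' hη

end ConeRegular

end RescaledJump

section Cayley

variable {m : ℕ}

lemma inv_smul_inv {A : HC} (hA : A.det ≠ 0) {c : ℂ} (hc : c ≠ 0) :
    (c • A⁻¹)⁻¹ = c⁻¹ • A := by
  refine Matrix.inv_eq_right_inv ?_
  rw [smul_mul_smul_comm, Matrix.nonsing_inv_mul _ hA.isUnit, mul_inv_cancel₀ hc, one_smul]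

lemma det_smul_inv (c : ℂ) (A : HC) : (c • A⁻¹).det = c ^ 2 * A.det⁻¹ := by
  rw [Matrix.det_smul, Fintype.card_fin, Matrix.det_nonsing_inv, Ring.inverse_eq_inv']

lemma fueterKernel_mul_fueterKernel_smul_inv {A : HC} (hA : A.det ≠ 0) {c : ℂ} (hc : c ≠ 0) :
    fueterKernel A * fueterKernel (c • A⁻¹) = (c ^ 3)⁻¹ • 1 := by
  rw [fueterKernel, fueterKernel, inv_smul_inv hA hc, det_smul_inv, smul_mul_smul_comm,
    mul_smul_comm, Matrix.nonsing_inv_mul _ hA.isUnit, smul_smul]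
  congr 1
  field_simp

lemma det_smul_mul_fueterKernel {A : HC} (hA : A.det ≠ 0) :
    A.det • (A * fueterKernel A) = 1 := by
  rw [fueterKernel, mul_smul_comm, Matrix.mul_nonsing_inv _ hA.isUnit, smul_inv_smul₀ hA]

/-- The inverse of the fractional linear map `fracLin γ`. -/
noncomputable def cayley (Z : HC) : HC := (2 * I) • (1 - Z)⁻¹ - I • 1

lemma γ_denom_cayley (Z : HC) : γ 1 0 * cayley Z + γ 1 1 = (-2 : ℂ) • (1 - Z)⁻¹ := by
  have hγ : γ 1 0 * cayley Z + γ 1 1 = I • cayley Z - 1 := by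
    simp [γ, sub_eq_add_neg]
  rw [hγ, cayley, smul_sub, smul_smul, smul_smul, I_mul_I, mul_left_comm, I_mul_I]
  module

lemma one_sub_fracLin_γ {X : HC} (hX : Nonsing γ X) :
    1 - fracLin γ X = (-2 : ℂ) • (γ 1 0 * X + γ 1 1)⁻¹ := by
  have hnum : γ 0 0 * X + γ 0 1 = γ 1 0 * X + γ 1 1 + (2 : ℂ) • 1 := by
    simp [γ, two_smul]
  rw [fracLin, hnum, add_mul, Matrix.mul_nonsing_inv _ (Ne.isUnit hX), smul_mul_assoc, one_mul]
  module

lemma cayley_fracLin_γ {X : HC} (hX : Nonsing γ X) : cayley (fracLin γ X) = X := by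
  have hγ : γ 1 0 * X + γ 1 1 = I • X - 1 := by
    simp [γ, sub_eq_add_neg]
  rw [cayley, one_sub_fracLin_γ hX, inv_smul_inv hX (by norm_num), hγ, smul_sub, smul_sub,
    smul_smul, smul_smul, smul_smul, show 2 * I * (-2)⁻¹ = -I by ring,
    show -I * I = 1 by linear_combination -I_sq]
  module

variable {Z : HC}

lemma nonsing_γ_cayley (hZ : (1 - Z).det ≠ 0) : Nonsing γ (cayley Z) := by
  rw [Nonsing, γ_denom_cayley, det_smul_inv]
  exact mul_ne_zero (by norm_num) (inv_ne_zero hZ)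

lemma fracLin_γ_cayley (hZ : (1 - Z).det ≠ 0) : fracLin γ (cayley Z) = Z := by
  have hsub := one_sub_fracLin_γ (nonsing_γ_cayley hZ)
  rwa [γ_denom_cayley, inv_smul_inv hZ (by norm_num), smul_inv_smul₀ (by norm_num),
    sub_right_inj] at hsub

/-- The inverse of the conformal action `h ↦ factor γ · (h ∘ fracLin γ)` of `γ⁻¹`. -/
noncomputable def cayleyPullback (F : HC → Val m) (Z : HC) : Val m :=
  (-8 : ℂ) • (fueterKernel (1 - Z) * F (cayley Z))

lemma factor_mul_cayleyPullback (F : HC → Val m) {X : HC} (hX : Nonsing γ X) :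
    factor γ X * cayleyPullback F (fracLin γ X) = F X := by
  rw [cayleyPullback, cayley_fracLin_γ hX, one_sub_fracLin_γ hX, factor, ← fueterKernel,
    Matrix.mul_smul, ← Matrix.mul_assoc, fueterKernel_mul_fueterKernel_smul_inv hX (by norm_num),
    Matrix.smul_mul, Matrix.one_mul, smul_smul]
  norm_num

lemma cayleyPullback_eq {F : HC → Val m} (hZ : (1 - Z).det ≠ 0) {v : Val m}
    (h : F (cayley Z) = factor γ (cayley Z) * v) : cayleyPullback F Z = v := by
  rw [cayleyPullback, h, factor, ← fueterKernel, γ_denom_cayley, ← Matrix.mul_assoc,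
    fueterKernel_mul_fueterKernel_smul_inv hZ (by norm_num), Matrix.smul_mul, Matrix.one_mul,
    smul_smul]
  norm_num

lemma det_smul_mul_cayleyPullback (F : HC → Val m) (hZ : (1 - Z).det ≠ 0) :
    (1 - Z).det • ((1 - Z) * cayleyPullback F Z) = (-8 : ℂ) • F (cayley Z) := by
  rw [cayleyPullback, Matrix.mul_smul, smul_comm, ← Matrix.mul_assoc, ← Matrix.smul_mul,
    det_smul_mul_fueterKernel hZ, Matrix.one_mul]

lemma differentiableAt_cayley (hZ : (1 - Z).det ≠ 0) : DifferentiableAt ℂ cayley Z := by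
  have hsub : DifferentiableAt ℂ (fun Z : HC => 1 - Z) Z := differentiableAt_id.const_sub 1
  have hinv : DifferentiableAt ℂ (fun Z : HC => (1 - Z).det⁻¹ • adj (1 - Z)) Z :=
    (DifferentiableAt.inv (DifferentiableAt.comp (g := fun Z : HC => Z.det) Z
      (hasFDerivAt_det _).differentiableAt hsub) hZ).fun_smul
        (DifferentiableAt.comp (g := adj) Z adj.differentiableAt hsub)
  have hcayley : cayley = fun Z : HC => (2 * I) • ((1 - Z).det⁻¹ • adj (1 - Z)) - I • 1 := by
    funext Z
    rw [cayley, Matrix.inv_def, Ring.inverse_eq_inv', adj_apply]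
  rw [hcayley]
  exact (hinv.fun_const_smul (2 * I)).sub_const _

lemma isOpen_setOf_cayley_mem {W : Set HC} (hW : IsOpen W) :
    IsOpen {Z : HC | (1 - Z).det ≠ 0 ∧ cayley Z ∈ W} := by
  have hcont : ContinuousOn cayley {Z : HC | (1 - Z).det ≠ 0} := fun Z hZ =>
    (differentiableAt_cayley hZ).continuousAt.continuousWithinAt
  exact hcont.isOpen_inter_preimage (isOpen_ne.preimage (by fun_prop)) hW

lemma differentiableAt_cayleyPullback {F : HC → Val m} (hZ : (1 - Z).det ≠ 0)
    (hF : DifferentiableAt ℂ F (cayley Z)) : DifferentiableAt ℂ (cayleyPullback F) Z := by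
  have hkernel : DifferentiableAt ℂ (fun Z : HC => fueterKernel (1 - Z)) Z :=
    DifferentiableAt.comp (g := fueterKernel) Z (hasFDerivAt_fueterKernel hZ).differentiableAt
      (differentiableAt_id.const_sub 1)
  exact (differentiableAt_matrix_mul hkernel
    (DifferentiableAt.comp (g := F) Z hF (differentiableAt_cayley hZ))).fun_const_smul (-8 : ℂ)

end Cayley

open scoped ComplexOrder in
lemma det_one_sub_ne_zero_of_star_eq_neg {n : Type*} [Fintype n] [DecidableEq n]
    {Y : Matrix n n ℂ} (hY : star Y = -Y) : (1 - Y).det ≠ 0 := by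
  have hmul : star (1 - Y) * (1 - Y) = 1 + Y.conjTranspose * Y := by
    rw [← Matrix.star_eq_conjTranspose, star_sub, star_one, hY]
    noncomm_ring
  have hpos :=
    (Matrix.PosDef.one.add_posSemidef (Matrix.posSemidef_conjTranspose_mul_self Y)).det_pos
  rw [← hmul, Matrix.det_mul] at hpos
  exact right_ne_zero_of_mul hpos.ne'

lemma cayley_mem_U2 {Y : HC} (hY : Y ∈ Minkowski) : cayley Y ∈ U2 := by
  have hstar : star Y = -Y := hY
  have hsub := (det_one_sub_ne_zero_of_star_eq_neg hstar).isUnit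
  have hadd : IsUnit (1 + Y).det := by
    have hneg := det_one_sub_ne_zero_of_star_eq_neg (Y := -Y) (by rw [star_neg, hstar])
    rw [sub_neg_eq_add] at hneg
    exact hneg.isUnit
  have hcayley : cayley Y = I • ((1 + Y) * (1 - Y)⁻¹) := by
    rw [show 1 + Y = (2 : ℂ) • 1 - (1 - Y) by module, sub_mul, Matrix.mul_nonsing_inv _ hsub,
      smul_mul_assoc, one_mul, cayley]
    module
  have hstar_sub : star ((1 - Y)⁻¹) = (1 + Y)⁻¹ := by
    rw [Matrix.star_eq_conjTranspose, Matrix.conjTranspose_nonsing_inv,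
      ← Matrix.star_eq_conjTranspose, star_sub, star_one, hstar, sub_neg_eq_add]
  have hstar_add : star (1 + Y) = 1 - Y := by rw [star_add, star_one, hstar, sub_eq_add_neg]
  have hcomm : (1 - Y) * (1 + Y) = (1 + Y) * (1 - Y) := by noncomm_ring
  refine Matrix.mem_unitaryGroup_iff'.2 ?_
  rw [hcayley, star_smul, star_mul, hstar_sub, hstar_add, smul_mul_smul_comm]
  calc (star I * I) • ((1 + Y)⁻¹ * (1 - Y) * ((1 + Y) * (1 - Y)⁻¹))
      = (1 + Y)⁻¹ * ((1 - Y) * (1 + Y)) * (1 - Y)⁻¹ := by simp [mul_assoc]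
    _ = ((1 + Y)⁻¹ * (1 + Y)) * ((1 - Y) * (1 - Y)⁻¹) := by rw [hcomm]; simp only [mul_assoc]
    _ = 1 := by rw [Matrix.nonsing_inv_mul _ hadd, Matrix.mul_nonsing_inv _ hsub, one_mul]

theorem exists_isContinuation {m : ℕ} {f : Minkowski → Val m} (hf : f ∈ V m) :
    ∃ fC : HC → Val m, IsContinuation f fC := by
  obtain ⟨-, W, hW, hU, F, hF, hFf⟩ := hf
  refine ⟨cayleyPullback F, fun Y => ?_, W, hW, hU, F, hF,
    fun X _ hX => (factor_mul_cayleyPullback F hX).symm⟩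
  have hZ := det_one_sub_ne_zero_of_star_eq_neg Y.2
  refine cayleyPullback_eq hZ ?_
  rw [hFf (cayley Y) (cayley_mem_U2 Y.2) (nonsing_γ_cayley hZ)]
  congr 2
  exact Subtype.ext (fracLin_γ_cayley hZ)

lemma isCompact_U2 : IsCompact U2 := by
  have hclosed : IsClosed U2 := isClosed_unitary
  have hbox : IsCompact {X : HC | ∀ i, X i ∈ {v : Fin 2 → ℂ | ∀ j, v j ∈ Metric.closedBall 0 1}} :=
    isCompact_pi_infinite fun _ => isCompact_pi_infinite fun _ => isCompact_closedBall 0 1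
  refine hbox.of_isClosed_subset hclosed fun X hX i j => ?_
  rw [mem_closedBall_zero_iff]
  exact entry_norm_bound_of_unitary hX i j

/-- The factor `(1 - (1 + iε) Y) (1 - Y)⁻¹` as a function of `X = cayley Y`. -/
noncomputable def tilt (ε : ℝ) (X : HC) : HC := 1 - (ε / 2 : ℂ) • (X - I • 1)

lemma tilt_cayley_mul {Y : HC} (hY : (1 - Y).det ≠ 0) (ε : ℝ) :
    tilt ε (cayley Y) * (1 - Y) = 1 - (1 + I * ε : ℂ) • Y := by
  rw [tilt, cayley, sub_mul, smul_mul_assoc, sub_mul, sub_mul, smul_mul_assoc,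
    Matrix.nonsing_inv_mul _ hY.isUnit, smul_mul_assoc, one_mul]
  module

lemma cayley_smul {Y : HC} (hY : (1 - Y).det ≠ 0) (ε : ℝ) :
    cayley ((1 + I * ε : ℂ) • Y) = (cayley Y + I • 1) * (tilt ε (cayley Y))⁻¹ - I • 1 := by
  rw [cayley, ← tilt_cayley_mul hY, Matrix.mul_inv_rev, cayley, sub_add_cancel, smul_mul_assoc]

lemma eventually_tilt {W : Set HC} (hW : IsOpen W) (hU : U2 ⊆ W) :
    ∀ᶠ ε in 𝓝 (0 : ℝ), ∀ X ∈ U2, (tilt ε X).det ≠ 0 ∧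
      (X + I • 1) * (tilt ε X)⁻¹ - I • 1 ∈ W := by
  refine isCompact_U2.eventually_forall_of_forall_eventually fun X hX => ?_
  have htilt : Continuous fun p : ℝ × HC => tilt p.1 p.2 := by
    unfold tilt
    fun_prop
  have htilt_zero : tilt 0 X = 1 := by simp [tilt]
  have hdet : Tendsto (fun p : ℝ × HC => (tilt p.1 p.2).det) (𝓝 (0, X)) (𝓝 1) :=
    htilt.matrix_det.tendsto' _ _ (by rw [htilt_zero, Matrix.det_one])
  have hadj : Tendsto (fun p : ℝ × HC => adj (tilt p.1 p.2)) (𝓝 (0, X)) (𝓝 1) :=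
    (adj.continuous.comp htilt).tendsto' _ _ (by rw [Function.comp_apply, htilt_zero, adj_one])
  have hadd : Tendsto (fun p : ℝ × HC => p.2 + I • 1) (𝓝 (0, X)) (𝓝 (X + I • 1)) :=
    (continuous_snd.add continuous_const).tendsto (0, X)
  have hmap : Tendsto (fun p : ℝ × HC => (p.2 + I • 1) * (tilt p.1 p.2)⁻¹ - I • 1)
      (𝓝 (0, X)) (𝓝 X) := by
    simp only [Matrix.inv_def, Ring.inverse_eq_inv', ← adj_apply]
    simpa using (hadd.mul ((hdet.inv₀ one_ne_zero).smul hadj)).sub_const (I • 1)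
  exact (hdet.eventually_ne one_ne_zero).and (hmap (hW.mem_nhds (hU hX)))

lemma exists_cone_subset {W : Set HC} (hW : IsOpen W) (hU : U2 ⊆ W) :
    ∃ κ : ℝ, 0 < κ ∧ cone κ ⊆ {Z | (1 - Z).det ≠ 0 ∧ cayley Z ∈ W} := by
  obtain ⟨κ, hκ, htilt⟩ := Metric.eventually_nhds_iff.1 (eventually_tilt hW hU)
  refine ⟨κ, hκ, ?_⟩
  rintro - ⟨t, ⟨hre, him⟩, σ, -, y, rfl⟩
  have hY : t.re • unitSheet σ y ∈ Minkowski := Submodule.smul_mem _ _ (unitSheet_mem_minkowski σ y)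
  have hpolar : t • unitSheet σ y = (1 + I * (t.im / t.re : ℝ) : ℂ) • t.re • unitSheet σ y := by
    have hne : (t.re : ℂ) ≠ 0 := ofReal_ne_zero.2 hre.ne'
    rw [← Complex.coe_smul, smul_smul]
    congr 1
    push_cast
    field_simp
    rw [mul_comm I, re_add_im]
  have hdet := det_one_sub_ne_zero_of_star_eq_neg hY
  obtain ⟨htilt_det, htilt_mem⟩ := htilt (y := t.im / t.re)
    (by rwa [Real.dist_eq, sub_zero, abs_div, abs_of_pos hre, div_lt_iff₀ hre]) _ (cayley_mem_U2 hY)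
  rw [hpolar]
  change (_ : HC).det ≠ 0 ∧ _ ∈ W
  rw [cayley_smul hdet, ← tilt_cayley_mul hdet, Matrix.det_mul]
  exact ⟨mul_ne_zero htilt_det hdet, htilt_mem⟩

lemma fderiv_apply_eq_fderiv_restrict {m : ℕ} {f : Minkowski → Val m} {φ : HC → Val m}
    (h : ∀ Y : Minkowski, φ Y = f Y) {Y : Minkowski} (hφ : DifferentiableAt ℂ φ Y)
    (v : Minkowski) : fderiv ℂ φ Y v = fderiv ℝ f Y v := by
  have hrestrict :
      HasFDerivAt f (((fderiv ℂ φ Y).restrictScalars ℝ).comp Minkowski.subtypeL) Y := by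
    have hcomp : HasFDerivAt (fun Z : Minkowski => φ (Minkowski.subtypeL Z))
        (((fderiv ℂ φ Y).restrictScalars ℝ).comp Minkowski.subtypeL) Y :=
      HasFDerivAt.comp (g := φ) Y (hφ.hasFDerivAt.restrictScalars ℝ)
        Minkowski.subtypeL.hasFDerivAt
    rwa [show (fun Z : Minkowski => φ (Minkowski.subtypeL Z)) = f from funext h] at hcomp
  exact (DFunLike.congr_fun hrestrict.fderiv v).symm

lemma LeftRegular.fueterOp_fderiv_eq_zero {m : ℕ} {f : Minkowski → Val m} (hf : LeftRegular f)
    {φ : HC → Val m} (h : ∀ Y : Minkowski, φ Y = f Y) {Y : Minkowski}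
    (hφ : DifferentiableAt ℂ φ Y) : fueterOp (fderiv ℂ φ Y) = 0 := by
  have hpderiv (j : Fin 4) : pderiv j f Y = fderiv ℂ φ Y (et j) :=
    (fderiv_apply_eq_fderiv_restrict h hφ _).symm
  have htime : -(et 0 * fderiv ℂ φ Y (et 0)) = e 0 * fderiv ℂ φ Y (e 0) := by
    have hmap : fderiv ℂ φ Y (-I • e 0) = -I • fderiv ℂ φ Y (e 0) := map_smul _ _ _
    change -((-I • e 0) * fderiv ℂ φ Y (-I • e 0)) = _
    rw [hmap, Matrix.smul_mul, Matrix.mul_smul, smul_smul, neg_mul_neg, I_mul_I, neg_one_smul,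
      neg_neg]
  have hregular := hf.2 Y
  simp only [hpderiv, htime] at hregular
  rwa [fueterOp, Fin.sum_univ_four]

lemma eqOn_zero_sector {E : Type*} [NormedAddCommGroup E] [NormedSpace ℂ E] [CompleteSpace E]
    {G : ℂ → E} {κ : ℝ} (hG : DifferentiableOn ℂ G (sector κ))
    (hreal : ∀ r : ℝ, (r : ℂ) ∈ sector κ → G r = 0) : EqOn G 0 (sector κ) := by
  intro t ht
  have hκ : 0 < κ := pos_of_mul_pos_left ((abs_nonneg _).trans_lt ht.2) ht.1.le
  have hmem {r : ℝ} (hr : 0 < r) : (r : ℂ) ∈ sector κ :=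
    ⟨by simpa using hr, by simpa using mul_pos hκ hr⟩
  have hreal_tendsto : Tendsto (fun r : ℝ => (r : ℂ)) (𝓝[>] 1) (𝓝[≠] 1) := by
    refine tendsto_nhdsWithin_iff.2
      ⟨(continuous_ofReal.tendsto' 1 1 ofReal_one).mono_left nhdsWithin_le_nhds, ?_⟩
    filter_upwards [self_mem_nhdsWithin] with r (hr : 1 < r)
    exact ofReal_ne_one.2 hr.ne'
  have hfrequently : ∃ᶠ z in 𝓝[≠] (1 : ℂ), G z = 0 := by
    refine hreal_tendsto.frequently (Eventually.frequently ?_)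
    filter_upwards [self_mem_nhdsWithin] with r (hr : 1 < r)
    exact hreal r (hmem (zero_lt_one.trans hr))
  exact (hG.analyticOnNhd (isOpen_sector κ)).eqOn_zero_of_preconnected_of_frequently_eq_zero
    (convex_sector κ).isPreconnected (by simpa using hmem one_pos) hfrequently ht

lemma fueterOp_fderiv_eq_zero_of_mem_cone {m : ℕ} {f : Minkowski → Val m} (hf : LeftRegular f)
    {φ : HC → Val m} (h : ∀ Y : Minkowski, φ Y = f Y) {κ : ℝ} {Ω : Set HC} (hΩ : IsOpen Ω)
    (hφ : DifferentiableOn ℂ φ Ω) (hsub : cone κ ⊆ Ω) {Z : HC} (hZ : Z ∈ cone κ) :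
    fueterOp (fderiv ℂ φ Z) = 0 := by
  obtain ⟨t, ht, σ, hσ, y, rfl⟩ := hZ
  have hΩ_of_mem {s : ℂ} (hs : s ∈ sector κ) : s • unitSheet σ y ∈ Ω :=
    hsub (smul_unitSheet_mem_cone hs hσ y)
  refine eqOn_zero_sector (G := fun t => fueterOp (fderiv ℂ φ (t • unitSheet σ y))) ?_ ?_ ht
  · intro s hs
    refine DifferentiableAt.differentiableWithinAt (DifferentiableAt.fun_sum fun j _ => ?_)
    exact differentiableAt_matrix_mul (differentiableAt_const _)
      (differentiableAt_fderiv_line hΩ hφ (unitSheet σ y) (e j) (hΩ_of_mem hs))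
  · intro r hr
    have hY : (r : ℂ) • unitSheet σ y ∈ Minkowski := by
      rw [Complex.coe_smul]
      exact Submodule.smul_mem _ r (unitSheet_mem_minkowski σ y)
    exact hf.fueterOp_fderiv_eq_zero h (Y := ⟨_, hY⟩)
      (hφ.differentiableAt (hΩ.mem_nhds (hΩ_of_mem hr)))

theorem exists_coneRegular {m : ℕ} {f : Minkowski → Val m} {φ : HC → Val m} (hf : LeftRegular f)
    (hφ : IsContinuation f φ) : ∃ κ : ℝ, 0 < κ ∧ ConeRegular φ κ := by
  obtain ⟨hfφ, W, hW, hU, F, hF, hFφ⟩ := hφ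
  have : LocallyCompactSpace HC := inferInstanceAs (LocallyCompactSpace (Fin 2 → Fin 2 → ℂ))
  obtain ⟨K, hK, hUK, hKW⟩ := exists_compact_between isCompact_U2 hW hU
  obtain ⟨κ, hκ, hcone⟩ := exists_cone_subset isOpen_interior hUK
  set Ω : Set HC := {Z | (1 - Z).det ≠ 0 ∧ cayley Z ∈ W}
  have hΩ : IsOpen Ω := isOpen_setOf_cayley_mem hW
  have hφ_eq (Z : HC) (hZ : Z ∈ Ω) : φ Z = cayleyPullback F Z := by
    refine (cayleyPullback_eq hZ.1 ?_).symm
    rw [hFφ _ hZ.2 (nonsing_γ_cayley hZ.1), fracLin_γ_cayley hZ.1]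
  have hφ_diff : DifferentiableOn ℂ φ Ω := DifferentiableOn.congr (fun Z hZ =>
    (differentiableAt_cayleyPullback hZ.1
      (hF.differentiableAt (hW.mem_nhds hZ.2))).differentiableWithinAt) hφ_eq
  have hsub : cone κ ⊆ Ω := fun Z hZ => ⟨(hcone hZ).1, hKW (interior_subset (hcone hZ).2)⟩
  obtain ⟨C, hC⟩ := hK.exists_bound_of_continuousOn (hF.continuousOn.mono hKW)
  refine ⟨κ, hκ, fun Z hZ => hφ_diff.differentiableAt (hΩ.mem_nhds (hsub hZ)),
    fun Z hZ => fueterOp_fderiv_eq_zero_of_mem_cone hf hfφ hΩ hφ_diff hsub hZ,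
    8 * C, fun Z hZ => ?_⟩
  rw [hφ_eq Z (hsub hZ), det_smul_mul_cayleyPullback F (hcone hZ).1, norm_smul, norm_neg,
    Complex.norm_ofNat]
  exact mul_le_mul_of_nonneg_left (hC _ (interior_subset (hcone hZ).2)) (by norm_num)

section Avoids

variable {ρ σ σ' : ℝ}

lemma avoids_of_forall_eventually (hρ : 0 < ρ) (hσ : σ ^ 2 = 1) (hσ' : σ' ^ 2 = 1)
    (y' : Fin 3 → ℝ) {T : Set ℂ}
    (h : ∀ t ∈ T, ∃ d : ℝ, 0 < d ∧ ∀ᶠ s in 𝓝 t, d ≤ |s.im| ∨ d ≤ s.re ∧ σ * σ' = -1) :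
    Avoids ((ρ : ℂ) • unitSheet σ' y') σ T := by
  intro t ht
  obtain ⟨d, hd, hev⟩ := h t ht
  have hnorm : ∀ᶠ s in 𝓝 t, ‖s‖ ≤ ‖t‖ + 1 :=
    continuous_norm.continuousAt.eventually_le_const (lt_add_one ‖t‖)
  have hgap : 0 < 2 * ρ * gap y' := mul_pos (by positivity) (gap_pos y')
  refine IsBigO.of_bound (((1 + (‖t‖ + 1)) / d + 1) ^ 2 / (2 * ρ * gap y')) ?_
  filter_upwards [(hev.and hnorm).prod_inl ⊤] with p hp
  rw [Real.norm_of_nonneg (height_pos _).le, div_mul_eq_mul_div, le_div_iff₀ hgap, mul_comm]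
  exact height_le_mul_norm_det_sub hd hp.2 hρ.le hσ hσ' p.2 y' hp.1

lemma avoids_im_ne_zero (hρ : 0 < ρ) (hσ : σ ^ 2 = 1) (hσ' : σ' ^ 2 = 1) (y' : Fin 3 → ℝ) :
    Avoids ((ρ : ℂ) • unitSheet σ' y') σ {t | t.im ≠ 0} := by
  refine avoids_of_forall_eventually hρ hσ hσ' y' fun t (ht : t.im ≠ 0) =>
    ⟨|t.im| / 2, by positivity, ?_⟩
  filter_upwards [continuous_im.abs.continuousAt.eventually_const_le
    (half_lt_self (abs_pos.2 ht))] with s hs using Or.inl hs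

lemma avoids_re_pos (hρ : 0 < ρ) (hσ : σ ^ 2 = 1) (hσ' : σ' ^ 2 = 1) (h : σ * σ' = -1)
    (y' : Fin 3 → ℝ) : Avoids ((ρ : ℂ) • unitSheet σ' y') σ {t | 0 < t.re} := by
  refine avoids_of_forall_eventually hρ hσ hσ' y' fun t (ht : 0 < t.re) =>
    ⟨t.re / 2, half_pos ht, ?_⟩
  filter_upwards [continuous_re.continuousAt.eventually_const_le (half_lt_self ht)]
    with s hs using Or.inr ⟨hs, h⟩

end Avoids

/-- The part of a sector above (for `s > 0`) or below (for `s < 0`) the real axis. -/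
def halfSector (κ s : ℝ) : Set ℂ := sector κ ∩ {t | 0 < s * t.im}

lemma halfSector_subset_sector (κ s : ℝ) : halfSector κ s ⊆ sector κ := inter_subset_left

lemma halfSector_subset_im_ne_zero (κ s : ℝ) : halfSector κ s ⊆ {t | t.im ≠ 0} :=
  fun _ ht => right_ne_zero_of_mul (ne_of_gt ht.2)

lemma isOpen_halfSector (κ s : ℝ) : IsOpen (halfSector κ s) :=
  (isOpen_sector κ).inter (isOpen_lt continuous_const (continuous_const.mul continuous_im))

lemma isPreconnected_halfSector (κ s : ℝ) : IsPreconnected (halfSector κ s) :=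
  ((convex_sector κ).inter
    (convex_halfSpace_gt (s • imLm).isLinear 0)).isPreconnected

lemma mul_mem_sector {κ R ε σ : ℝ} (hR : 0 < R) (hε : |ε| < κ) (hσ : σ ^ 2 = 1) :
    (R * (1 + I * (σ * ε)) : ℂ) ∈ sector κ := by
  have hσ_abs : |σ| = 1 := by rw [abs_eq_abs.2 (sq_eq_one_iff.1 hσ), abs_one]
  refine ⟨by simpa using hR, ?_⟩
  simpa [abs_mul, hσ_abs, abs_of_pos hR, mul_comm κ] using mul_lt_mul_of_pos_left hε hR

lemma im_mul_one_add (R ε σ : ℝ) : (R * (1 + I * (σ * ε)) : ℂ).im = R * (σ * ε) := by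
  simp

lemma im_mul_one_add_ne_zero {R ε σ : ℝ} (hR : R ≠ 0) (hε : ε ≠ 0) (hσ : σ ^ 2 = 1) :
    (R * (1 + I * (σ * ε)) : ℂ).im ≠ 0 := by
  have hσ₀ : σ ≠ 0 := fun h => by simp [h] at hσ
  rw [im_mul_one_add]
  positivity

namespace ConeRegular

variable {m : ℕ} {φ : HC → Val m} {κ ρ σ σ' : ℝ}

lemma integral_sheetCoeff_sub_of_im_pos (hφ : ConeRegular φ κ) (hσ : σ ^ 2 = 1)
    (hρ : (ρ : ℂ) ∈ sector κ) (y' : Fin 3 → ℝ) {t t' : ℂ} (ht : t ∈ halfSector κ 1)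
    (ht' : t' ∈ halfSector κ (-1)) :
    (∫ y, sheetCoeff ((ρ : ℂ) • unitSheet σ y') φ σ t y) -
        ∫ y, sheetCoeff ((ρ : ℂ) • unitSheet σ y') φ σ t' y =
      (σ * (2 * Real.pi ^ 2)) • φ ((ρ : ℂ) • unitSheet σ y') := by
  have hρ₀ : 0 < ρ := by simpa using hρ.1
  have hA (s : ℝ) : Avoids ((ρ : ℂ) • unitSheet σ y') σ (halfSector κ s) :=
    (avoids_im_ne_zero hρ₀ hσ hσ y').mono (halfSector_subset_im_ne_zero κ s)
  have hconst {s : ℝ} {t t' : ℂ} (ht : t ∈ halfSector κ s) (ht' : t' ∈ halfSector κ s) :=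
    hφ.integral_sheetCoeff_eq hσ (isOpen_halfSector κ s) (isPreconnected_halfSector κ s)
      (halfSector_subset_sector κ s) (hA s) ht ht'
  have hint {s : ℝ} {t : ℂ} (ht : t ∈ halfSector κ s) :=
    hφ.integrable_sheetCoeff hσ (halfSector_subset_sector κ s) (hA s) ht
  have hsector := (isOpen_sector κ).mem_nhds hρ
  have harc : ∀ᶠ η in 𝓝 0, arc ρ η ∈ sector κ :=
    (continuous_arc ρ).tendsto' 0 ρ (arc_zero ρ) hsector
  have harc_neg : ∀ᶠ η in 𝓝 0, arc ρ (-η) ∈ sector κ :=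
    ((continuous_arc ρ).comp continuous_neg).tendsto' 0 ρ (by simp [arc_zero]) hsector
  refine tendsto_nhds_unique (tendsto_const_nhds.congr' ?_) (hφ.tendsto_integral_jump hσ hρ y')
  filter_upwards [nhdsWithin_le_nhds harc, nhdsWithin_le_nhds harc_neg, self_mem_nhdsWithin]
    with η hη hη_neg (hη₀ : 0 < η)
  have himη : 0 < 2 * ρ * η / (1 + η ^ 2) := by positivity
  have hpos : arc ρ η ∈ halfSector κ 1 := ⟨hη, by simpa only [mem_ofPred_eq, arc_im, one_mul]⟩
  have hneg : arc ρ (-η) ∈ halfSector κ (-1) := by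
    refine ⟨hη_neg, ?_⟩
    rwa [mem_ofPred_eq, arc_im, neg_sq, mul_neg, neg_div, neg_mul_neg, one_mul]
  rw [integral_sub (hint hpos) (hint hneg), hconst ht hpos, hconst ht' hneg]

theorem integral_sheetCoeff_sub (hφ : ConeRegular φ κ) (hσ : σ ^ 2 = 1)
    (hρ : (ρ : ℂ) ∈ sector κ) (y' : Fin 3 → ℝ) {t t' : ℂ} (ht : t ∈ halfSector κ σ)
    (ht' : t' ∈ halfSector κ (-σ)) :
    (∫ y, sheetCoeff ((ρ : ℂ) • unitSheet σ y') φ σ t y) -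
        ∫ y, sheetCoeff ((ρ : ℂ) • unitSheet σ y') φ σ t' y =
      (2 * Real.pi ^ 2) • φ ((ρ : ℂ) • unitSheet σ y') := by
  rcases sq_eq_one_iff.1 hσ with rfl | rfl
  · rw [hφ.integral_sheetCoeff_sub_of_im_pos hσ hρ y' ht ht', one_mul]
  · rw [neg_neg] at ht'
    rw [← neg_sub, hφ.integral_sheetCoeff_sub_of_im_pos hσ hρ y' ht' ht, neg_one_mul, neg_smul,
      neg_neg]

lemma integrable_sheetCoeff_of_im_ne_zero (hφ : ConeRegular φ κ) (hσ : σ ^ 2 = 1)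
    (hσ' : σ' ^ 2 = 1) (hρ : 0 < ρ) (y' : Fin 3 → ℝ) {t : ℂ} (ht : t ∈ sector κ)
    (him : t.im ≠ 0) : Integrable (sheetCoeff ((ρ : ℂ) • unitSheet σ' y') φ σ t) :=
  hφ.integrable_sheetCoeff (T := sector κ ∩ {t | t.im ≠ 0}) hσ inter_subset_left
    ((avoids_im_ne_zero hρ hσ hσ' y').mono inter_subset_right) ⟨ht, him⟩

lemma integral_sheetCoeff_opposite_eq (hφ : ConeRegular φ κ) (hσ : σ ^ 2 = 1)
    (hσ' : σ' ^ 2 = 1) (h : σ * σ' = -1) (hρ : 0 < ρ) (y' : Fin 3 → ℝ) {t t' : ℂ}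
    (ht : t ∈ sector κ) (ht' : t' ∈ sector κ) :
    ∫ y, sheetCoeff ((ρ : ℂ) • unitSheet σ' y') φ σ t y =
      ∫ y, sheetCoeff ((ρ : ℂ) • unitSheet σ' y') φ σ t' y :=
  hφ.integral_sheetCoeff_eq hσ (isOpen_sector κ) (convex_sector κ).isPreconnected subset_rfl
    ((avoids_re_pos hρ hσ hσ' h y').mono fun _ ht => ht.1) ht ht'

end ConeRegular

section FormIntegral

variable {m : ℕ} {φ : HC → Val m} {Y₀ : HC} {R ε : ℝ}

lemma integrable_pullback_deformedSheet (hR : 0 < R) {σ : ℝ} (hσ : σ ^ 2 = 1)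
    (h : Integrable (sheetCoeff Y₀ φ σ (R * (1 + I * (σ * ε))))) :
    Integrable (pullback (fueterForm φ Y₀) (deformedSheet R ε σ)) := by
  rw [funext (pullback_deformedSheet hR ε hσ Y₀ φ)]
  exact (h.comp_smul (inv_ne_zero hR.ne')).smul (R⁻¹ ^ 3)

lemma integral_pullback_deformedSheet (hR : 0 < R) (ε : ℝ) {σ : ℝ} (hσ : σ ^ 2 = 1) (Y₀ : HC)
    (φ : HC → Val m) :
    ∫ y, pullback (fueterForm φ Y₀) (deformedSheet R ε σ) y =
      ∫ y, sheetCoeff Y₀ φ σ (R * (1 + I * (σ * ε))) y := by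
  rw [funext (pullback_deformedSheet hR ε hσ Y₀ φ), integral_smul,
    Measure.integral_comp_inv_smul, smul_smul, Module.finrank_fin_fun,
    abs_of_pos (pow_pos hR 3), ← mul_pow, inv_mul_cancel₀ hR.ne', one_pow, one_smul]

/-- The `(a, b)` matrix entry as a continuous linear functional. -/
noncomputable def entryCLM (a : Fin 2) (b : Fin m) : Val m →L[ℝ] ℂ :=
  LinearMap.toContinuousLinearMap (Matrix.entryLinearMap ℝ ℂ a b)

variable {ω : HC → (Fin 3 → HC) → Val m}

lemma formIntegrable_of_integrable
    (h : ∀ σ : ℝ, σ ^ 2 = 1 → Integrable (pullback ω (deformedSheet R ε σ))) :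
    FormIntegrable ω R ε := fun a b =>
  ⟨(entryCLM a b).integrable_comp (h 1 (by norm_num)),
    (entryCLM a b).integrable_comp (h (-1) (by norm_num))⟩

lemma formIntegral_eq_add
    (h : ∀ σ : ℝ, σ ^ 2 = 1 → Integrable (pullback ω (deformedSheet R ε σ))) {σ : ℝ}
    (hσ : σ ^ 2 = 1) :
    formIntegral ω R ε =
      (∫ y, pullback ω (deformedSheet R ε σ) y) + ∫ y, pullback ω (deformedSheet R ε (-σ)) y := by
  have hone : formIntegral ω R ε =
      (∫ y, pullback ω (deformedSheet R ε 1) y) + ∫ y, pullback ω (deformedSheet R ε (-1)) y := by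
    ext a b
    exact congrArg₂ (· + ·) ((entryCLM a b).integral_comp_comm (h 1 (by norm_num)))
      ((entryCLM a b).integral_comp_comm (h (-1) (by norm_num)))
  rcases sq_eq_one_iff.1 hσ with rfl | rfl
  · exact hone
  · rw [hone, neg_neg, add_comm]

end FormIntegral

lemma det_im_eq_zero_of_mem_minkowski {Y : HC} (hY : Y ∈ Minkowski) : Y.det.im = 0 := by
  have hstar : star Y = -Y := hY
  refine conj_eq_iff_im.1 ?_
  change star Y.det = Y.det
  rw [← Matrix.det_conjTranspose, ← Matrix.star_eq_conjTranspose, hstar, Matrix.det_neg,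
    Fintype.card_fin, neg_one_sq, one_mul]

lemma exists_eq_smul_unitSheet {Y : HC} (hY : Y ∈ Minkowski) (hdet : Y.det.re < 0) :
    ∃ ρ : ℝ, 0 < ρ ∧ ∃ σ : ℝ, σ ^ 2 = 1 ∧ ∃ y, Y = (ρ : ℂ) • unitSheet σ y := by
  have hρ : 0 < √(-Y.det.re) := Real.sqrt_pos.2 (neg_pos.2 hdet)
  have hmem : Y ∈ hyperboloid √(-Y.det.re) := by
    refine ⟨hY, ?_⟩
    rw [← ofReal_pow, Real.sq_sqrt (neg_pos.2 hdet).le, ofReal_neg, neg_neg]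
    exact (conj_eq_iff_re.1 (conj_eq_iff_im.2 (det_im_eq_zero_of_mem_minkowski hY))).symm
  rw [← range_sheet] at hmem
  obtain ⟨y, hy⟩ | ⟨y, hy⟩ := hmem
  · exact ⟨_, hρ, 1, by norm_num, _, hy.symm.trans (sheet_eq_smul_unitSheet hρ 1 y)⟩
  · exact ⟨_, hρ, -1, by norm_num, _, hy.symm.trans (sheet_eq_smul_unitSheet hρ (-1) y)⟩

lemma exists_eq_smul_of_mem_deformedHyperboloid {R : ℝ} (hR : 0 < R) {ε : ℝ} {Z : HC}
    (hZ : Z ∈ deformedHyperboloid R ε) :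
    ∃ σ : ℝ, σ ^ 2 = 1 ∧ ∃ y, Z = (R * (1 + I * (σ * ε)) : ℂ) • unitSheet σ y := by
  rw [← range_deformedSheet] at hZ
  obtain ⟨y, hy⟩ | ⟨y, hy⟩ := hZ
  · exact ⟨1, by norm_num, _,
      hy.symm.trans (deformedSheet_eq_smul_unitSheet hR ε (by norm_num) y)⟩
  · exact ⟨-1, by norm_num, _,
      hy.symm.trans (deformedSheet_eq_smul_unitSheet hR ε (by norm_num) y)⟩

lemma deformedHyperboloid_subset_cone {κ R ε : ℝ} (hR : 0 < R) (hε : |ε| < κ) :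
    deformedHyperboloid R ε ⊆ cone κ := fun Z hZ => by
  obtain ⟨σ, hσ, y, rfl⟩ := exists_eq_smul_of_mem_deformedHyperboloid hR hZ
  exact smul_unitSheet_mem_cone (mul_mem_sector hR hε hσ) hσ y

lemma det_sub_ne_zero_of_mem_deformedHyperboloid {R ε : ℝ} (hR : 0 < R) (hε : ε ≠ 0) {Y₀ : HC}
    (hY₀ : Y₀ ∈ Minkowski) (hdet : Y₀.det.re < 0) {Z : HC} (hZ : Z ∈ deformedHyperboloid R ε) :
    (Z - Y₀).det ≠ 0 := by
  obtain ⟨σ, hσ, y, rfl⟩ := exists_eq_smul_of_mem_deformedHyperboloid hR hZ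
  obtain ⟨ρ, hρ, σ', hσ', y', rfl⟩ := exists_eq_smul_unitSheet hY₀ hdet
  exact (avoids_im_ne_zero hρ hσ hσ' y').det_ne_zero (im_mul_one_add_ne_zero hR.ne' hε hσ) y

namespace ConeRegular

variable {m : ℕ} {φ : HC → Val m} {κ R R' ε : ℝ} {Y₀ : HC}

lemma integrable_pullback_fueterForm (hφ : ConeRegular φ κ) (hY₀ : Y₀ ∈ Minkowski)
    (hdet : Y₀.det.re < 0) (hR : 0 < R) (hε₀ : ε ≠ 0) (hε : |ε| < κ) {σ : ℝ} (hσ : σ ^ 2 = 1) :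
    Integrable (pullback (fueterForm φ Y₀) (deformedSheet R ε σ)) := by
  obtain ⟨ρ, hρ, σ', hσ', y', rfl⟩ := exists_eq_smul_unitSheet hY₀ hdet
  exact integrable_pullback_deformedSheet hR hσ (hφ.integrable_sheetCoeff_of_im_ne_zero hσ hσ' hρ
    y' (mul_mem_sector hR hε hσ) (im_mul_one_add_ne_zero hR.ne' hε₀ hσ))

theorem formIntegrable_fueterForm (hφ : ConeRegular φ κ) (hY₀ : Y₀ ∈ Minkowski)
    (hdet : Y₀.det.re < 0) (hR : 0 < R) (hε₀ : ε ≠ 0) (hε : |ε| < κ) :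
    FormIntegrable (fueterForm φ Y₀) R ε :=
  formIntegrable_of_integrable fun _ =>
    hφ.integrable_pullback_fueterForm hY₀ hdet hR hε₀ hε

theorem formIntegral_fueterForm_sub (hφ : ConeRegular φ κ) (hY₀ : Y₀ ∈ Minkowski)
    (hdet : Y₀.det.re < 0) (hR : 0 < R) (hR' : 0 < R') (hε₀ : 0 < ε) (hε : ε < κ) :
    formIntegral (fueterForm φ Y₀) R ε - formIntegral (fueterForm φ Y₀) R' (-ε) =
      (2 * Real.pi ^ 2) • φ Y₀ := by
  have hε_abs : |ε| < κ := by rwa [abs_of_pos hε₀]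
  have hε_neg : |-ε| < κ := by rwa [abs_neg]
  have hint (σ : ℝ) (hσ : σ ^ 2 = 1) :=
    hφ.integrable_pullback_fueterForm hY₀ hdet hR hε₀.ne' hε_abs hσ
  have hint_neg (σ : ℝ) (hσ : σ ^ 2 = 1) :=
    hφ.integrable_pullback_fueterForm hY₀ hdet hR' (neg_ne_zero.2 hε₀.ne') hε_neg hσ
  obtain ⟨ρ, hρ, σ, hσ, y', rfl⟩ := exists_eq_smul_unitSheet hY₀ hdet
  have hσ_neg : (-σ) ^ 2 = 1 := by rwa [neg_sq]
  have hρ_mem : (ρ : ℂ) ∈ sector κ := by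
    simpa using mul_mem_sector (ε := 0) hρ (by simpa using hε₀.trans hε) hσ
  have hopposite := hφ.integral_sheetCoeff_opposite_eq hσ_neg hσ (by linarith) hρ y'
    (mul_mem_sector hR hε_abs hσ_neg) (mul_mem_sector hR' hε_neg hσ_neg)
  have hσσ : σ * σ = 1 := by rwa [← sq]
  have hupper : (R * (1 + I * (σ * ε)) : ℂ) ∈ halfSector κ σ := by
    refine ⟨mul_mem_sector hR hε_abs hσ, ?_⟩
    rw [mem_ofPred_eq, im_mul_one_add]
    linear_combination mul_pos hR hε₀ - R * ε * hσσ
  have hlower : (R' * (1 + I * (σ * (-ε : ℝ))) : ℂ) ∈ halfSector κ (-σ) := by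
    refine ⟨mul_mem_sector hR' hε_neg hσ, ?_⟩
    rw [mem_ofPred_eq, im_mul_one_add]
    linear_combination mul_pos hR' hε₀ - R' * ε * hσσ
  rw [formIntegral_eq_add hint hσ, formIntegral_eq_add hint_neg hσ,
    integral_pullback_deformedSheet hR ε hσ, integral_pullback_deformedSheet hR ε hσ_neg,
    integral_pullback_deformedSheet hR' (-ε) hσ, integral_pullback_deformedSheet hR' (-ε) hσ_neg,
    hopposite, add_sub_add_right_eq_sub, hφ.integral_sheetCoeff_sub hσ hρ_mem y' hupper hlower]

end ConeRegular

end MinkowskiFueter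

theorem mainTheorem9 (m : ℕ) (f : MinkowskiFueter.Minkowski → MinkowskiFueter.Val m)
    (hf : f ∈ MinkowskiFueter.V m) :
    (∃ fC : MinkowskiFueter.HC → MinkowskiFueter.Val m, MinkowskiFueter.IsContinuation f fC) ∧
    ∀ fC : MinkowskiFueter.HC → MinkowskiFueter.Val m, MinkowskiFueter.IsContinuation f fC →
      ∃ ε₀ : ℝ, 0 < ε₀ ∧ ∀ ε : ℝ, 0 < ε → ε < ε₀ → ∀ R R' : ℝ, 0 < R → 0 < R' →
        (∀ Z ∈ MinkowskiFueter.deformedHyperboloid R ε ∪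
            MinkowskiFueter.deformedHyperboloid R' (-ε), DifferentiableAt ℂ fC Z) ∧
        ∀ Y₀ : MinkowskiFueter.Minkowski, (Y₀ : MinkowskiFueter.HC).det.re < 0 →
          (∀ Z ∈ MinkowskiFueter.deformedHyperboloid R ε ∪
            MinkowskiFueter.deformedHyperboloid R' (-ε), (Z - Y₀).det ≠ 0) ∧
          MinkowskiFueter.FormIntegrable (MinkowskiFueter.fueterForm fC Y₀) R ε ∧
          MinkowskiFueter.FormIntegrable (MinkowskiFueter.fueterForm fC Y₀) R' (-ε) ∧
          f Y₀ = (1 / (2 * Real.pi ^ 2) : ℝ) •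
            (MinkowskiFueter.formIntegral (MinkowskiFueter.fueterForm fC Y₀) R ε -
              MinkowskiFueter.formIntegral (MinkowskiFueter.fueterForm fC Y₀) R' (-ε)) := by
  refine ⟨MinkowskiFueter.exists_isContinuation hf, fun fC hfC => ?_⟩
  obtain ⟨κ, hκ, hreg⟩ := MinkowskiFueter.exists_coneRegular hf.1 hfC
  refine ⟨κ, hκ, fun ε hε₀ hε R R' hR hR' => ?_⟩
  have hε_abs : |ε| < κ := by rwa [abs_of_pos hε₀]
  have hε_neg_abs : |-ε| < κ := by rwa [abs_neg]
  have hε_neg : -ε ≠ 0 := neg_ne_zero.2 hε₀.ne'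
  refine ⟨fun Z hZ => ?_, fun ⟨Y₀, hY₀⟩ hdet => ⟨fun Z hZ => ?_, ?_, ?_, ?_⟩⟩
  · exact hreg.differentiableAt Z
      (hZ.elim (fun h => MinkowskiFueter.deformedHyperboloid_subset_cone hR hε_abs h)
        fun h => MinkowskiFueter.deformedHyperboloid_subset_cone hR' hε_neg_abs h)
  · exact hZ.elim
      (MinkowskiFueter.det_sub_ne_zero_of_mem_deformedHyperboloid hR hε₀.ne' hY₀ hdet)
      (MinkowskiFueter.det_sub_ne_zero_of_mem_deformedHyperboloid hR' hε_neg hY₀ hdet)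
  · exact hreg.formIntegrable_fueterForm hY₀ hdet hR hε₀.ne' hε_abs
  · exact hreg.formIntegrable_fueterForm hY₀ hdet hR' hε_neg hε_neg_abs
  · rw [hreg.formIntegral_fueterForm_sub hY₀ hdet hR hR' hε₀ hε, one_div,
      inv_smul_smul₀ (by positivity), hfC.1 ⟨Y₀, hY₀⟩]
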